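/- **Setting.** Let $u\in[-1,1]$, $v\in\mathbb R$. A dyadic interval is an interval $2^j(k+(0,1))$ with $j,k\in\mathbb Z$, and $D_{u,v}$ is the collection of intervals $2^uJ+v$ with $J$ dyadic. A bi-tile is a rectangle $P=I_P\times\omega_P$ of area $2$ with $I_P\in D_{-u,0}$, $\omega_P\in D_{u,v}$; $\overline{\bf P}$ is the set of all bi-tiles. Let $\omega_{P_1},\omega_{P_2}$ be the left and right halves of $\omega_P$ and $P_i=I_P\times\omega_{P_i}$. Let $\tilde\chi_I(x)=(1+(|x-x_I|/|I|)^2)^{-1/2}$, where $x_I$ is the center of $I$. A wave packet on $P_1$ is a function $\phi_{P_1}$ whose Fourier transform is supported in $\frac9{10}\omega_{P_1}$ and with $|\phi_{P_1}|\le K_M|I_P|^{-1/2}\tilde\chi_{I_P}^M$ for all $M\in\mathbb N$. Write $P\le P'$ if $I_P\subseteq I_{P'}$ and $\omega_{P'}\subseteq\omega_P$. A finite set $T$ of bi-tiles is a tree with top $P_T\in\overline{\bf P}$ if $P\le P_T$ for all $P\in T$; it is a $2$-tree if moreover $\omega_{(P_T)_2}\subseteq\omega_{P_2}$ for all $P\in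 T$. Put $I_T=I_{P_T}$. Trees $T,T'$ are strongly $1$-disjoint if $P_1\ne P_1'$ for all $P\in T$, $P'\in T'$, and if $\omega_{P_1}\subsetneq\omega_{P'_1}$ with $P\in T$, $P'\in T'$ implies $I_{P'}\cap I_T=\emptyset$, and similarly with $T,T'$ reversed. For a finite collection ${\bf P}$ of bi-tiles and complex numbers $a_{P_1}$ put $${\rm size}_1=\sup_T\Big(\frac1{|I_T|}\sum_{P\in T}|a_{P_1}|^2\Big)^{1/2},\qquad \widetilde{\rm energy}_1=\sup_{n\in\mathbb Z}\sup_{\bf T}2^n\Big(\sum_{T\in{\bf T}}|I_T|\Big)^{1/2},$$ where $T$ ranges over the $2$-trees in ${\bf P}$, and ${\bf T}$ over the collections of pairwise strongly $1$-disjoint $2$-trees in ${\bf P}$ such that $(\sum_{P\in T}|a_{P_1}|^2)^{1/2}\ge2^n|I_T|^{1/2}$ for all $T\in{\bf T}$ and $(\sum_{P\in T'}|a_{P_1}|^2)^{1/2}\le2^{n+1}|I_{T'}|^{1/2}$ for all trees $T'\subseteq T\in{\bf T}$. Let $N:\mathbb R\to\mathbb R$ and $G:\mathbb R\to\mathbb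 C$ be measurable, let $\phi_{P_1}$ be a wave packet on $P_1$ for each $P\in{\bf P}$, assume that the pairings $b_{P_2}=\langle G\chi_{\{N(x)\in\omega_{P_2}\}},\phi_{P_1}\rangle$ are absolutely convergent, and put $m(P)=\int|G|\chi_{\{N(x)\in\omega_P\}}\tilde\chi_{I_P}^C\,dx$, $${\rm size}=\sup_{P\in{\bf P}}\ \sup_{P'\in\overline{\bf P},\,P\le P'}\frac{m(P')}{|I_{P'}|},\qquad {\rm size}_e=\sup_{P\in{\bf P}}\frac{m(P)}{|I_P|},\qquad \widetilde{\rm energy}=\sup_{n\in\mathbb Z}\sup_{\bf D}2^n\sum_{P'\in{\bf D}}|I_{P'}|,$$ where ${\bf D}$ ranges over the collections of pairwise disjoint $P'\in\overline{\bf P}$ such that $P\le P'$ for some $P\in{\bf P}$ and $m(P')\ge2^n|I_{P'}|$. (These quantities may be $+\infty$; $0\cdot\infty=0$ and $0^0=1$.) **Proposition.** For every sufficiently large fixed constant $C$ and all $0\le\theta_1<1$, $0<\theta_2\le1$ with $\theta_1+2\theta_2=1$ there is a constant $A$, depending only on $C$, $\theta_1,\theta_2$ and $(K_M)_M$, such that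 for all $u,v,{\bf P},\phi,N,G$ as above and all complex numbers $a_{P_1}$, $P\in{\bf P}$ (in particular for $a_{P_1}=\langle f_1,\phi_{P_1}\rangle$), $$\Big|\sum_{P\in{\bf P}}a_{P_1}b_{P_2}\Big|\le A\;{\rm size}_1^{\theta_1}\,{\rm size}^{\theta_2}\,\widetilde{\rm energy}_1^{\,1-\theta_1}\,\widetilde{\rm energy}^{\,1-\theta_2}.$$ Moreover, if the bi-tiles of ${\bf P}$ are pairwise disjoint, the inequality holds with ${\rm size}$ replaced by ${\rm size}_e$. -/

import Mathlib

open scoped ENNReal NNReal FourierTransform ComplexConjugate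

namespace Bicarleson

noncomputable section

/-- The standard dyadic intervals `2 ^ j * (k + (0, 1))`, `j, k ∈ ℤ`. -/
def dyadicIntervals : Set (Set ℝ) :=
  {J | ∃ j k : ℤ, J = Set.Ioo ((2 : ℝ) ^ j * k) ((2 : ℝ) ^ j * (k + 1))}

/-- The grid `D_{u,v}` of all intervals `2 ^ u * J + v` with `J` a standard dyadic interval. -/
def grid (u v : ℝ) : Set (Set ℝ) :=
  {J | ∃ J₀ ∈ dyadicIntervals, J = (fun x : ℝ => (2 : ℝ) ^ u * x + v) '' J₀}

/-- A bi-tile associated to the parameters `u, v`, i.e. a rectangle `I × ω` of area `2` with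
`I ∈ D_{-u,0}` and `ω ∈ D_{u,v}`. It is encoded by the scale `j` and the position `k` of `I`
and by the position `l` of `ω`; the scale of `ω` is then forced to be `1 - j` by the area.
See `BiTile.mem_grid` and `BiTile.exists_of_mem_grid` below. -/
@[ext]
structure BiTile (u v : ℝ) where
  /-- the scale of the time interval -/
  j : ℤ
  /-- the position of the time interval -/
  k : ℤ
  /-- the position of the frequency interval -/
  l : ℤ

namespace BiTile

variable {u v : ℝ}

/-- The length `|I_P|` of the time interval. -/
def len (P : BiTile u v) : ℝ := (2 : ℝ) ^ (-u) * (2 : ℝ) ^ P.j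

/-- The length `|ω_P|` of the frequency interval. -/
def freqLen (P : BiTile u v) : ℝ := (2 : ℝ) ^ u * (2 : ℝ) ^ (1 - P.j)

/-- The left endpoint of the frequency interval. -/
def freqLeft (P : BiTile u v) : ℝ := P.freqLen * P.l + v

/-- The time interval `I_P`. -/
def I (P : BiTile u v) : Set ℝ := Set.Ioo (P.len * P.k) (P.len * (P.k + 1))

/-- The frequency interval `ω_P`. -/
def ω (P : BiTile u v) : Set ℝ := Set.Ioo P.freqLeft (P.freqLeft + P.freqLen)

/-- The frequency interval `ω_{P_1}` of the sub-tile `P_1`: the left half of `ω_P`. -/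
def ω₁ (P : BiTile u v) : Set ℝ := Set.Ioo P.freqLeft (P.freqLeft + P.freqLen / 2)

/-- The frequency interval `ω_{P_2}` of the sub-tile `P_2`: the right half of `ω_P`. -/
def ω₂ (P : BiTile u v) : Set ℝ :=
  Set.Ioo (P.freqLeft + P.freqLen / 2) (P.freqLeft + P.freqLen)

/-- The interval `(9/10) ω_{P_1}`, with the same center as `ω_{P_1}`, whose length is
`|ω_P| / 2`. -/
def coreω₁ (P : BiTile u v) : Set ℝ :=
  Set.Ioo (P.freqLeft + P.freqLen / 4 - 9 / 10 * (P.freqLen / 4))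
    (P.freqLeft + P.freqLen / 4 + 9 / 10 * (P.freqLen / 4))

/-- The bi-tile as a rectangle in the phase plane. -/
def rect (P : BiTile u v) : Set (ℝ × ℝ) := P.I ×ˢ P.ω

/-- The sub-tile `P_1` as a rectangle in the phase plane. -/
def tile₁ (P : BiTile u v) : Set (ℝ × ℝ) := P.I ×ˢ P.ω₁

/-- The center of the time interval. -/
def center (P : BiTile u v) : ℝ := P.len * (P.k + 1 / 2)

/-- The approximate cutoff function of the time interval. -/
def cutoff (P : BiTile u v) (x : ℝ) : ℝ :=
  (1 + (|x - P.center| / P.len) ^ 2) ^ (-(1 / 2) : ℝ)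

/-- The classical ordering of bi-tiles. -/
def le (P P' : BiTile u v) : Prop := P.I ⊆ P'.I ∧ P'.ω ⊆ P.ω

theorem len_pos (P : BiTile u v) : 0 < P.len := by unfold len; positivity

theorem freqLen_pos (P : BiTile u v) : 0 < P.freqLen := by unfold freqLen; positivity

theorem area (P : BiTile u v) : P.len * P.freqLen = 2 := by
  have h1 : (2 : ℝ) ^ (-u) * (2 : ℝ) ^ u = 1 := by
    rw [← Real.rpow_add (by norm_num)]; simp
  have h2 : (2 : ℝ) ^ P.j * (2 : ℝ) ^ (1 - P.j) = 2 := by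
    rw [← zpow_add₀ (by norm_num)]; simp
  calc P.len * P.freqLen
      = ((2 : ℝ) ^ (-u) * (2 : ℝ) ^ u) * ((2 : ℝ) ^ P.j * (2 : ℝ) ^ (1 - P.j)) := by
        unfold len freqLen; ring
    _ = 2 := by rw [h1, h2]; norm_num

theorem image_Ioo_grid (u v a b : ℝ) :
    (fun x : ℝ => (2 : ℝ) ^ u * x + v) '' Set.Ioo a b
      = Set.Ioo ((2 : ℝ) ^ u * a + v) ((2 : ℝ) ^ u * b + v) := by
  have h : (0 : ℝ) < (2 : ℝ) ^ u := by positivity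
  rw [← Set.image_image (fun y => y + v) (fun x => (2 : ℝ) ^ u * x), Set.image_mul_left_Ioo h,
    Set.image_add_const_Ioo]

theorem I_eq (P : BiTile u v) : P.I = (fun x : ℝ => (2 : ℝ) ^ (-u) * x + 0) ''
    Set.Ioo ((2 : ℝ) ^ P.j * P.k) ((2 : ℝ) ^ P.j * (P.k + 1)) := by
  rw [image_Ioo_grid]; unfold I len; congr 1 <;> ring

theorem ω_eq (P : BiTile u v) : P.ω = (fun x : ℝ => (2 : ℝ) ^ u * x + v) ''
    Set.Ioo ((2 : ℝ) ^ (1 - P.j) * P.l) ((2 : ℝ) ^ (1 - P.j) * (P.l + 1)) := by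
  rw [image_Ioo_grid]; unfold ω freqLeft freqLen; congr 1 <;> ring

theorem mem_grid (P : BiTile u v) : P.I ∈ grid (-u) 0 ∧ P.ω ∈ grid u v :=
  ⟨⟨_, ⟨P.j, P.k, rfl⟩, P.I_eq⟩, ⟨_, ⟨1 - P.j, P.l, rfl⟩, P.ω_eq⟩⟩

/-- Every rectangle of area `2` with sides in the two grids is a bi-tile. -/
theorem exists_of_mem_grid {J W : Set ℝ} (hJ : J ∈ grid (-u) 0) (hW : W ∈ grid u v)
    (harea : MeasureTheory.volume J * MeasureTheory.volume W = 2) :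
    ∃ P : BiTile u v, P.I = J ∧ P.ω = W := by
  obtain ⟨_, ⟨j, k, rfl⟩, rfl⟩ := hJ
  obtain ⟨_, ⟨i, l, rfl⟩, rfl⟩ := hW
  have hi : i = 1 - j := by
    rw [image_Ioo_grid, image_Ioo_grid, Real.volume_Ioo, Real.volume_Ioo,
      ← ENNReal.ofReal_mul' (by
        have : (0 : ℝ) < (2 : ℝ) ^ u * (2 : ℝ) ^ i := by positivity
        linarith)] at harea
    replace harea := ENNReal.ofReal_eq_ofNat.1 harea
    have h1 : (2 : ℝ) ^ (-u) * (2 : ℝ) ^ u = 1 := by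
      rw [← Real.rpow_add (by norm_num)]; simp
    have key : (2 : ℝ) ^ (j + i) = (2 : ℝ) ^ (1 : ℤ) := by
      rw [zpow_add₀ (by norm_num), zpow_one]
      linear_combination harea - (2 : ℝ) ^ j * (2 : ℝ) ^ i * h1
    have := zpow_right_injective₀ (by norm_num : (0 : ℝ) < 2) (by norm_num) key
    omega
  subst hi
  exact ⟨⟨j, k, l⟩, I_eq _, ω_eq _⟩

end BiTile

variable {u v : ℝ}

/-- `φ` is a wave packet on the tile `P_1`: its Fourier transform vanishes outside
`(9/10) ω_{P_1}`, and for every `M` it is bounded by `K M * |I_P| ^ (-1/2)` times the `M`-th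
power of the cutoff function of `I_P`. -/
structure IsWavePacket (K : ℕ → ℝ) (P : BiTile u v) (φ : ℝ → ℂ) : Prop where
  measurable : Measurable φ
  fourier_support : Function.support (𝓕 φ) ⊆ P.coreω₁
  decay : ∀ (M : ℕ) (x : ℝ), ‖φ x‖ ≤ K M * P.len ^ (-(1 / 2) : ℝ) * P.cutoff x ^ M

/-! ### Trees -/

/-- `T` is a tree with top `top`; the top need not belong to `T`. -/
def IsTree (T : Finset (BiTile u v)) (top : BiTile u v) : Prop := ∀ P ∈ T, P.le top

/-- `T` is a `2`-tree with top `top`. -/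
def IsTwoTree (T : Finset (BiTile u v)) (top : BiTile u v) : Prop :=
  IsTree T top ∧ ∀ P ∈ T, top.ω₂ ⊆ P.ω₂

/-- The trees `t.1` and `t'.1`, with tops `t.2` and `t'.2`, are strongly `1`-disjoint: they share
no tile `P_1`, and whenever `ω_{P_1} ⊊ ω_{P'_1}` for `P` in one of them and `P'` in the other, the
time interval of `P'` is disjoint from the time interval of the top of the tree of `P`. -/
def StronglyDisjoint (t t' : Finset (BiTile u v) × BiTile u v) : Prop :=
  ∀ P ∈ t.1, ∀ P' ∈ t'.1, P.tile₁ ≠ P'.tile₁ ∧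
    (P.ω₁ ⊂ P'.ω₁ → Disjoint P'.I t.2.I) ∧ (P'.ω₁ ⊂ P.ω₁ → Disjoint P.I t'.2.I)

/-! ### Size and modified energy of the first sequence -/

/-- `(∑_{P ∈ T} |a_{P_1}|^2)^{1/2}`. -/
def l2norm (a : BiTile u v → ℂ) (T : Finset (BiTile u v)) : ℝ := √(∑ P ∈ T, ‖a P‖ ^ 2)

/-- `size_1`: the supremum of `(|I_T|^{-1} ∑_{P ∈ T} |a_{P_1}|^2)^{1/2}` over all trees `T` in
`𝒬` which are `i`-trees for some `i ≠ 1`, i.e. over all `2`-trees in `𝒬`. -/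
def size₁ (𝒬 : Finset (BiTile u v)) (a : BiTile u v → ℂ) : ℝ≥0∞ :=
  ⨆ (T : Finset (BiTile u v)) (top : BiTile u v) (_ : T ⊆ 𝒬) (_ : IsTwoTree T top),
    ENNReal.ofReal (√((1 / top.len) * ∑ P ∈ T, ‖a P‖ ^ 2))

/-- The collections `𝒯` of strongly `1`-disjoint `2`-trees in `𝒬` that compete at level `n` in the
definition of the modified energy. Trees are paired with their tops. The upper bound is required for
all sub-trees, of whatever type and with whatever top. -/
structure IsEnergyFamily (𝒬 : Finset (BiTile u v)) (a : BiTile u v → ℂ) (n : ℤ)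
    (𝒯 : Set (Finset (BiTile u v) × BiTile u v)) : Prop where
  subset : ∀ t ∈ 𝒯, t.1 ⊆ 𝒬
  isTwoTree : ∀ t ∈ 𝒯, IsTwoTree t.1 t.2
  disjoint : 𝒯.Pairwise StronglyDisjoint
  lower : ∀ t ∈ 𝒯, (2 : ℝ) ^ n * √t.2.len ≤ l2norm a t.1
  upper : ∀ t ∈ 𝒯, ∀ (T' : Finset (BiTile u v)) (top' : BiTile u v), T' ⊆ t.1 → IsTree T' top' →
    l2norm a T' ≤ (2 : ℝ) ^ (n + 1) * √top'.len

/-- The modified energy of the first sequence. -/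
def energy₁ (𝒬 : Finset (BiTile u v)) (a : BiTile u v → ℂ) : ℝ≥0∞ :=
  ⨆ (n : ℤ) (𝒯 : Set (Finset (BiTile u v) × BiTile u v)) (_ : IsEnergyFamily 𝒬 a n 𝒯),
    (2 : ℝ≥0∞) ^ n * (∑' t : 𝒯, ENNReal.ofReal t.1.2.len) ^ (1 / 2 : ℝ)

/-! ### The second sequence, its sizes and its modified energy -/

/-- The coefficient `b_{P_2} = ⟨G χ_{N ∈ ω_{P_2}}, φ⟩`. -/
def coeff (N : ℝ → ℝ) (G : ℝ → ℂ) (P : BiTile u v) (φ : ℝ → ℂ) : ℂ :=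
  ∫ x, ({x | N x ∈ P.ω₂}.indicator G x) * conj (φ x)

/-- `∫ |G| χ_{N ∈ ω_P} (cutoff of I_P) ^ C`. -/
def mass (C : ℝ) (N : ℝ → ℝ) (G : ℝ → ℂ) (P : BiTile u v) : ℝ≥0∞ :=
  ∫⁻ x in {x | N x ∈ P.ω}, ‖G x‖ₑ * ENNReal.ofReal (P.cutoff x ^ C)

/-- The size of the second sequence. -/
def size (𝒬 : Finset (BiTile u v)) (C : ℝ) (N : ℝ → ℝ) (G : ℝ → ℂ) : ℝ≥0∞ :=
  ⨆ P ∈ 𝒬, ⨆ (P' : BiTile u v) (_ : P.le P'), mass C N G P' / ENNReal.ofReal P'.len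

/-- The easy variant of the size of the second sequence. -/
def sizeE (𝒬 : Finset (BiTile u v)) (C : ℝ) (N : ℝ → ℝ) (G : ℝ → ℂ) : ℝ≥0∞ :=
  ⨆ P ∈ 𝒬, mass C N G P / ENNReal.ofReal P.len

/-- The bi-tiles in `𝒟` are pairwise disjoint, as rectangles. -/
def DisjointBiTiles (𝒟 : Set (BiTile u v)) : Prop :=
  𝒟.Pairwise fun P P' => Disjoint P.rect P'.rect

/-- The modified energy of the second sequence. -/
def energy (𝒬 : Finset (BiTile u v)) (C : ℝ) (N : ℝ → ℝ) (G : ℝ → ℂ) : ℝ≥0∞ :=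
  ⨆ (n : ℤ) (𝒟 : Set (BiTile u v)) (_ : DisjointBiTiles 𝒟)
    (_ : ∀ P' ∈ 𝒟, (∃ P ∈ 𝒬, P.le P') ∧ (2 : ℝ≥0∞) ^ n * ENNReal.ofReal P'.len ≤ mass C N G P'),
    (2 : ℝ≥0∞) ^ n * ∑' P' : 𝒟, ENNReal.ofReal P'.1.len

end

end Bicarleson

/-!
The sum is decomposed into trees. If a collection has size at most `2 ^ (m + 1)` for the first
sequence, the greedy selection `exists_tops_energy₁` removes trees whose tops have total length
`O(energy₁ ^ 2 / 4 ^ m)`, and the size of the rest drops to `2 ^ m`. For the second sequence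
`exists_tops_energy` removes the bi-tiles below the maximal bi-tiles of mass density more than
`2 ^ m`, and the tops have total length `O(energy / 2 ^ m)`. `norm_sum_le_of_selection` alternates
the two selections and sums the geometric series that results from the tree estimate
`|∑_{P ∈ T} a b| ≲ size₁ * size * |I_T|`, that is, `IsTree.norm_sum_le`.

In the tree estimate the linearising function `N` is only known through the masses. Each tree gets
a stopping time `κ`, i.e. a partition of the line into dyadic cells that are maximal subject to
being far from the time intervals in the tree. Bi-tiles of scale at most `κ x` contribute little
at `x`, because of the decay of the wave packets (`IsStopping.lintegral_below_le`). The part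
`upper` of `|G|` that interacts with the other bi-tiles has average `O(size)` on every cell,
because the parent of a cell is close to a bi-tile of the tree and so carries a bi-tile of
controlled mass (`IsStopping.lintegral_upper_cell_le`).

A tree is the union of a `2`-tree and of bi-tiles whose left frequency half contains the frequency
interval of the top. In the latter part, the bi-tiles with `N x ∈ ω_{P_2}` for a given `x` all have
the same scale, and absolute values suffice. In the `2`-tree, `N x ∈ ω_{P_2}` means that the scale of `P`
is at most `topScale x`, so the sum at `x` is the difference of two truncations of
`f = ∑ conj a_P φ_P`. A truncation of `f` is the convolution with a band-limited kernel
(`IsTwoTree.exists_kernel`), hence is bounded by an average of `|f|`. Moving the averages from `f`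
to `upper`, it remains to apply the Cauchy-Schwarz inequality with `IsTwoTree.lintegral_sq_le`,
the almost orthogonality of wave packets, and `lintegral_sq_sum_le`, the dual form of a maximal
inequality.

When the bi-tiles are pairwise disjoint, the tops for the second sequence can be taken from the
collection itself and the tree estimate is trivial (`IsTree.norm_sum_le_of_disjoint`), so only the
masses of the given bi-tiles enter.
-/

namespace Bicarleson

open MeasureTheory

variable {u v : ℝ}

/-! ### Geometry of the grids and of bi-tiles -/

/-- Nestedness of dyadic intervals: if the interval of length `r` with index `i` meets the interval
of length `r * 2 ^ d` with index `i'`, then it is contained in it. -/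
theorem grid_nested {r : ℝ} (hr : 0 < r) {d : ℕ} {i i' : ℤ}
    (h1 : r * 2 ^ d * i' < r * (i + 1)) (h2 : r * i < r * 2 ^ d * (i' + 1)) :
    r * 2 ^ d * i' ≤ r * i ∧ r * (i + 1) ≤ r * 2 ^ d * (i' + 1) := by
  rw [mul_assoc, mul_lt_mul_iff_right₀ hr] at h1 h2
  rw [mul_assoc, mul_assoc, mul_le_mul_iff_right₀ hr, mul_le_mul_iff_right₀ hr]
  have h1' : (2 ^ d * i' : ℤ) < i + 1 := by exact_mod_cast h1
  have h2' : i < (2 ^ d * (i' + 1) : ℤ) := by exact_mod_cast h2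
  constructor
  · exact_mod_cast Int.lt_add_one_iff.1 h1'
  · exact_mod_cast Int.add_one_le_of_lt h2'

/-- The length of the time intervals of scale `m`. -/
noncomputable def scaleLen (u : ℝ) (m : ℤ) : ℝ := (2 : ℝ) ^ (-u) * (2 : ℝ) ^ m

theorem scaleLen_pos (u : ℝ) (m : ℤ) : 0 < scaleLen u m := by unfold scaleLen; positivity

theorem scaleLen_add_nat (u : ℝ) (m : ℤ) (d : ℕ) :
    scaleLen u (m + d) = scaleLen u m * 2 ^ d := by
  unfold scaleLen
  rw [zpow_add₀ (by norm_num), zpow_natCast, mul_assoc]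

theorem scaleLen_succ (u : ℝ) (m : ℤ) : scaleLen u (m + 1) = scaleLen u m * 2 := by
  simpa using scaleLen_add_nat u m 1

theorem scaleLen_le_iff {u : ℝ} {m n : ℤ} : scaleLen u m ≤ scaleLen u n ↔ m ≤ n := by
  unfold scaleLen
  rw [mul_le_mul_iff_right₀ (by positivity), zpow_le_zpow_iff_right₀ (by norm_num)]

theorem scaleLen_lt_iff {u : ℝ} {m n : ℤ} : scaleLen u m < scaleLen u n ↔ m < n := by
  rw [← not_le, ← not_le, scaleLen_le_iff]

namespace BiTile

theorem len_eq_scaleLen (P : BiTile u v) : P.len = scaleLen u P.j := rfl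

theorem freqLen_eq (P : BiTile u v) : P.freqLen = 2 / P.len := by
  rw [eq_div_iff P.len_pos.ne', mul_comm, area]

/-- The relation between the sizes of two bi-tiles, as needed for `grid_nested`. -/
theorem exists_len_eq {P Q : BiTile u v} (h : P.j ≤ Q.j) :
    ∃ d : ℕ, Q.j = P.j + d ∧ Q.len = P.len * 2 ^ d ∧ P.freqLen = Q.freqLen * 2 ^ d := by
  obtain ⟨d, hd⟩ := Int.le.dest h
  refine ⟨d, hd.symm, ?_, ?_⟩
  · rw [len_eq_scaleLen, len_eq_scaleLen, ← hd, scaleLen_add_nat]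
  · have : Q.len = P.len * 2 ^ d := by rw [len_eq_scaleLen, len_eq_scaleLen, ← hd, scaleLen_add_nat]
    rw [freqLen_eq, freqLen_eq, this]
    have := P.len_pos
    field_simp

theorem len_le_len {P Q : BiTile u v} : P.len ≤ Q.len ↔ P.j ≤ Q.j := scaleLen_le_iff

theorem freqRight_eq (P : BiTile u v) : P.freqLeft + P.freqLen = P.freqLen * (P.l + 1) + v := by
  unfold freqLeft; ring

theorem freqMid_eq (P : BiTile u v) :
    P.freqLeft + P.freqLen / 2 = P.freqLen / 2 * (2 * P.l + 1) + v := by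
  unfold freqLeft; ring

theorem volume_I (P : BiTile u v) : MeasureTheory.volume P.I = ENNReal.ofReal P.len := by
  unfold I
  rw [Real.volume_Ioo]; congr 1; ring

theorem center_mem (P : BiTile u v) : P.center ∈ P.I := by
  have := P.len_pos
  constructor <;> unfold center <;> nlinarith

theorem freqMid_mem (P : BiTile u v) : P.freqLeft + P.freqLen / 2 ∈ P.ω := by
  have := P.freqLen_pos
  constructor <;> linarith

theorem freqQuarter_mem (P : BiTile u v) : P.freqLeft + 3 / 4 * P.freqLen ∈ P.ω₂ := by
  have := P.freqLen_pos
  constructor <;> linarith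

theorem ω₁_subset (P : BiTile u v) : P.ω₁ ⊆ P.ω := fun _ hx =>
  ⟨hx.1, by have := P.freqLen_pos; linarith [hx.2]⟩

theorem ω₂_subset (P : BiTile u v) : P.ω₂ ⊆ P.ω := fun _ hx =>
  ⟨by have := P.freqLen_pos; linarith [hx.1], hx.2⟩

theorem disjoint_ω₁_ω₂ (P : BiTile u v) : Disjoint P.ω₁ P.ω₂ :=
  Set.disjoint_left.2 fun _ h1 h2 => lt_asymm h1.2 h2.1

theorem I_subset_of_meet {P Q : BiTile u v} (h : P.j ≤ Q.j) {x : ℝ} (hP : x ∈ P.I)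
    (hQ : x ∈ Q.I) : P.I ⊆ Q.I := by
  obtain ⟨d, -, hd, -⟩ := exists_len_eq h
  unfold I at *
  rw [hd] at hQ ⊢
  obtain ⟨h1, h2⟩ := grid_nested P.len_pos (hQ.1.trans hP.2) (hP.1.trans hQ.2)
  exact Set.Ioo_subset_Ioo h1 h2

theorem ω_subset_of_meet {P Q : BiTile u v} (h : P.j ≤ Q.j) {x : ℝ} (hP : x ∈ P.ω)
    (hQ : x ∈ Q.ω) : Q.ω ⊆ P.ω := by
  obtain ⟨d, -, -, hd⟩ := exists_len_eq h
  unfold ω at *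
  rw [freqRight_eq] at *
  unfold freqLeft at *
  rw [hd] at hP ⊢
  obtain ⟨h1, h2⟩ := grid_nested (d := d) (i := Q.l) (i' := P.l) Q.freqLen_pos
    (by linarith [hP.1, hQ.2]) (by linarith [hQ.1, hP.2])
  exact Set.Ioo_subset_Ioo (by linarith) (by linarith)

/-- A strictly shorter frequency interval is nested not only with the longer ones but also with
their halves, which are intervals of the same grid. -/
theorem ω_subset_halves {P Q : BiTile u v} (h : P.j < Q.j) {x : ℝ} (hQ : x ∈ Q.ω) :
    (x ∈ P.ω₁ → Q.ω ⊆ P.ω₁) ∧ (x ∈ P.ω₂ → Q.ω ⊆ P.ω₂) := by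
  obtain ⟨d, hd, -, hd'⟩ := exists_len_eq h.le
  obtain ⟨e, rfl⟩ : ∃ e, d = e + 1 := ⟨d - 1, by omega⟩
  have he : P.freqLen / 2 = Q.freqLen * 2 ^ e := by rw [hd']; ring
  have he' : P.freqLen = 2 * (Q.freqLen * 2 ^ e) := by rw [hd']; ring
  unfold ω ω₁ ω₂ at *
  rw [freqMid_eq, he, freqRight_eq, freqRight_eq] at *
  unfold freqLeft at *
  rw [he']
  constructor
  · intro hP
    obtain ⟨h1, h2⟩ := grid_nested (d := e) (i := Q.l) (i' := 2 * P.l) Q.freqLen_pos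
      (by push_cast; linarith [hP.1, hQ.2]) (by push_cast; linarith [hQ.1, hP.2])
    push_cast at h1 h2
    exact Set.Ioo_subset_Ioo (by linarith) (by linarith)
  · intro hP
    obtain ⟨h1, h2⟩ := grid_nested (d := e) (i := Q.l) (i' := 2 * P.l + 1) Q.freqLen_pos
      (by push_cast; linarith [hP.1, hQ.2]) (by push_cast; linarith [hQ.1, hP.2])
    push_cast at h1 h2
    exact Set.Ioo_subset_Ioo (by linarith) (by linarith)

theorem ω_subset_ω₁ {P Q : BiTile u v} (h : P.j < Q.j) {x : ℝ} (hP : x ∈ P.ω₁)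
    (hQ : x ∈ Q.ω) : Q.ω ⊆ P.ω₁ := (ω_subset_halves h hQ).1 hP

theorem ω_subset_ω₂ {P Q : BiTile u v} (h : P.j < Q.j) {x : ℝ} (hP : x ∈ P.ω₂)
    (hQ : x ∈ Q.ω) : Q.ω ⊆ P.ω₂ := (ω_subset_halves h hQ).2 hP

theorem k_eq_of_meet {P Q : BiTile u v} (h : P.j = Q.j) {x : ℝ} (hP : x ∈ P.I)
    (hQ : x ∈ Q.I) : P.k = Q.k := by
  have hl : P.len = Q.len := by rw [len_eq_scaleLen, len_eq_scaleLen, h]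
  have hp := Q.len_pos
  unfold I at *
  rw [hl] at hP
  have h1 := hP.1.trans hQ.2
  have h2 := hQ.1.trans hP.2
  rw [mul_lt_mul_iff_right₀ hp] at h1 h2
  norm_cast at h1 h2
  omega

theorem l_eq_of_meet {P Q : BiTile u v} (h : P.j = Q.j) {x : ℝ} (hP : x ∈ P.ω)
    (hQ : x ∈ Q.ω) : P.l = Q.l := by
  have hl : P.freqLen = Q.freqLen := by unfold freqLen; rw [h]
  have hp := Q.freqLen_pos
  unfold ω at *
  rw [freqRight_eq] at *
  unfold freqLeft at *
  rw [hl] at hP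
  have h1 : Q.freqLen * P.l < Q.freqLen * (Q.l + 1) := by linarith [hP.1, hQ.2]
  have h2 : Q.freqLen * Q.l < Q.freqLen * (P.l + 1) := by linarith [hP.2, hQ.1]
  rw [mul_lt_mul_iff_right₀ hp] at h1 h2
  norm_cast at h1 h2
  omega

theorem le_refl (P : BiTile u v) : P.le P := ⟨subset_rfl, subset_rfl⟩

theorem le_trans {P Q R : BiTile u v} (h : P.le Q) (h' : Q.le R) : P.le R :=
  ⟨h.1.trans h'.1, h'.2.trans h.2⟩

theorem le_of_meet {P Q : BiTile u v} (h : P.j ≤ Q.j) {x ξ : ℝ} (hP : x ∈ P.I) (hQ : x ∈ Q.I)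
    (hP' : ξ ∈ P.ω) (hQ' : ξ ∈ Q.ω) : P.le Q :=
  ⟨I_subset_of_meet h hP hQ, ω_subset_of_meet h hP' hQ'⟩

theorem len_le_of_I_subset {P Q : BiTile u v} (h : P.I ⊆ Q.I) : P.len ≤ Q.len := by
  have := MeasureTheory.measure_mono (μ := MeasureTheory.volume) h
  rw [volume_I, volume_I] at this
  exact (ENNReal.ofReal_le_ofReal_iff Q.len_pos.le).1 this

theorem le_len {P Q : BiTile u v} (h : P.le Q) : P.len ≤ Q.len := len_le_of_I_subset h.1

theorem le_j {P Q : BiTile u v} (h : P.le Q) : P.j ≤ Q.j := len_le_len.1 (le_len h)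

theorem eq_of_meet {P Q : BiTile u v} (h : P.j = Q.j) {x ξ : ℝ} (hP : x ∈ P.I) (hQ : x ∈ Q.I)
    (hP' : ξ ∈ P.ω) (hQ' : ξ ∈ Q.ω) : P = Q :=
  BiTile.ext h (k_eq_of_meet h hP hQ) (l_eq_of_meet h hP' hQ')

theorem eq_of_le {P Q : BiTile u v} (h : P.le Q) (hj : P.j = Q.j) : P = Q :=
  eq_of_meet hj P.center_mem (h.1 P.center_mem) (h.2 Q.freqMid_mem) Q.freqMid_mem

/-- Bi-tiles whose rectangles meet are comparable. -/
theorem comparable_of_not_disjoint {P Q : BiTile u v} (h : ¬ Disjoint P.rect Q.rect) :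
    P.le Q ∨ Q.le P := by
  obtain ⟨⟨x, ξ⟩, h1, h2⟩ := Set.not_disjoint_iff.1 h
  rcases le_total P.j Q.j with hj | hj
  · exact .inl (le_of_meet hj h1.1 h2.1 h1.2 h2.2)
  · exact .inr (le_of_meet hj h2.1 h1.1 h2.2 h1.2)

theorem eq_of_tile₁_eq {P Q : BiTile u v} (h : P.tile₁ = Q.tile₁) : P = Q := by
  have hne : ∀ R : BiTile u v, R.I.Nonempty ∧ R.ω₁.Nonempty := fun R =>
    ⟨⟨_, R.center_mem⟩, Set.nonempty_Ioo.2 (by linarith [R.freqLen_pos])⟩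
  have := (Set.prod_eq_prod_iff_of_nonempty ((hne P).1.prod (hne P).2)).1 h
  have hj : P.j = Q.j := le_antisymm (len_le_len.1 (len_le_of_I_subset this.1.subset))
    (len_le_len.1 (len_le_of_I_subset this.1.symm.subset))
  obtain ⟨ξ, hξ⟩ := (hne P).2
  exact eq_of_meet hj P.center_mem (this.1 ▸ P.center_mem) (P.ω₁_subset hξ)
    (Q.ω₁_subset (this.2 ▸ hξ))

/-- Below a given top there are only two kinds of bi-tiles: those that can form a `2`-tree with it,
and those whose left frequency half contains the whole frequency interval of the top. -/
theorem subset_ω₂_or_subset_ω₁ {P top : BiTile u v} (h : P.le top) :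
    top.ω₂ ⊆ P.ω₂ ∨ (P.j < top.j ∧ top.ω ⊆ P.ω₁) := by
  rcases (le_j h).eq_or_lt with hj | hj
  · left; rw [eq_of_le h hj]
  · -- compare a point of `top.ω₂` with the midpoint of `P.ω`; equality is impossible because that
    -- midpoint is a grid point of a scale coarser than `top.ω`
    have hx := top.freqQuarter_mem
    set x := top.freqLeft + 3 / 4 * top.freqLen
    have hxω := top.ω₂_subset hx
    rcases lt_trichotomy x (P.freqLeft + P.freqLen / 2) with hlt | heq | hgt
    · exact .inr ⟨hj, ω_subset_ω₁ hj ⟨(h.2 hxω).1, hlt⟩ hxω⟩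
    · exfalso
      have hy : top.freqLeft + 1 / 2 * top.freqLen ∈ top.ω := by
        have := top.freqMid_mem; convert this using 1; ring
      have h1 := ω_subset_ω₁ hj (x := top.freqLeft + 1 / 2 * top.freqLen)
        ⟨(h.2 hy).1, by have := top.freqLen_pos; rw [← heq]; simp only [x]; linarith⟩ hy hxω
      exact absurd h1.2 heq.not_lt
    · exact .inl (top.ω₂_subset.trans (ω_subset_ω₂ hj ⟨hgt, (h.2 hxω).2⟩ hxω))

/-- Only finitely many bi-tiles of bounded scale lie above a given one. -/
theorem finite_above (P : BiTile u v) (J : ℤ) : {Q : BiTile u v | P.le Q ∧ Q.j ≤ J}.Finite := by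
  let B : ℤ → ℤ → Set (ℤ × ℤ) := fun k l => Set.Icc (-(|k| + 1)) (|k| + 1) ×ˢ
    Set.Icc (-((|l| + 1) * 2 ^ (J - P.j).toNat)) ((|l| + 1) * 2 ^ (J - P.j).toNat)
  have hfin : (Set.Icc P.j J ×ˢ B P.k P.l).Finite :=
    (Set.finite_Icc _ _).prod ((Set.finite_Icc _ _).prod (Set.finite_Icc _ _))
  refine (hfin.preimage (f := fun Q : BiTile u v => (Q.j, Q.k, Q.l)) ?_).subset ?_
  · intro Q _ Q' _ h
    simp only [Prod.mk.injEq] at h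
    exact BiTile.ext h.1 h.2.1 h.2.2
  · rintro Q ⟨hle, hJ⟩
    have hj := le_j hle
    obtain ⟨d, hdj, hd, hd'⟩ := exists_len_eq hj
    have hc := hle.1 P.center_mem
    have hPc := P.center_mem
    have hm := hle.2 Q.freqMid_mem
    have hQm := Q.freqMid_mem
    unfold I at hc hPc
    unfold ω at hm hQm
    rw [freqRight_eq] at hm hQm
    unfold freqLeft at hm hQm
    have hdJ : d ≤ (J - P.j).toNat := by omega
    have hpow : (2 : ℤ) ^ d ≤ 2 ^ (J - P.j).toNat := pow_le_pow_right₀ (by norm_num) hdJ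
    have hpow1 : (1 : ℤ) ≤ 2 ^ d := one_le_pow₀ (by norm_num)
    rw [hd] at hc
    obtain ⟨a1, a2⟩ := grid_nested (d := d) (i := P.k) (i' := Q.k) P.len_pos
      (hc.1.trans hPc.2) (hPc.1.trans hc.2)
    rw [hd'] at hm
    obtain ⟨b1, b2⟩ := grid_nested (d := d) (i := Q.l) (i' := P.l) Q.freqLen_pos
      (by linarith [hm.1, hQm.2]) (by linarith [hm.2, hQm.1])
    rw [mul_assoc, mul_le_mul_iff_right₀ P.len_pos] at a1
    rw [mul_assoc, mul_le_mul_iff_right₀ P.len_pos] at a2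
    rw [mul_assoc, mul_le_mul_iff_right₀ Q.freqLen_pos] at b1
    rw [mul_assoc, mul_le_mul_iff_right₀ Q.freqLen_pos] at b2
    norm_cast at a1 a2 b1 b2
    have hk := abs_nonneg P.k
    have hl := abs_nonneg P.l
    have hk1 := neg_abs_le P.k
    have hk2 := le_abs_self P.k
    have hl1 := neg_abs_le P.l
    have hl2 := le_abs_self P.l
    refine ⟨⟨hj, hJ⟩, ⟨?_, ?_⟩, ⟨?_, ?_⟩⟩ <;> simp only
    · push_cast at *
      by_contra hcon
      have : Q.k + 1 ≤ -(|P.k| + 1) := by omega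
      nlinarith
    · push_cast at *
      by_contra hcon
      have : |P.k| + 1 + 1 ≤ Q.k := by omega
      nlinarith
    · push_cast at *
      nlinarith
    · push_cast at *
      nlinarith

end BiTile

/-! ### Summation over the levels of the decomposition -/

/-- A geometric series with ratio `2 ^ δ` in both directions, bounded by telescoping against the
logistic function `z / (1 + z)`, `z = t ^ δ`. -/
theorem sum_min_le {δ : ℝ} (hδ : 0 < δ) (hδ1 : δ ≤ 1) {t : ℝ} (ht : 0 < t) (k : ℕ) :
    ∑ i ∈ Finset.range k, (2 ^ i * t) ^ (-δ) * min 1 ((2 ^ i * t) ^ 2)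
      ≤ 4 * 2 ^ δ / (2 ^ δ - 1) := by
  have hr : (1 : ℝ) < 2 ^ δ := Real.one_lt_rpow (by norm_num) hδ
  set r : ℝ := 2 ^ δ with hrdef
  let ψ : ℕ → ℝ := fun i => (2 ^ i * t) ^ δ / (1 + (2 ^ i * t) ^ δ)
  have key : ∀ i, (2 ^ i * t) ^ (-δ) * min 1 ((2 ^ i * t) ^ 2)
      ≤ 4 * r / (r - 1) * (ψ (i + 1) - ψ i) := by
    intro i
    have hs : 0 < 2 ^ i * t := by positivity
    have h2 : (2 : ℝ) ^ (i + 1) * t = 2 * (2 ^ i * t) := by ring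
    simp only [ψ, h2]
    generalize 2 ^ i * t = s at hs
    rw [Real.mul_rpow (by norm_num) hs.le, ← hrdef, Real.rpow_neg hs.le]
    have hz : 0 < s ^ δ := Real.rpow_pos_of_pos hs δ
    have hb : (s ^ δ)⁻¹ * min 1 (s ^ 2) ≤ s ^ δ := by
      rw [inv_mul_le_iff₀ hz, ← Real.rpow_add hs]
      rcases le_total s 1 with h | h
      · refine (min_le_right _ _).trans ?_
        rw [← Real.rpow_natCast]
        exact Real.rpow_le_rpow_of_exponent_ge hs h (by push_cast; linarith)
      · exact (min_le_left _ _).trans (Real.one_le_rpow h (by linarith))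
    have hb' : (s ^ δ)⁻¹ * min 1 (s ^ 2) ≤ (s ^ δ)⁻¹ :=
      mul_le_of_le_one_right (by positivity) (min_le_left _ _)
    generalize (s ^ δ)⁻¹ * min 1 (s ^ 2) = h at hb hb'
    generalize s ^ δ = z at hz hb hb'
    have e : 4 * r / (r - 1) * (r * z / (1 + r * z) - z / (1 + z))
        = 4 * r * z / ((1 + r * z) * (1 + z)) := by
      have : r - 1 ≠ 0 := by linarith
      field_simp
      ring
    rw [e]
    -- since `r ≥ 1`, the increment is at least `4 * z / (1 + z) ^ 2`
    have hden : (1 + r * z) * (1 + z) ≤ r * (1 + z) ^ 2 := by nlinarith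
    calc h ≤ 4 * z / (1 + z) ^ 2 := by
            rw [le_div_iff₀ (by positivity)]
            have hzi : z⁻¹ * z = 1 := inv_mul_cancel₀ hz.ne'
            rcases le_total z 1 with h1 | h1
            · have : (1 + z) ^ 2 ≤ 4 := by nlinarith
              nlinarith
            · have h4 : (1 + z) ^ 2 ≤ 4 * z ^ 2 := by nlinarith
              calc h * (1 + z) ^ 2 ≤ z⁻¹ * (4 * z ^ 2) :=
                    mul_le_mul hb' h4 (by positivity) (by positivity)
                _ = 4 * z := by field_simp
      _ = 4 * r * z / (r * (1 + z) ^ 2) := by field_simp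
      _ ≤ 4 * r * z / ((1 + r * z) * (1 + z)) := by gcongr
  have hc : 0 ≤ 4 * r / (r - 1) := by
    have : 0 < r - 1 := by linarith
    positivity
  calc _ ≤ ∑ i ∈ Finset.range k, 4 * r / (r - 1) * (ψ (i + 1) - ψ i) :=
        Finset.sum_le_sum fun i _ => key i
    _ = 4 * r / (r - 1) * (ψ k - ψ 0) := by rw [← Finset.mul_sum, Finset.sum_range_sub]
    _ ≤ 4 * r / (r - 1) * 1 := by
        gcongr
        have h0 : 0 ≤ ψ 0 := by simp only [ψ]; positivity
        have hk : ψ k ≤ 1 := by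
          simp only [ψ]; rw [div_le_one (by positivity)]; linarith
        linarith
    _ = _ := mul_one _

/-- The sum over the levels `p = 2 ^ i * q` of the total length `p ^ 2` of the tops, times the sizes
`min (X / p) S₁` and `min (Y / p ^ 2) S₂` of the two sequences at that level. After rescaling this
is `sum_min_le` with `δ = 1 - θ₁`. -/
theorem sum_levels_le {θ₁ θ₂ : ℝ} (h0 : 0 ≤ θ₁) (h1 : θ₁ < 1) (h12 : θ₁ + 2 * θ₂ = 1)
    {X Y S₁ S₂ : ℝ} (hX : 0 < X) (hY : 0 < Y) (hS₁ : 0 < S₁) (hS₂ : 0 < S₂) {q : ℝ} (hq : 0 < q)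
    (k : ℕ) :
    ∑ i ∈ Finset.range k, (2 ^ i * q) ^ 2 * (min (X / (2 ^ i * q)) S₁ *
        min (Y / (2 ^ i * q) ^ 2) S₂)
      ≤ 4 * 2 ^ (1 - θ₁) / (2 ^ (1 - θ₁) - 1) *
        (S₁ ^ θ₁ * S₂ ^ θ₂ * X ^ (1 - θ₁) * Y ^ (1 - θ₂)) := by
  have hy : 0 < S₂ / Y := by positivity
  have hsq : 0 < √(S₂ / Y) := Real.sqrt_pos.2 hy
  have hθ₂ : θ₂ = (1 - θ₁) / 2 := by linarith
  set M := S₁ ^ θ₁ * S₂ ^ θ₂ * X ^ (1 - θ₁) * Y ^ (1 - θ₂) with hM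
  have hM0 : 0 ≤ M := by positivity
  have key : ∀ i, (2 ^ i * q) ^ 2 * (min (X / (2 ^ i * q)) S₁ * min (Y / (2 ^ i * q) ^ 2) S₂)
      ≤ M * ((2 ^ i * (q * √(S₂ / Y))) ^ (-(1 - θ₁)) *
        min 1 ((2 ^ i * (q * √(S₂ / Y))) ^ 2)) := by
    intro i
    rw [← mul_assoc (2 ^ i) q]
    have hp : 0 < 2 ^ i * q := by positivity
    generalize 2 ^ i * q = p at hp
    -- the first minimum is interpolated, the second one is kept to make the series converge
    have e1 : min (X / p) S₁ ≤ (X / p) ^ (1 - θ₁) * S₁ ^ θ₁ := by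
      have hm : 0 < min (X / p) S₁ := lt_min (by positivity) hS₁
      calc min (X / p) S₁ = min (X / p) S₁ ^ (1 - θ₁) * min (X / p) S₁ ^ θ₁ := by
            rw [← Real.rpow_add hm]; simp
        _ ≤ _ := by
            gcongr
            · exact min_le_left _ _
            · exact min_le_right _ _
    have e2 : min (Y / p ^ 2) S₂ = Y / p ^ 2 * min 1 ((p * √(S₂ / Y)) ^ 2) := by
      rw [mul_min_of_nonneg _ _ (by positivity), mul_one, mul_pow, Real.sq_sqrt hy.le]
      congr 1
      field_simp
    rw [e2]
    have e3 : (p * √(S₂ / Y)) ^ (-(1 - θ₁)) = (p ^ (1 - θ₁))⁻¹ * (Y ^ θ₂ * (S₂ ^ θ₂)⁻¹) := by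
      rw [Real.mul_rpow hp.le hsq.le, Real.rpow_neg hp.le, Real.sqrt_eq_rpow, ← Real.rpow_mul hy.le,
        show 1 / 2 * -(1 - θ₁) = -θ₂ by rw [hθ₂]; ring, Real.rpow_neg hy.le,
        Real.div_rpow hS₂.le hY.le]
      field_simp
    rw [e3, hM]
    have hYY : Y ^ (1 - θ₂) * Y ^ θ₂ = Y := by rw [← Real.rpow_add hY]; simp
    generalize min 1 ((p * √(S₂ / Y)) ^ 2) = w at *
    have hw : 0 ≤ w := by
      have : 0 ≤ Y / p ^ 2 * w := e2 ▸ (le_min (by positivity) hS₂.le)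
      exact nonneg_of_mul_nonneg_right this (by positivity)
    calc p ^ 2 * (min (X / p) S₁ * (Y / p ^ 2 * w))
        ≤ p ^ 2 * ((X / p) ^ (1 - θ₁) * S₁ ^ θ₁ * (Y / p ^ 2 * w)) := by gcongr
      _ = S₁ ^ θ₁ * (S₂ ^ θ₂ * (S₂ ^ θ₂)⁻¹) * X ^ (1 - θ₁) * (Y ^ (1 - θ₂) * Y ^ θ₂)
          * (p ^ (1 - θ₁))⁻¹ * w := by
          rw [hYY, mul_inv_cancel₀ (by positivity), Real.div_rpow hX.le hp.le]
          field_simp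
      _ = _ := by ring
  calc _ ≤ ∑ i ∈ Finset.range k, M * ((2 ^ i * (q * √(S₂ / Y))) ^ (-(1 - θ₁)) *
        min 1 ((2 ^ i * (q * √(S₂ / Y))) ^ 2)) := Finset.sum_le_sum fun i _ => key i
    _ ≤ M * (4 * 2 ^ (1 - θ₁) / (2 ^ (1 - θ₁) - 1)) := by
        rw [← Finset.mul_sum]
        gcongr
        exact sum_min_le (by linarith) (by linarith) (by positivity) k
    _ = _ := mul_comm _ _

/-! ### The decomposition into trees -/

/-- The size of the sequence `a` on `𝒬` is at most `s`, in terms of the squares. -/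
def HasSize (a : BiTile u v → ℂ) (𝒬 : Finset (BiTile u v)) (s : ℝ) : Prop :=
  ∀ T ⊆ 𝒬, ∀ top, IsTwoTree T top → ∑ P ∈ T, ‖a P‖ ^ 2 ≤ s ^ 2 * top.len

theorem HasSize.mono {a : BiTile u v → ℂ} {𝒬 𝒬' : Finset (BiTile u v)} {s : ℝ}
    (h : HasSize a 𝒬 s) (h' : 𝒬' ⊆ 𝒬) : HasSize a 𝒬' s :=
  fun T hT => h T (hT.trans h')

theorem HasSize.mono_right {a : BiTile u v → ℂ} {𝒬 : Finset (BiTile u v)} {s s' : ℝ}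
    (h : HasSize a 𝒬 s) (hs : 0 ≤ s) (hs' : s ≤ s') : HasSize a 𝒬 s' :=
  fun T hT top ht => (h T hT top ht).trans (by have := top.len_pos; gcongr)

theorem HasSize.norm_le {a : BiTile u v → ℂ} {𝒬 : Finset (BiTile u v)} {s : ℝ}
    (h : HasSize a 𝒬 s) (hs : 0 ≤ s) {P : BiTile u v} (hP : P ∈ 𝒬) : ‖a P‖ ≤ s * √P.len := by
  have := h {P} (by simpa using hP) P ⟨by simpa [IsTree] using P.le_refl, by simp⟩
  rw [Finset.sum_singleton] at this
  refine abs_le_of_sq_le_sq' ?_ (by positivity) |>.2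
  rwa [mul_pow, Real.sq_sqrt P.len_pos.le]

open scoped Classical in
/-- The bi-tiles of `𝒬` below none of the bi-tiles of `D`. -/
noncomputable def remainder (𝒬 D : Finset (BiTile u v)) : Finset (BiTile u v) :=
  𝒬.filter fun P => ∀ t ∈ D, ¬ P.le t

theorem remainder_subset (𝒬 D : Finset (BiTile u v)) : remainder 𝒬 D ⊆ 𝒬 := by
  classical exact Finset.filter_subset _ _

theorem mem_remainder {𝒬 D : Finset (BiTile u v)} {P : BiTile u v} :
    P ∈ remainder 𝒬 D ↔ P ∈ 𝒬 ∧ ∀ t ∈ D, ¬ P.le t := by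
  classical exact Finset.mem_filter

/-- The sum over the bi-tiles lying below some top is controlled by the lengths of the tops. -/
theorem norm_sum_le_add_remainder {c : BiTile u v → ℂ} {𝒬 D : Finset (BiTile u v)} {κ : ℝ}
    (h : ∀ T ⊆ 𝒬, ∀ top ∈ D, IsTree T top → ‖∑ P ∈ T, c P‖ ≤ κ * top.len) :
    ‖∑ P ∈ 𝒬, c P‖ ≤ κ * ∑ t ∈ D, t.len + ‖∑ P ∈ remainder 𝒬 D, c P‖ := by
  classical
  rw [← Finset.sum_filter_not_add_sum_filter 𝒬 (fun P => ∀ t ∈ D, ¬ P.le t)]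
  refine (norm_add_le _ _).trans (add_le_add ?_ (by unfold remainder; convert le_rfl))
  -- assign to each bi-tile a top above it; the value is irrelevant where there is none
  have hex : ∀ P : BiTile u v, ∃ t, (∃ t ∈ D, P.le t) → t ∈ D ∧ P.le t := by
    intro P
    by_cases hP : ∃ t ∈ D, P.le t
    · obtain ⟨t, ht⟩ := hP
      exact ⟨t, fun _ => ht⟩
    · exact ⟨P, fun h => absurd h hP⟩
  choose f hf using hex
  rw [← Finset.sum_fiberwise_of_maps_to (t := D) (g := f), Finset.mul_sum]
  · refine (norm_sum_le _ _).trans (Finset.sum_le_sum fun t ht => ?_)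
    refine h _ ((Finset.filter_subset _ _).trans (Finset.filter_subset _ _)) t ht ?_
    intro P hP
    simp only [Finset.mem_filter] at hP
    obtain ⟨⟨-, h1⟩, rfl⟩ := hP
    push Not at h1
    exact (hf P h1).2
  · intro P hP
    simp only [Finset.mem_filter] at hP
    have h1 := hP.2
    push Not at h1
    exact (hf P h1).1

/-- The passage from the tree estimate and the two selection procedures to the estimate for the
whole sum. The predicate `p P s` expresses that the size of the second sequence at `P` is at most
`s`.

With `X ≈ E₁` and `Y ≈ E₂`, level `r` consists of the bi-tiles that remain when the sizes have been
brought down to `X / r` and `Y / r ^ 2`. Passing from `r` to `2 * r` removes trees whose tops have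
total length `O(r ^ 2)`, by both selection procedures, and the tree estimate applies to these. -/
theorem norm_sum_le_of_selection {θ₁ θ₂ : ℝ} (h0 : 0 ≤ θ₁) (h1 : θ₁ < 1) (hθ₂ : 0 < θ₂)
    (h12 : θ₁ + 2 * θ₂ = 1)
    {𝒬 : Finset (BiTile u v)} {a b : BiTile u v → ℂ} {p : BiTile u v → ℝ → Prop}
    {E₁ E₂ S₁ S₂ κ : ℝ} (hE₁ : 0 < E₁) (hE₂ : 0 < E₂) (hS₁ : 0 < S₁) (hS₂ : 0 < S₂) (hκ : 0 ≤ κ)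
    (hp : ∀ P s s', p P s → s ≤ s' → p P s')
    (hsel₁ : ∀ 𝒬' ⊆ 𝒬, ∀ m : ℤ, HasSize a 𝒬' (2 ^ (m + 1)) →
      ∃ D : Finset (BiTile u v), ((2 : ℝ) ^ m) ^ 2 * ∑ t ∈ D, t.len ≤ E₁ ^ 2 ∧
        HasSize a (remainder 𝒬' D) (2 ^ m))
    (hsel₂ : ∀ 𝒬' ⊆ 𝒬, ∀ m : ℤ, ∃ D : Finset (BiTile u v), (2 : ℝ) ^ m * ∑ t ∈ D, t.len ≤ E₂ ∧
        ∀ P ∈ remainder 𝒬' D, p P (2 ^ m))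
    (htree : ∀ T ⊆ 𝒬, ∀ top, IsTree T top → ∀ s₁ s₂, 0 ≤ s₁ → 0 ≤ s₂ → HasSize a T s₁ →
      (∀ P ∈ T, p P s₂) → ‖∑ P ∈ T, a P * b P‖ ≤ κ * (s₁ * s₂) * top.len)
    (hsz₁ : HasSize a 𝒬 S₁) (hsz₂ : ∀ P ∈ 𝒬, p P S₂) :
    ‖∑ P ∈ 𝒬, a P * b P‖ ≤ κ * (128 * 2 ^ (1 - θ₁) / (2 ^ (1 - θ₁) - 1)) *
      (S₁ ^ θ₁ * S₂ ^ θ₂ * E₁ ^ (1 - θ₁) * E₂ ^ (1 - θ₂)) := by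
  obtain ⟨e₁, he₁, he₁'⟩ := exists_mem_Ioc_zpow hE₁ (one_lt_two (α := ℝ))
  obtain ⟨e₂, he₂, he₂'⟩ := exists_mem_Ioc_zpow hE₂ (one_lt_two (α := ℝ))
  set X : ℝ := 2 ^ (e₁ + 1) with hX
  set Y : ℝ := 2 ^ (e₂ + 1) with hY
  have hX0 : 0 < X := by positivity
  have hY0 : 0 < Y := by positivity
  have hXE : X ≤ 2 * E₁ := by rw [hX, zpow_add₀ (by norm_num)]; linarith
  have hYE : Y ≤ 2 * E₂ := by rw [hY, zpow_add₀ (by norm_num)]; linarith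
  -- a starting level at which both sizes are below the thresholds
  obtain ⟨n₀, hn₁, hn₂⟩ : ∃ n₀ : ℤ, S₁ ≤ X / 2 ^ n₀ ∧ S₂ ≤ Y / (2 ^ n₀) ^ 2 := by
    obtain ⟨j₁, hj₁⟩ := pow_unbounded_of_one_lt (S₁ / X) (one_lt_two (α := ℝ))
    obtain ⟨j₂, hj₂⟩ := pow_unbounded_of_one_lt (S₂ / Y) (one_lt_two (α := ℝ))
    refine ⟨-((j₁ + j₂ : ℕ) : ℤ), ?_, ?_⟩
    · rw [zpow_neg, div_inv_eq_mul, zpow_natCast, pow_add]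
      rw [div_lt_iff₀ hX0] at hj₁
      have h1 : (1 : ℝ) ≤ 2 ^ j₂ := one_le_pow₀ (by norm_num)
      have h2 : (0 : ℝ) < 2 ^ j₁ := by positivity
      nlinarith [mul_le_mul_of_nonneg_left h1 (mul_pos hX0 h2).le]
    · rw [zpow_neg, inv_pow, div_inv_eq_mul, zpow_natCast, pow_add, mul_pow]
      rw [div_lt_iff₀ hY0] at hj₂
      have h1 : (1 : ℝ) ≤ 2 ^ j₁ := one_le_pow₀ (by norm_num)
      have h2 : (1 : ℝ) ≤ 2 ^ j₂ := one_le_pow₀ (by norm_num)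
      have h3 : (1 : ℝ) ≤ (2 ^ j₁) ^ 2 := one_le_pow₀ h1
      calc S₂ ≤ Y * (1 * 2 ^ j₂) := by linarith
        _ ≤ Y * ((2 ^ j₁) ^ 2 * (2 ^ j₂) ^ 2) := by
            gcongr
            nlinarith
  set q : ℝ := 2 ^ n₀ with hq
  have hq0 : 0 < q := by positivity
  -- the state after `k` steps: what remains is `𝒬'`, and what was removed is under control
  have main : ∀ k : ℕ, ∃ 𝒬' ⊆ 𝒬, HasSize a 𝒬' (X / (2 ^ k * q)) ∧
      (∀ P ∈ 𝒬', p P (Y / (2 ^ k * q) ^ 2)) ∧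
      ‖∑ P ∈ 𝒬, a P * b P‖ ≤ κ * 8 * (∑ i ∈ Finset.range k, (2 ^ i * q) ^ 2 *
        (min (X / (2 ^ i * q)) S₁ * min (Y / (2 ^ i * q) ^ 2) S₂)) + ‖∑ P ∈ 𝒬', a P * b P‖ := by
    intro k
    induction k with
    | zero =>
      refine ⟨𝒬, subset_rfl, ?_, fun P hP => ?_, by simp⟩
      · simpa using hsz₁.mono_right hS₁.le hn₁
      · exact hp P _ _ (hsz₂ P hP) (by simpa using hn₂)
    | succ k ih =>
      obtain ⟨𝒬', hsub, hs₁, hs₂, hle⟩ := ih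
      have hkq : (2 : ℝ) ^ k * q = 2 ^ ((k : ℤ) + n₀) := by
        rw [zpow_add₀ (by norm_num), zpow_natCast]
      -- all thresholds are powers of `2`, as the selection procedures require
      have hx : ∀ i : ℤ, X / (2 ^ k * q) * 2 ^ i = 2 ^ (e₁ + 1 - (k + n₀) + i) := by
        intro i
        rw [hkq, hX, ← zpow_sub₀ (by norm_num), ← zpow_add₀ (by norm_num)]
      have hy : ∀ i : ℤ, Y / (2 ^ k * q) ^ 2 * 2 ^ i = 2 ^ (e₂ + 1 - (k + n₀) * 2 + i) := by
        intro i
        rw [hkq, hY, ← zpow_natCast _ 2, ← zpow_mul, ← zpow_sub₀ (by norm_num),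
          ← zpow_add₀ (by norm_num)]
        rfl
      set r : ℝ := 2 ^ k * q with hr
      have hr0 : 0 < r := by positivity
      have hr1 : 2 ^ (k + 1) * q = 2 * r := by rw [hr]; ring
      rw [hr1]
      set σ := min (X / r) S₁ * min (Y / r ^ 2) S₂ with hσ
      have hm1 : 0 ≤ min (X / r) S₁ := le_min (by positivity) hS₁.le
      have hm2 : 0 ≤ min (Y / r ^ 2) S₂ := le_min (by positivity) hS₂.le
      have tree : ∀ 𝒬'' ⊆ 𝒬', ∀ T ⊆ 𝒬'', ∀ top, IsTree T top →
          ‖∑ P ∈ T, a P * b P‖ ≤ κ * σ * top.len := by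
        intro 𝒬'' h'' T hT top htop
        have hT' := hT.trans h''
        refine htree T (hT'.trans hsub) top htop _ _ hm1 hm2 ?_ ?_
        · rcases min_choice (X / r) S₁ with h | h <;> rw [h]
          · exact hs₁.mono hT'
          · exact hsz₁.mono (hT'.trans hsub)
        · intro P hP
          rcases min_choice (Y / r ^ 2) S₂ with h | h <;> rw [h]
          · exact hs₂ P (hT' hP)
          · exact hsz₂ P (hsub (hT' hP))
      obtain ⟨D₁, hD₁, hR₁⟩ := hsel₁ 𝒬' hsub (e₁ + 1 - (k + n₀) - 1) (by
        have := hx 0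
        rw [zpow_zero, mul_one, add_zero] at this
        rwa [sub_add_cancel, ← this])
      obtain ⟨D₂, hD₂, hR₂⟩ := hsel₂ (remainder 𝒬' D₁) ((remainder_subset _ _).trans hsub)
        (e₂ + 1 - (k + n₀) * 2 - 2)
      rw [sub_eq_add_neg _ (1 : ℤ), ← hx] at hD₁ hR₁
      rw [sub_eq_add_neg _ (2 : ℤ), ← hy] at hD₂ hR₂
      have hx2 : X / r * 2 ^ (-1 : ℤ) = X / (2 * r) := by
        rw [zpow_neg, zpow_one]; field_simp
      have hy2 : Y / r ^ 2 * 2 ^ (-2 : ℤ) = Y / (2 * r) ^ 2 := by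
        rw [zpow_neg]; norm_num; field_simp; norm_num
      rw [hx2] at hD₁ hR₁
      rw [hy2] at hD₂ hR₂
      refine ⟨_, (remainder_subset _ D₂).trans ((remainder_subset _ D₁).trans hsub),
        hR₁.mono (remainder_subset _ D₂), hR₂, ?_⟩
      have b1 := norm_sum_le_add_remainder (D := D₁) (fun T hT top _ => tree 𝒬' subset_rfl T hT top)
      have b2 := norm_sum_le_add_remainder (D := D₂)
        (fun T hT top _ => tree _ (remainder_subset 𝒬' D₁) T hT top)
      have c1 : ∑ t ∈ D₁, t.len ≤ 4 * r ^ 2 := by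
        have : (X / (2 * r)) ^ 2 * ∑ t ∈ D₁, t.len ≤ X ^ 2 := hD₁.trans (by gcongr)
        rw [div_pow, div_mul_eq_mul_div, div_le_iff₀ (by positivity)] at this
        have := le_of_mul_le_mul_left this (by positivity)
        linarith
      have c2 : ∑ t ∈ D₂, t.len ≤ 4 * r ^ 2 := by
        have : Y / (2 * r) ^ 2 * ∑ t ∈ D₂, t.len ≤ Y := hD₂.trans he₂'
        rw [div_mul_eq_mul_div, div_le_iff₀ (by positivity)] at this
        have := le_of_mul_le_mul_left this (by positivity)
        linarith
      have hκσ : 0 ≤ κ * σ := by positivity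
      rw [Finset.sum_range_succ]
      have d1 := mul_le_mul_of_nonneg_left c1 hκσ
      have d2 := mul_le_mul_of_nonneg_left c2 hκσ
      rw [← hr, ← hσ]
      linarith
  set B := κ * (128 * 2 ^ (1 - θ₁) / (2 ^ (1 - θ₁) - 1)) *
      (S₁ ^ θ₁ * S₂ ^ θ₂ * E₁ ^ (1 - θ₁) * E₂ ^ (1 - θ₂)) with hB
  have hden : (0 : ℝ) < 2 ^ (1 - θ₁) - 1 :=
    sub_pos.2 (Real.one_lt_rpow (by norm_num) (by linarith))
  -- what remains after `k` steps is bounded trivially, and tends to `0`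
  have bound : ∀ k : ℕ, ‖∑ P ∈ 𝒬, a P * b P‖
      ≤ B + X / (2 ^ k * q) * ∑ P ∈ 𝒬, √P.len * ‖b P‖ := by
    intro k
    obtain ⟨𝒬', hsub, hs₁, -, hle⟩ := main k
    refine hle.trans (add_le_add ?_ ?_)
    · calc _ ≤ κ * 8 * (4 * 2 ^ (1 - θ₁) / (2 ^ (1 - θ₁) - 1) *
            (S₁ ^ θ₁ * S₂ ^ θ₂ * X ^ (1 - θ₁) * Y ^ (1 - θ₂))) := by
            gcongr
            exact sum_levels_le h0 h1 h12 hX0 hY0 hS₁ hS₂ hq0 k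
        _ ≤ κ * 8 * (4 * 2 ^ (1 - θ₁) / (2 ^ (1 - θ₁) - 1) *
            (S₁ ^ θ₁ * S₂ ^ θ₂ * (2 * E₁ ^ (1 - θ₁)) * (2 * E₂ ^ (1 - θ₂)))) := by
            have two : ∀ {Z E t : ℝ}, 0 < Z → 0 < E → Z ≤ 2 * E → 0 ≤ t → t ≤ 1 →
                Z ^ t ≤ 2 * E ^ t := by
              intro Z E t hZ hE hZE ht ht'
              calc Z ^ t ≤ (2 * E) ^ t := by gcongr
                _ = 2 ^ t * E ^ t := Real.mul_rpow (by norm_num) hE.le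
                _ ≤ 2 ^ (1 : ℝ) * E ^ t := by gcongr; norm_num
                _ = 2 * E ^ t := by rw [Real.rpow_one]
            have t1 := two hX0 hE₁ hXE (t := 1 - θ₁) (by linarith) (by linarith)
            have t2 := two hY0 hE₂ hYE (t := 1 - θ₂) (by linarith) (by linarith)
            gcongr
        _ = B := by rw [hB]; ring
    · calc ‖∑ P ∈ 𝒬', a P * b P‖ ≤ ∑ P ∈ 𝒬', X / (2 ^ k * q) * (√P.len * ‖b P‖) := by
            refine (norm_sum_le _ _).trans (Finset.sum_le_sum fun P hP => ?_)
            rw [norm_mul, ← mul_assoc]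
            gcongr
            exact hs₁.norm_le (by positivity) hP
        _ ≤ ∑ P ∈ 𝒬, X / (2 ^ k * q) * (√P.len * ‖b P‖) :=
            Finset.sum_le_sum_of_subset_of_nonneg hsub fun _ _ _ => by positivity
        _ = _ := by rw [Finset.mul_sum]
  have hlim : Filter.Tendsto (fun k : ℕ => B + X / (2 ^ k * q) * ∑ P ∈ 𝒬, √P.len * ‖b P‖)
      Filter.atTop (nhds (B + 0 * ∑ P ∈ 𝒬, √P.len * ‖b P‖)) := by
    refine tendsto_const_nhds.add (Filter.Tendsto.mul_const _ ?_)
    refine Filter.Tendsto.const_div_atTop ?_ _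
    exact (tendsto_pow_atTop_atTop_of_one_lt one_lt_two).atTop_mul_const hq0
  rw [zero_mul, add_zero] at hlim
  exact ge_of_tendsto' hlim bound

/-! ### Selection of trees -/

/-- Inside a `2`-tree, the size controls subtrees of any type: the tree is the union of the
`2`-trees below its bi-tiles with maximal time interval. -/
theorem sum_sq_le_volume {a : BiTile u v → ℂ} {T : Finset (BiTile u v)} {top : BiTile u v}
    (hT : IsTwoTree T top) {s : ℝ} (hs : HasSize a T s) (T' : Finset (BiTile u v)) (hT' : T' ⊆ T) :
    ∑ P ∈ T', ‖a P‖ ^ 2 ≤ s ^ 2 * volume.real (⋃ P ∈ T', P.I) := by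
  classical
  induction T' using Finset.strongInduction with
  | H T' ih =>
    rcases T'.eq_empty_or_nonempty with rfl | hne
    · simp
    obtain ⟨P, hP, hmax⟩ := T'.exists_max_image (fun P => P.j) hne
    set S := T'.filter fun Q => Q.I ⊆ P.I with hS
    set R := T'.filter fun Q => ¬ Q.I ⊆ P.I with hR
    have hRss : R ⊂ T' := Finset.filter_ssubset.2 ⟨P, hP, by simp⟩
    have hSbound : ∑ Q ∈ S, ‖a Q‖ ^ 2 ≤ s ^ 2 * P.len := by
      refine hs S ((Finset.filter_subset _ _).trans hT') P ?_
      have hx := top.freqQuarter_mem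
      have hPx := hT.2 P (hT' hP) hx
      have key : ∀ Q ∈ S, Q.I ⊆ P.I ∧ P.ω ⊆ Q.ω ∧ P.ω₂ ⊆ Q.ω₂ := by
        intro Q hQ
        obtain ⟨hQT, hQI⟩ := Finset.mem_filter.1 hQ
        have hQx := hT.2 Q (hT' hQT) hx
        refine ⟨hQI, BiTile.ω_subset_of_meet (hmax Q hQT) (Q.ω₂_subset hQx) (P.ω₂_subset hPx), ?_⟩
        rcases (hmax Q hQT).eq_or_lt with hj | hj
        · rw [BiTile.eq_of_meet hj Q.center_mem (hQI Q.center_mem) (Q.ω₂_subset hQx)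
            (P.ω₂_subset hPx)]
        · exact P.ω₂_subset.trans (BiTile.ω_subset_ω₂ hj hQx (P.ω₂_subset hPx))
      exact ⟨fun Q hQ => ⟨(key Q hQ).1, (key Q hQ).2.1⟩, fun Q hQ => (key Q hQ).2.2⟩
    have hRbound := ih R hRss (hRss.1.trans hT')
    have hdisj : Disjoint P.I (⋃ Q ∈ R, Q.I) := by
      simp only [Set.disjoint_iUnion_right]
      intro Q hQ
      obtain ⟨hQT, hQI⟩ := Finset.mem_filter.1 hQ
      refine Set.disjoint_left.2 fun x hx hx' => hQI ?_
      exact BiTile.I_subset_of_meet (hmax Q hQT) hx' hx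
    have hfin : volume (⋃ Q ∈ T', Q.I) ≠ ⊤ := by
      refine (measure_biUnion_lt_top T'.finite_toSet fun Q _ => ?_).ne
      rw [BiTile.volume_I]; exact ENNReal.ofReal_lt_top
    have hmeas : MeasurableSet (⋃ Q ∈ R, Q.I) :=
      Finset.measurableSet_biUnion _ fun Q _ => measurableSet_Ioo
    have hunion : P.len + volume.real (⋃ Q ∈ R, Q.I) ≤ volume.real (⋃ Q ∈ T', Q.I) := by
      have hlen : P.len = volume.real P.I := by
        rw [Measure.real, BiTile.volume_I, ENNReal.toReal_ofReal P.len_pos.le]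
      have hsub : P.I ∪ (⋃ Q ∈ R, Q.I) ⊆ ⋃ Q ∈ T', Q.I := by
        refine Set.union_subset (Set.subset_biUnion_of_mem (u := fun Q : BiTile u v => Q.I) hP) ?_
        exact Set.biUnion_subset_biUnion_left hRss.1
      rw [hlen, ← measureReal_union hdisj hmeas
        (h₁ := ne_top_of_le_ne_top hfin (measure_mono (Set.subset_union_left.trans hsub)))
        (h₂ := ne_top_of_le_ne_top hfin (measure_mono (Set.subset_union_right.trans hsub)))]
      exact measureReal_mono hsub hfin
    have hsplit : ∑ Q ∈ T', ‖a Q‖ ^ 2 = ∑ Q ∈ S, ‖a Q‖ ^ 2 + ∑ Q ∈ R, ‖a Q‖ ^ 2 :=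
      (Finset.sum_filter_add_sum_filter_not T' _ _).symm
    rw [hsplit]
    nlinarith [mul_le_mul_of_nonneg_left hunion (sq_nonneg s)]

/-- The upper bound on subtrees that is part of the definition of the modified energy. -/
theorem l2norm_le_of_subtree {a : BiTile u v → ℂ} {T : Finset (BiTile u v)} {top : BiTile u v}
    (hT : IsTwoTree T top) {s : ℝ} (hs0 : 0 ≤ s) (hs : HasSize a T s) {T' : Finset (BiTile u v)}
    (hT' : T' ⊆ T) {top' : BiTile u v} (htop' : IsTree T' top') :
    l2norm a T' ≤ s * √top'.len := by
  unfold l2norm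
  refine Real.sqrt_le_iff.2 ⟨by positivity, ?_⟩
  rw [mul_pow, Real.sq_sqrt top'.len_pos.le]
  refine (sum_sq_le_volume hT hs T' hT').trans ?_
  gcongr
  have hlen : top'.len = volume.real top'.I := by
    rw [Measure.real, BiTile.volume_I, ENNReal.toReal_ofReal top'.len_pos.le]
  rw [hlen]
  refine measureReal_mono (Set.iUnion₂_subset fun Q hQ => (htop' Q hQ).1) ?_
  rw [BiTile.volume_I]; exact ENNReal.ofReal_ne_top

theorem BiTile.j_lt_of_ω₁_ssubset {P Q : BiTile u v} (h : P.ω₁ ⊂ Q.ω₁) : Q.j < P.j := by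
  by_contra hcon
  push Not at hcon
  obtain ⟨d, -, -, hd⟩ := BiTile.exists_len_eq hcon
  have hP := P.freqLen_pos
  have hQ := Q.freqLen_pos
  have h2 : (1 : ℝ) ≤ 2 ^ d := one_le_pow₀ (by norm_num)
  have hle : Q.freqLen ≤ P.freqLen := by rw [hd]; nlinarith
  have hsub := (Set.Ioo_subset_Ioo_iff (by linarith)).1 h.1
  have e1 : P.freqLen = Q.freqLen := by linarith [hsub.1, hsub.2]
  have e2 : P.freqLeft = Q.freqLeft := by linarith [hsub.1, hsub.2]
  exact h.2 (by unfold BiTile.ω₁; rw [e1, e2])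

theorem BiTile.ω_subset_ω₁_of_ssubset {P Q : BiTile u v} (h : P.ω₁ ⊂ Q.ω₁) : P.ω ⊆ Q.ω₁ := by
  have hx : P.freqLeft + P.freqLen / 4 ∈ P.ω₁ := by
    have := P.freqLen_pos
    constructor <;> linarith
  exact BiTile.ω_subset_ω₁ (BiTile.j_lt_of_ω₁_ssubset h) (h.1 hx) (P.ω₁_subset hx)

theorem BiTile.freqMid_le {P top : BiTile u v} (h : top.ω₂ ⊆ P.ω₂) :
    P.freqLeft + P.freqLen / 2 ≤ top.freqLeft + top.freqLen / 2 :=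
  ((Set.Ioo_subset_Ioo_iff (by linarith [top.freqLen_pos])).1 h).1

theorem exists_lt_scaleLen (u B : ℝ) : ∃ J : ℤ, B < scaleLen u J := by
  have h : (0 : ℝ) < 2 ^ (-u) := by positivity
  obtain ⟨n, hn⟩ := pow_unbounded_of_one_lt (B / 2 ^ (-u)) (one_lt_two (α := ℝ))
  refine ⟨n, ?_⟩
  rw [div_lt_iff₀ h] at hn
  unfold scaleLen
  rw [zpow_natCast]; linarith

/-- Greedy selection of `2`-trees with large `ℓ²` norm. The tree whose top has the lowest frequency
is selected first, and with it everything below its top is discarded; this makes the selected trees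
strongly `1`-disjoint. -/
theorem exists_twoTrees (a : BiTile u v → ℂ) {α : ℝ} (hα : 0 < α) (𝒬 : Finset (BiTile u v)) :
    ∃ 𝒯 : Set (Finset (BiTile u v) × BiTile u v),
      (∀ t ∈ 𝒯, t.1 ⊆ 𝒬 ∧ IsTwoTree t.1 t.2 ∧ α ^ 2 * t.2.len < ∑ P ∈ t.1, ‖a P‖ ^ 2) ∧
      𝒯.Pairwise StronglyDisjoint ∧
      ∃ D : Finset (BiTile u v), (D : Set (BiTile u v)) = Prod.snd '' 𝒯 ∧
        HasSize a (remainder 𝒬 D) α := by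
  classical
  induction 𝒬 using Finset.strongInduction with
  | H 𝒬 ih =>
    by_cases hsz : HasSize a 𝒬 α
    · exact ⟨∅, by simp, by simp, ∅, by simp, hsz.mono (remainder_subset _ _)⟩
    unfold HasSize at hsz
    push Not at hsz
    set 𝒞 : Set (BiTile u v) := {top | ∃ T ⊆ 𝒬, IsTwoTree T top ∧
      α ^ 2 * top.len < ∑ P ∈ T, ‖a P‖ ^ 2} with h𝒞
    have hnonempty : ∀ {T : Finset (BiTile u v)} {top : BiTile u v},
        α ^ 2 * top.len < ∑ P ∈ T, ‖a P‖ ^ 2 → T.Nonempty := by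
      intro T top h
      by_contra hT
      rw [Finset.not_nonempty_iff_eq_empty] at hT
      rw [hT, Finset.sum_empty] at h
      have := top.len_pos
      have : 0 < α ^ 2 * top.len := by positivity
      linarith
    have h𝒞ne : 𝒞.Nonempty := by
      obtain ⟨T, hT, top, h1, h2⟩ := hsz
      exact ⟨top, T, hT, h1, h2⟩
    have h𝒞fin : 𝒞.Finite := by
      obtain ⟨J, hJ⟩ := exists_lt_scaleLen u ((∑ P ∈ 𝒬, ‖a P‖ ^ 2) / α ^ 2)
      refine (𝒬.finite_toSet.biUnion fun P _ => BiTile.finite_above P J).subset ?_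
      rintro top ⟨T, hT, h1, h2⟩
      obtain ⟨P, hP⟩ := hnonempty h2
      simp only [Set.mem_iUnion]
      refine ⟨P, hT hP, h1.1 P hP, ?_⟩
      have h3 : α ^ 2 * top.len < ∑ P ∈ 𝒬, ‖a P‖ ^ 2 := h2.trans_le
        (Finset.sum_le_sum_of_subset_of_nonneg hT fun _ _ _ => by positivity)
      rw [mul_comm, ← lt_div_iff₀ (by positivity)] at h3
      exact (scaleLen_lt_iff.1 (h3.trans hJ)).le
    -- lowest frequency first
    obtain ⟨top, ⟨T, hT, h2T, hbig⟩, hmin⟩ :=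
      Set.exists_min_image 𝒞 (fun t => t.freqLeft + t.freqLen / 2) h𝒞fin h𝒞ne
    set 𝒬₁ := remainder 𝒬 {top} with h𝒬₁
    have hss : 𝒬₁ ⊂ 𝒬 := by
      refine (remainder_subset _ _).ssubset_of_ne fun h => ?_
      obtain ⟨P, hP⟩ := hnonempty hbig
      have : P ∈ 𝒬₁ := by rw [h𝒬₁, h]; exact hT hP
      exact (mem_remainder.1 this).2 top (by simp) (h2T.1 P hP)
    obtain ⟨𝒯₁, hprop, hpw, D₁, hD₁, hsize⟩ := ih 𝒬₁ hss
    refine ⟨insert (T, top) 𝒯₁, ?_, ?_, insert top D₁, ?_, ?_⟩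
    · rintro t (rfl | ht)
      · exact ⟨hT, h2T, hbig⟩
      · exact ⟨(hprop t ht).1.trans hss.1, (hprop t ht).2⟩
    · have hsym : ∀ t t' : Finset (BiTile u v) × BiTile u v,
          StronglyDisjoint t t' → StronglyDisjoint t' t := fun t t' h P hP P' hP' =>
        ⟨(h P' hP' P hP).1.symm, (h P' hP' P hP).2.2, (h P' hP' P hP).2.1⟩
      refine hpw.insert fun t ht _ => ?_
      have hmain : StronglyDisjoint (T, top) t := by
        intro P hP P' hP'
        have hP'1 := mem_remainder.1 ((hprop t ht).1 hP')
        have hnot : ¬ P'.le top := hP'1.2 top (by simp)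
        have hPle := h2T.1 P hP
        refine ⟨fun h => hnot (BiTile.eq_of_tile₁_eq h ▸ hPle), fun hss' => ?_, fun hss' => ?_⟩
        · -- otherwise `P'` would have been discarded together with the bi-tiles below `top`
          refine Set.disjoint_left.2 fun x hx hx' => hnot ⟨?_, ?_⟩
          · exact BiTile.I_subset_of_meet
              ((BiTile.j_lt_of_ω₁_ssubset hss').le.trans (BiTile.le_j hPle)) hx hx'
          · exact hPle.2.trans ((BiTile.ω_subset_ω₁_of_ssubset hss').trans P'.ω₁_subset)
        · -- the choice of `top` excludes this: `t.2` would have a lower frequency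
          exfalso
          have h1 : t.2.freqLeft + t.2.freqLen / 2 ∈ P.ω₁ :=
            BiTile.ω_subset_ω₁_of_ssubset hss' (((hprop t ht).2.1.1 P' hP').2 t.2.freqMid_mem)
          have h2 := BiTile.freqMid_le (h2T.2 P hP)
          have h3 := hmin t.2 ⟨t.1, (hprop t ht).1.trans hss.1, (hprop t ht).2⟩
          linarith [h1.2]
      exact ⟨hmain, hsym _ _ hmain⟩
    · rw [Finset.coe_insert, Set.image_insert_eq, hD₁]
    · refine hsize.mono fun P hP => ?_
      rw [mem_remainder] at hP ⊢
      refine ⟨mem_remainder.2 ⟨hP.1, ?_⟩, fun t ht => hP.2 t (Finset.mem_insert_of_mem ht)⟩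
      intro t ht
      rw [Finset.mem_singleton] at ht
      exact ht ▸ hP.2 top (Finset.mem_insert_self _ _)

theorem ofReal_two_zpow (m : ℤ) : ENNReal.ofReal ((2 : ℝ) ^ m) = (2 : ℝ≥0∞) ^ m := by
  rw [← Real.rpow_intCast, ← ENNReal.rpow_intCast, ← ENNReal.ofReal_rpow_of_pos (by norm_num)]
  norm_num

/-- Selection for the first sequence: the size of the remainder drops by a factor `2`. -/
theorem exists_tops_energy₁ {𝒬₀ : Finset (BiTile u v)} {a : BiTile u v → ℂ}
    (hE : energy₁ 𝒬₀ a ≠ ⊤) {𝒬 : Finset (BiTile u v)} (h𝒬 : 𝒬 ⊆ 𝒬₀) (m : ℤ)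
    (hs : HasSize a 𝒬 (2 ^ (m + 1))) :
    ∃ D : Finset (BiTile u v), ((2 : ℝ) ^ m) ^ 2 * ∑ t ∈ D, t.len ≤ (energy₁ 𝒬₀ a).toReal ^ 2 ∧
      HasSize a (remainder 𝒬 D) (2 ^ m) := by
  classical
  have h2 : (0 : ℝ) < 2 ^ m := by positivity
  obtain ⟨𝒯, hprop, hpw, D, hD, hsize⟩ := exists_twoTrees a h2 𝒬
  refine ⟨D, ?_, hsize⟩
  have hfam : IsEnergyFamily 𝒬₀ a m 𝒯 :=
    { subset := fun t ht => (hprop t ht).1.trans h𝒬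
      isTwoTree := fun t ht => (hprop t ht).2.1
      disjoint := hpw
      lower := fun t ht => by
        unfold l2norm
        refine Real.le_sqrt_of_sq_le ?_
        rw [mul_pow, Real.sq_sqrt t.2.len_pos.le]
        exact (hprop t ht).2.2.le
      upper := fun t ht T' top' hT' htop' => l2norm_le_of_subtree (hprop t ht).2.1 (by positivity)
        (hs.mono (hprop t ht).1) hT' htop' }
  have hle : (2 : ℝ≥0∞) ^ m * (∑' t : 𝒯, ENNReal.ofReal t.1.2.len) ^ (1 / 2 : ℝ) ≤ energy₁ 𝒬₀ a :=
    le_iSup₂_of_le m 𝒯 (le_iSup_of_le hfam le_rfl)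
  have hsum : ENNReal.ofReal (∑ t ∈ D, t.len) ≤ ∑' t : 𝒯, ENNReal.ofReal t.1.2.len := by
    -- different trees might share a top, so one tree is chosen for each top
    have hex : ∀ t : D, ∃ s : 𝒯, s.1.2 = t := fun t => by
      have : (t : BiTile u v) ∈ Prod.snd '' 𝒯 := hD ▸ t.2
      obtain ⟨s, hs, hst⟩ := this
      exact ⟨⟨s, hs⟩, hst⟩
    choose f hf using hex
    have hinj : Function.Injective f := fun t t' h => Subtype.ext (by rw [← hf t, ← hf t', h])
    calc ENNReal.ofReal (∑ t ∈ D, t.len) = ∑' t : D, ENNReal.ofReal t.1.len := by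
          rw [ENNReal.ofReal_sum_of_nonneg fun t _ => t.len_pos.le, Finset.tsum_subtype D
            fun t : BiTile u v => ENNReal.ofReal t.len]
      _ = ∑' t : D, ENNReal.ofReal (f t).1.2.len := by simp only [hf]
      _ ≤ _ := ENNReal.tsum_comp_le_tsum_of_injective hinj fun t : 𝒯 => ENNReal.ofReal t.1.2.len
  have h0 : 0 ≤ ∑ t ∈ D, t.len := Finset.sum_nonneg fun t _ => t.len_pos.le
  have hle2 : ENNReal.ofReal (2 ^ m * √(∑ t ∈ D, t.len)) ≤ energy₁ 𝒬₀ a := by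
    refine le_trans ?_ hle
    rw [ENNReal.ofReal_mul h2.le, ofReal_two_zpow, Real.sqrt_eq_rpow,
      ← ENNReal.ofReal_rpow_of_nonneg h0 (by norm_num)]
    gcongr
  rw [ENNReal.ofReal_le_iff_le_toReal hE] at hle2
  calc ((2 : ℝ) ^ m) ^ 2 * ∑ t ∈ D, t.len = (2 ^ m * √(∑ t ∈ D, t.len)) ^ 2 := by
        rw [mul_pow, Real.sq_sqrt h0]
    _ ≤ _ := by gcongr

theorem ofReal_sum_le_energy {𝒬 : Finset (BiTile u v)} {C : ℝ} {N : ℝ → ℝ} {G : ℝ → ℂ} (m : ℤ)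
    {𝒟 : Set (BiTile u v)} (hdisj : DisjointBiTiles 𝒟)
    (h : ∀ P' ∈ 𝒟, (∃ P ∈ 𝒬, P.le P') ∧ ENNReal.ofReal (2 ^ m * P'.len) ≤ mass C N G P')
    {D : Finset (BiTile u v)} (hD : (D : Set (BiTile u v)) ⊆ 𝒟) :
    ENNReal.ofReal (2 ^ m * ∑ t ∈ D, t.len) ≤ energy 𝒬 C N G := by
  have hle : (2 : ℝ≥0∞) ^ m * ∑' P' : 𝒟, ENNReal.ofReal P'.1.len ≤ energy 𝒬 C N G := by
    refine le_iSup₂_of_le m 𝒟 (le_iSup₂_of_le hdisj (fun P' hP' => ⟨(h P' hP').1, ?_⟩) le_rfl)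
    rw [← ofReal_two_zpow, ← ENNReal.ofReal_mul (by positivity)]
    exact (h P' hP').2
  refine le_trans ?_ hle
  rw [ENNReal.ofReal_mul (by positivity), ofReal_two_zpow,
    ENNReal.ofReal_sum_of_nonneg fun t _ => t.len_pos.le]
  gcongr
  rw [← Finset.tsum_subtype D fun t : BiTile u v => ENNReal.ofReal t.len]
  exact ENNReal.tsum_comp_le_tsum_of_injective (Set.inclusion_injective hD)
    fun P' : 𝒟 => ENNReal.ofReal P'.1.len

theorem sum_len_le_toReal_energy {𝒬 : Finset (BiTile u v)} {C : ℝ} {N : ℝ → ℝ} {G : ℝ → ℂ}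
    (hE : energy 𝒬 C N G ≠ ⊤) (m : ℤ)
    {𝒟 : Set (BiTile u v)} (hdisj : DisjointBiTiles 𝒟)
    (h : ∀ P' ∈ 𝒟, (∃ P ∈ 𝒬, P.le P') ∧ ENNReal.ofReal (2 ^ m * P'.len) ≤ mass C N G P')
    {D : Finset (BiTile u v)} (hD : (D : Set (BiTile u v)) ⊆ 𝒟) :
    2 ^ m * ∑ t ∈ D, t.len ≤ (energy 𝒬 C N G).toReal :=
  (ENNReal.ofReal_le_iff_le_toReal hE).1 (ofReal_sum_le_energy m hdisj h hD)

/-- Selection for the second sequence: the tops are maximal among the bi-tiles above `𝒬` with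
large mass, hence pairwise disjoint. -/
theorem exists_tops_energy {𝒬₀ : Finset (BiTile u v)} {C : ℝ} {N : ℝ → ℝ} {G : ℝ → ℂ}
    (hE : energy 𝒬₀ C N G ≠ ⊤) {𝒬 : Finset (BiTile u v)} (h𝒬 : 𝒬 ⊆ 𝒬₀) (m : ℤ) :
    ∃ D : Finset (BiTile u v), (2 : ℝ) ^ m * ∑ t ∈ D, t.len ≤ (energy 𝒬₀ C N G).toReal ∧
      ∀ P ∈ remainder 𝒬 D, ∀ P', P.le P' → mass C N G P' ≤ ENNReal.ofReal (2 ^ m * P'.len) := by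
  classical
  have h2 : (0 : ℝ) < 2 ^ m := by positivity
  set 𝒞 : Set (BiTile u v) := {P' | (∃ P ∈ 𝒬, P.le P') ∧
    ENNReal.ofReal (2 ^ m * P'.len) < mass C N G P'} with h𝒞
  set 𝒟 : Set (BiTile u v) := {Q | Q ∈ 𝒞 ∧ ∀ Q' ∈ 𝒞, Q.le Q' → Q' = Q} with h𝒟
  have hprop : ∀ P' ∈ 𝒞, (∃ P ∈ 𝒬₀, P.le P') ∧ ENNReal.ofReal (2 ^ m * P'.len) ≤ mass C N G P' :=
    fun P' hP' => ⟨by obtain ⟨P, hP, h⟩ := hP'.1; exact ⟨P, h𝒬 hP, h⟩, hP'.2.le⟩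
  have hdisj : DisjointBiTiles 𝒟 := by
    intro Q hQ Q' hQ' hne
    by_contra hcon
    rcases BiTile.comparable_of_not_disjoint hcon with h | h
    · exact hne (hQ.2 Q' hQ'.1 h).symm
    · exact hne (hQ'.2 Q hQ.1 h)
  -- the scales of the bi-tiles of large mass are bounded
  obtain ⟨J, hJ⟩ := exists_lt_scaleLen u ((energy 𝒬₀ C N G).toReal / 2 ^ m)
  have hbdd : ∀ P' ∈ 𝒞, P'.j ≤ J := by
    intro P' hP'
    have := sum_len_le_toReal_energy hE m (𝒟 := {P'}) (D := {P'}) (by simp [DisjointBiTiles])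
      (by rintro _ rfl; exact hprop _ hP') (by simp)
    rw [Finset.sum_singleton, mul_comm, ← le_div_iff₀ h2] at this
    exact (scaleLen_lt_iff.1 (this.trans_lt hJ)).le
  have hmax : ∀ P' ∈ 𝒞, ∃ Q ∈ 𝒟, P'.le Q := by
    intro P' hP'
    obtain ⟨Q, ⟨hQ𝒞, hQle⟩, hQ⟩ := Set.exists_max_image {Q | Q ∈ 𝒞 ∧ P'.le Q} (fun Q => Q.j)
      ((BiTile.finite_above P' J).subset fun Q hQ => ⟨hQ.2, hbdd Q hQ.1⟩) ⟨P', hP', P'.le_refl⟩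
    refine ⟨Q, ⟨hQ𝒞, fun Q' hQ' hle => ?_⟩, hQle⟩
    exact (BiTile.eq_of_le hle (le_antisymm (BiTile.le_j hle)
      (hQ Q' ⟨hQ', BiTile.le_trans hQle hle⟩))).symm
  have hex : ∀ P : BiTile u v, ∃ t, (∃ t ∈ 𝒟, P.le t) → t ∈ 𝒟 ∧ P.le t := by
    intro P
    by_cases hP : ∃ t ∈ 𝒟, P.le t
    · obtain ⟨t, ht⟩ := hP
      exact ⟨t, fun _ => ht⟩
    · exact ⟨P, fun h => absurd h hP⟩
  choose f hf using hex
  refine ⟨(𝒬.filter fun P => ∃ t ∈ 𝒟, P.le t).image f,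
    sum_len_le_toReal_energy hE m hdisj (fun P' hP' => hprop P' hP'.1) ?_, ?_⟩
  · intro t ht
    simp only [Finset.coe_image, Set.mem_image, Finset.mem_coe, Finset.mem_filter] at ht
    obtain ⟨P, ⟨-, hP⟩, rfl⟩ := ht
    exact (hf P hP).1
  · intro P hP P' hPP'
    rw [mem_remainder] at hP
    by_contra hcon
    obtain ⟨Q, hQ, hle⟩ := hmax P' ⟨⟨P, hP.1, hPP'⟩, not_le.1 hcon⟩
    have hPQ : ∃ t ∈ 𝒟, P.le t := ⟨Q, hQ, BiTile.le_trans hPP' hle⟩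
    exact hP.2 (f P) (Finset.mem_image_of_mem f (Finset.mem_filter.2 ⟨hP.1, hPQ⟩)) (hf P hPQ).2

/-- The selection for the second sequence when the bi-tiles are pairwise disjoint: the bi-tiles of
large mass are their own tops. -/
theorem exists_tops_energy_of_disjoint {𝒬₀ : Finset (BiTile u v)} {C : ℝ} {N : ℝ → ℝ} {G : ℝ → ℂ}
    (hE : energy 𝒬₀ C N G ≠ ⊤) (hd : DisjointBiTiles (𝒬₀ : Set (BiTile u v)))
    {𝒬 : Finset (BiTile u v)} (h𝒬 : 𝒬 ⊆ 𝒬₀) (m : ℤ) :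
    ∃ D : Finset (BiTile u v), (2 : ℝ) ^ m * ∑ t ∈ D, t.len ≤ (energy 𝒬₀ C N G).toReal ∧
      ∀ P ∈ remainder 𝒬 D, mass C N G P ≤ ENNReal.ofReal (2 ^ m * P.len) := by
  classical
  refine ⟨𝒬.filter fun P => ENNReal.ofReal (2 ^ m * P.len) ≤ mass C N G P,
    sum_len_le_toReal_energy hE m (hd.mono ?_) ?_ subset_rfl, ?_⟩
  · exact (Finset.coe_subset.2 ((Finset.filter_subset _ _).trans h𝒬))
  · intro P hP
    have := Finset.mem_filter.1 (Finset.mem_coe.1 hP)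
    exact ⟨⟨P, h𝒬 this.1, P.le_refl⟩, this.2⟩
  · intro P hP
    rw [mem_remainder] at hP
    by_contra hcon
    exact hP.2 P (Finset.mem_filter.2 ⟨hP.1, (not_le.1 hcon).le⟩) P.le_refl

/-! ### Fourier inversion and band-limited kernels -/

theorem integral_fourier_mul {f g : ℝ → ℂ} (hf : Integrable f) (hg : Integrable g) :
    ∫ x, 𝓕 f x * g x = ∫ x, f x * 𝓕 g x := by
  have := VectorFourier.integral_fourierIntegral_smul_eq_flip (μ := volume) (ν := volume)
    (L := innerₗ ℝ) Real.continuous_fourierChar continuous_inner hf hg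
  rw [flip_innerₗ] at this
  exact this

theorem integral_fourierInv_mul {f g : ℝ → ℂ} (hf : Integrable f) (hg : Integrable g) :
    ∫ x, 𝓕⁻ f x * g x = ∫ x, f x * 𝓕⁻ g x := by
  have h1 : ∫ x, 𝓕⁻ f x * g x = ∫ x, 𝓕 f x * g (-x) := by
    rw [← integral_neg_eq_self]
    simp only [Real.fourierInv_eq_fourier_neg, neg_neg]
  rw [h1, integral_fourier_mul hf hg.comp_neg]
  congr 1; ext x
  rw [Real.fourierInv_eq_fourier_comp_neg]

theorem continuous_fourier_of_integrable {f : ℝ → ℂ} (hf : Integrable f) : Continuous (𝓕 f) :=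
  VectorFourier.fourierIntegral_continuous Real.continuous_fourierChar continuous_inner hf

theorem continuous_fourierInv_of_integrable {f : ℝ → ℂ} (hf : Integrable f) :
    Continuous (𝓕⁻ f) := by
  have : 𝓕⁻ f = fun x => 𝓕 f (-x) := funext fun x => Real.fourierInv_eq_fourier_neg f x
  rw [this]
  exact (continuous_fourier_of_integrable hf).comp continuous_neg

/-- Fourier inversion for a function that is not assumed to be continuous. -/
theorem ae_eq_fourierInv_fourier {f : ℝ → ℂ} (hf : Integrable f) (hf' : Integrable (𝓕 f)) :
    ∀ᵐ x, f x = 𝓕⁻ (𝓕 f) x := by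
  refine ae_eq_of_integral_contDiff_smul_eq hf.locallyIntegrable
    (continuous_fourierInv_of_integrable hf').locallyIntegrable fun g hg hgc => ?_
  have hg1 : ContDiff ℝ (⊤ : ℕ∞) fun x => (g x : ℂ) := Complex.ofRealCLM.contDiff.comp hg
  have hg2 : HasCompactSupport fun x => (g x : ℂ) :=
    hgc.comp_left (g := Complex.ofReal) Complex.ofReal_zero
  obtain ⟨S, hS⟩ : ∃ S : SchwartzMap ℝ ℂ, ∀ x, S x = (g x : ℂ) :=
    ⟨hg2.toSchwartzMap hg1, fun x => rfl⟩
  obtain ⟨R, hR, hRS⟩ : ∃ R : SchwartzMap ℝ ℂ,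
      𝓕⁻ (S : ℝ → ℂ) = R ∧ (S : ℝ → ℂ) = 𝓕 (R : ℝ → ℂ) := by
    refine ⟨𝓕⁻ S, (SchwartzMap.fourierInv_coe S).symm, ?_⟩
    rw [← SchwartzMap.fourier_coe, FourierTransform.fourier_fourierInv_eq]
  have e1 : ∫ x, g x • f x = ∫ x, S x * f x := by
    simp only [hS, Complex.real_smul]
  have e2 : ∫ x, g x • 𝓕⁻ (𝓕 f) x = ∫ x, 𝓕⁻ (𝓕 f) x * S x := by
    simp only [hS, Complex.real_smul, mul_comm]
  rw [e1, e2, integral_fourierInv_mul hf' S.integrable, hR, hRS,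
    integral_fourier_mul (SchwartzMap.integrable _) hf]
  simp_rw [mul_comm]

theorem fourierInv_sub_eq {θ : ℝ → ℂ} (x z : ℝ) :
    𝓕⁻ θ (x - z) = 𝓕 (fun η => Real.fourierChar (η * x) • θ η) z := by
  rw [Real.fourierInv_eq, Real.fourier_eq]
  congr 1; ext η
  rw [smul_smul, ← AddChar.map_add_eq_mul]
  congr 2
  simp only [RCLike.inner_apply, conj_trivial]
  ring

/-- Convolution with `𝓕⁻ θ` is multiplication by `θ` on the Fourier side. -/
theorem integral_mul_fourierInv_sub {f θ : ℝ → ℂ} (hf : Integrable f) (hθ : Integrable θ) (x : ℝ) :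
    ∫ z, f z * 𝓕⁻ θ (x - z) = 𝓕⁻ (fun η => 𝓕 f η * θ η) x := by
  have hint : Integrable fun η => Real.fourierChar (η * x) • θ η := by
    have := (Real.fourierIntegral_convergent_iff (μ := volume) (f := θ) (-x)).2 hθ
    simpa [mul_comm] using this
  simp_rw [fourierInv_sub_eq]
  rw [← integral_fourier_mul hf hint, Real.fourierInv_eq]
  congr 1; ext η
  simp only [RCLike.inner_apply, conj_trivial, Circle.smul_def, smul_eq_mul]
  rw [mul_comm η x]; ring

theorem integrable_fourier_of_support {f : ℝ → ℂ} (hf : Integrable f) {a b : ℝ}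
    (h : Function.support (𝓕 f) ⊆ Set.Ioo a b) : Integrable (𝓕 f) :=
  (continuous_fourier_of_integrable hf).integrable_of_hasCompactSupport
    (HasCompactSupport.of_support_subset_isCompact isCompact_Icc
      (h.trans Set.Ioo_subset_Icc_self))

/-- Functions with disjoint frequency supports are orthogonal. -/
theorem integral_mul_conj_eq_zero {f g : ℝ → ℂ} (hf : Integrable f) (hg : Integrable g)
    (hf' : Integrable (𝓕 f))
    (h : Disjoint (Function.support (𝓕 f)) (Function.support (𝓕 g))) :
    ∫ x, f x * conj (g x) = 0 := by
  have hgc : Integrable fun x => conj (g x) :=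
    Complex.conjCLE.toContinuousLinearMap.integrable_comp hg
  have e : ∫ x, f x * conj (g x) = ∫ x, 𝓕⁻ (𝓕 f) x * conj (g x) :=
    integral_congr_ae ((ae_eq_fourierInv_fourier hf hf').mono fun x hx => by
      simp only [hx.symm])
  have hconj : ∀ x, 𝓕⁻ (fun x => conj (g x)) x = conj (𝓕 g x) := by
    intro x
    rw [Real.fourierInv_eq, Real.fourier_eq, ← integral_conj]
    congr 1; ext η
    simp only [Circle.smul_def, smul_eq_mul, map_mul, AddChar.map_neg_eq_inv, Circle.coe_inv_eq_conj,
      Complex.conj_conj]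
  rw [e, integral_fourierInv_mul hf' hgc]
  refine integral_eq_zero_of_ae (Filter.Eventually.of_forall fun x => ?_)
  simp only [hconj, Pi.zero_apply]
  by_cases hx : 𝓕 f x = 0
  · rw [hx, zero_mul]
  · have : 𝓕 g x = 0 := by
      by_contra hx'
      exact Set.disjoint_left.1 h hx hx'
    rw [this, map_zero, mul_zero]

/-- The profile of the frequency cutoffs, equal to `1` on `[0, 1]` and to `0` away from
`(-1/20, 21/20)`. The margin `1/20` is what the factor `9/10` in the definition of wave packets
leaves room for. -/
noncomputable def bump : ContDiffBump (1 / 2 : ℝ) := ⟨1 / 2, 11 / 20, by norm_num, by norm_num⟩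

/-- The frequency cutoff adapted to the interval `[c, c + ℓ]`. -/
noncomputable def freqCutoff (c ℓ : ℝ) (η : ℝ) : ℂ := (bump ((η - c) / ℓ) : ℂ)

theorem freqCutoff_eq_one {c ℓ η : ℝ} (hℓ : 0 < ℓ) (h1 : c ≤ η) (h2 : η ≤ c + ℓ) :
    freqCutoff c ℓ η = 1 := by
  unfold freqCutoff
  rw [bump.one_of_mem_closedBall, Complex.ofReal_one]
  have a1 : 0 ≤ (η - c) / ℓ := div_nonneg (by linarith) hℓ.le
  have a2 : (η - c) / ℓ ≤ 1 := (div_le_one hℓ).2 (by linarith)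
  rw [Metric.mem_closedBall, Real.dist_eq, abs_le]
  simp only [bump]
  constructor <;> linarith

theorem freqCutoff_eq_zero {c ℓ η : ℝ} (hℓ : 0 < ℓ) (h : η ≤ c - ℓ / 20) :
    freqCutoff c ℓ η = 0 := by
  unfold freqCutoff
  rw [bump.zero_of_le_dist, Complex.ofReal_zero]
  have a1 : (η - c) / ℓ ≤ -(1 / 20) := by
    rw [div_le_iff₀ hℓ]; linarith
  rw [Real.dist_eq, abs_of_neg (by linarith)]
  simp only [bump]
  linarith

theorem integrable_freqCutoff {ℓ : ℝ} (hℓ : 0 < ℓ) (c : ℝ) : Integrable (freqCutoff c ℓ) := by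
  have h : Integrable fun x => (bump x : ℂ) :=
    (bump.continuous.integrable_of_hasCompactSupport bump.hasCompactSupport).ofReal
  exact (h.comp_div hℓ.ne').comp_sub_right c

theorem fourierInv_freqCutoff {ℓ : ℝ} (hℓ : 0 < ℓ) (c y : ℝ) :
    ‖𝓕⁻ (freqCutoff c ℓ) y‖ = ℓ * ‖𝓕⁻ (fun x => (bump x : ℂ)) (ℓ * y)‖ := by
  have e : 𝓕⁻ (freqCutoff c ℓ) y =
      (ℓ : ℂ) * (Real.fourierChar (c * y) : ℂ) * 𝓕⁻ (fun x => (bump x : ℂ)) (ℓ * y) := by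
    rw [Real.fourierInv_eq, Real.fourierInv_eq]
    have h1 : ∀ η, Real.fourierChar (inner ℝ η y) • freqCutoff c ℓ η =
        (fun s => Real.fourierChar ((ℓ * s + c) * y) • (bump s : ℂ)) ((η - c) / ℓ) := by
      intro η
      unfold freqCutoff
      simp only [RCLike.inner_apply, conj_trivial]
      congr 2
      field_simp
      ring
    simp_rw [h1]
    rw [integral_sub_right_eq_self
      (fun η => (fun s => Real.fourierChar ((ℓ * s + c) * y) • (bump s : ℂ)) (η / ℓ)) c,
      Measure.integral_comp_div
      (fun s => Real.fourierChar ((ℓ * s + c) * y) • (bump s : ℂ)) ℓ, abs_of_pos hℓ,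
      Complex.real_smul, mul_assoc]
    refine congrArg (fun z : ℂ => (ℓ : ℂ) * z) ?_
    rw [← integral_const_mul]
    refine integral_congr_ae (Filter.Eventually.of_forall fun s => ?_)
    simp only [RCLike.inner_apply, conj_trivial, Circle.smul_def, smul_eq_mul]
    rw [← mul_assoc, ← Circle.coe_mul, ← AddChar.map_add_eq_mul]
    congr 3
    ring
  rw [e, norm_mul, norm_mul, Circle.norm_coe, mul_one, Complex.norm_real, Real.norm_of_nonneg hℓ.le]

/-- The kernels of the frequency cutoffs decay on the scale dual to `ℓ`, uniformly. -/
theorem exists_norm_fourierInv_freqCutoff_le :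
    ∃ B : ℝ, 0 < B ∧ ∀ c ℓ y : ℝ, 0 < ℓ →
      ‖𝓕⁻ (freqCutoff c ℓ) y‖ ≤ B * (ℓ * (1 + (ℓ * y) ^ 2)⁻¹) := by
  have hg1 : ContDiff ℝ (⊤ : ℕ∞) fun x => (bump x : ℂ) :=
    Complex.ofRealCLM.contDiff.comp bump.contDiff
  have hg2 : HasCompactSupport fun x => (bump x : ℂ) :=
    bump.hasCompactSupport.comp_left (g := Complex.ofReal) Complex.ofReal_zero
  obtain ⟨S, hS⟩ : ∃ S : SchwartzMap ℝ ℂ, ∀ x, S x = 𝓕⁻ (fun x => (bump x : ℂ)) x := by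
    obtain ⟨S₀, hS₀⟩ : ∃ S : SchwartzMap ℝ ℂ, (S : ℝ → ℂ) = fun x => (bump x : ℂ) :=
      ⟨hg2.toSchwartzMap hg1, rfl⟩
    exact ⟨𝓕⁻ S₀, fun x => by rw [SchwartzMap.fourierInv_coe, hS₀]⟩
  obtain ⟨B₀, hB₀, h0⟩ := S.decay 0 0
  obtain ⟨B₂, hB₂, h2⟩ := S.decay 2 0
  refine ⟨B₀ + B₂, by positivity, fun c ℓ y hℓ => ?_⟩
  rw [fourierInv_freqCutoff hℓ, ← hS]
  generalize ℓ * y = t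
  have a0 := h0 t
  have a2 := h2 t
  simp only [norm_iteratedFDeriv_zero, pow_zero, one_mul, Real.norm_eq_abs, sq_abs] at a0 a2
  have : ‖S t‖ ≤ (B₀ + B₂) * (1 + t ^ 2)⁻¹ := by
    rw [← div_eq_mul_inv, le_div_iff₀ (by positivity)]
    linarith
  calc ℓ * ‖S t‖ ≤ ℓ * ((B₀ + B₂) * (1 + t ^ 2)⁻¹) := by gcongr
    _ = _ := by ring

/-! ### The weights -/

/-- The weight `(1 + (x / t) ^ 2)⁻¹` at scale `t`. -/
noncomputable def wt (t x : ℝ) : ℝ := (1 + (x / t) ^ 2)⁻¹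

theorem wt_pos (t x : ℝ) : 0 < wt t x := by unfold wt; positivity

theorem wt_le_one (t x : ℝ) : wt t x ≤ 1 := by
  unfold wt
  exact inv_le_one_of_one_le₀ (by nlinarith [sq_nonneg (x / t)])

theorem continuous_wt (t : ℝ) : Continuous (wt t) := by
  unfold wt
  exact Continuous.inv₀ (by fun_prop) fun x => by positivity

theorem wt_neg (t x : ℝ) : wt t (-x) = wt t x := by
  unfold wt; rw [neg_div, neg_sq]

theorem wt_sub_comm (t x y : ℝ) : wt t (x - y) = wt t (y - x) := by
  rw [← wt_neg, neg_sub]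

theorem wt_le_sq_div {t x d : ℝ} (ht : 0 < t) (hd : 0 < d) (h : d ≤ |x|) :
    wt t x ≤ (t / d) ^ 2 := by
  unfold wt
  rw [← inv_div d t, inv_pow]
  refine inv_anti₀ (by positivity) ?_
  have : (d / t) ^ 2 ≤ (x / t) ^ 2 := by
    rw [div_pow, div_pow, ← sq_abs x]
    gcongr
  linarith

theorem wt_le_mul {t x y : ℝ} (ht : 0 < t) (h : |x - y| ≤ t) : wt t x ≤ 3 * wt t y := by
  unfold wt
  rw [← div_eq_mul_inv, le_div_iff₀ (by positivity), inv_mul_le_iff₀ (by positivity)]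
  have h1 : ((x - y) / t) ^ 2 ≤ 1 := by
    rw [div_pow, ← sq_abs, div_le_one (by positivity)]
    gcongr
  have h2 : y / t = x / t - (x - y) / t := by ring
  rw [h2]
  nlinarith [sq_nonneg (x / t + (x - y) / t)]

theorem integral_wt {t : ℝ} (ht : 0 < t) : ∫ x, wt t x = Real.pi * t := by
  unfold wt
  rw [Measure.integral_comp_div (fun x => (1 + x ^ 2)⁻¹) t, integral_univ_inv_one_add_sq,
    abs_of_pos ht, smul_eq_mul, mul_comm]

theorem integrable_wt {t : ℝ} (ht : 0 < t) : Integrable (wt t) := by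
  unfold wt
  exact integrable_inv_one_add_sq.comp_div ht.ne'

/-- The weight with values in `ℝ≥0∞`. -/
noncomputable def ewt (t x : ℝ) : ℝ≥0∞ := ENNReal.ofReal (wt t x)

@[fun_prop]
theorem measurable_ewt (t : ℝ) : Measurable (ewt t) :=
  (continuous_wt t).measurable.ennreal_ofReal

theorem ewt_sub_comm (t x y : ℝ) : ewt t (x - y) = ewt t (y - x) := by
  unfold ewt; rw [wt_sub_comm]

theorem lintegral_ewt {t : ℝ} (ht : 0 < t) : ∫⁻ x, ewt t x = ENNReal.ofReal (Real.pi * t) := by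
  unfold ewt
  rw [← ofReal_integral_eq_lintegral_ofReal (integrable_wt ht)
    (Filter.Eventually.of_forall fun x => (wt_pos t x).le), integral_wt ht]

theorem lintegral_ewt_sub {t : ℝ} (ht : 0 < t) (x : ℝ) :
    ∫⁻ z, ewt t (x - z) = ENNReal.ofReal (Real.pi * t) := by
  rw [← lintegral_ewt ht, lintegral_sub_left_eq_self (ewt t) x]

/-- The two weights cannot both be large when `x` and `y` are far apart. -/
theorem wt_mul_wt_le {s t : ℝ} (hs : 0 < s) (ht : 0 < t) (x y z : ℝ) :
    wt s (x - z) * wt t (y - z) ≤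
      wt t (x - y) * (2 * wt s (x - z) + 2 * (s / t) ^ 2 * wt t (y - z)) := by
  unfold wt
  set a := (x - z) / s with ha
  set b := (y - z) / t with hb
  have hxy : (x - y) / t = s / t * a - b := by rw [ha, hb]; field_simp; ring
  rw [hxy]
  set r := s / t with hr
  have hA : (0 : ℝ) < 1 + a ^ 2 := by positivity
  have hB : (0 : ℝ) < 1 + b ^ 2 := by positivity
  have hC : (0 : ℝ) < 1 + (r * a - b) ^ 2 := by positivity
  have e : 2 * (1 + a ^ 2)⁻¹ + 2 * r ^ 2 * (1 + b ^ 2)⁻¹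
      = (2 * (1 + b ^ 2) + 2 * r ^ 2 * (1 + a ^ 2)) * ((1 + a ^ 2)⁻¹ * (1 + b ^ 2)⁻¹) := by
    field_simp
  rw [e, ← mul_assoc]
  refine le_mul_of_one_le_left (by positivity) ?_
  rw [inv_mul_eq_div, one_le_div hC]
  nlinarith [sq_nonneg (r * a + b), sq_nonneg r]

/-- Two weights at scales `s ≤ t` convolve to a weight at the larger scale. -/
theorem lintegral_ewt_mul_ewt_le {s t : ℝ} (hs : 0 < s) (hst : s ≤ t) (x y : ℝ) :
    ∫⁻ z, ewt s (x - z) * ewt t (y - z) ≤ ENNReal.ofReal (4 * Real.pi * s) * ewt t (x - y) := by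
  have ht := hs.trans_le hst
  have hpi := Real.pi_pos
  have hle : ∀ z, ewt s (x - z) * ewt t (y - z) ≤ ewt t (x - y) * (ENNReal.ofReal 2 * ewt s (x - z)
      + ENNReal.ofReal (2 * (s / t) ^ 2) * ewt t (y - z)) := by
    intro z
    unfold ewt
    have p1 := wt_pos s (x - z)
    have p2 := wt_pos t (y - z)
    have p3 := wt_pos t (x - y)
    rw [← ENNReal.ofReal_mul p1.le, ← ENNReal.ofReal_mul (by norm_num),
      ← ENNReal.ofReal_mul (by positivity), ← ENNReal.ofReal_add (by positivity) (by positivity),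
      ← ENNReal.ofReal_mul p3.le]
    exact ENNReal.ofReal_le_ofReal (wt_mul_wt_le hs ht x y z)
  have m1 : Measurable fun z => ewt s (x - z) := (measurable_ewt s).comp (by fun_prop)
  have m2 : Measurable fun z => ewt t (y - z) := (measurable_ewt t).comp (by fun_prop)
  refine (lintegral_mono hle).trans ?_
  rw [lintegral_const_mul _ (by fun_prop), lintegral_add_left (by fun_prop),
    lintegral_const_mul _ m1, lintegral_const_mul _ m2, lintegral_ewt_sub hs, lintegral_ewt_sub ht,
    mul_comm (ewt t (x - y))]
  gcongr
  rw [← ENNReal.ofReal_mul (by norm_num), ← ENNReal.ofReal_mul (by positivity),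
    ← ENNReal.ofReal_add (by positivity) (by positivity)]
  refine ENNReal.ofReal_le_ofReal ?_
  have : (s / t) ^ 2 * t ≤ s := by
    have h1 : s / t ≤ 1 := (div_le_one ht).2 hst
    have h2 : (s / t) ^ 2 * t = s / t * s := by field_simp
    rw [h2]
    exact mul_le_of_le_one_left hs.le h1
  nlinarith

/-- The dual form of the maximal function estimate for averages of scale `k` over functions `h k`
that do not concentrate below scale `k`. Expanding the square and using symmetry, only pairs of
scales `l ≤ k` matter, and in those the finer average is absorbed by the coarser weight. -/
theorem lintegral_sq_sum_le {F : Finset ℤ} {t : ℤ → ℝ} (ht : ∀ k, 0 < t k) (hmono : Monotone t)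
    {h : ℤ → ℝ → ℝ≥0∞} (hmeas : ∀ k, Measurable (h k)) {B : ℝ≥0∞}
    (hB : ∀ k ∈ F, ∀ x, ∑ l ∈ F with l ≤ k, ∫⁻ y, h l y * ewt (t k) (x - y)
      ≤ B * ENNReal.ofReal (t k)) :
    ∫⁻ z, (∑ k ∈ F, (ENNReal.ofReal (t k))⁻¹ * ∫⁻ x, h k x * ewt (t k) (x - z)) ^ 2
      ≤ ENNReal.ofReal (8 * Real.pi) * B * ∑ k ∈ F, ∫⁻ x, h k x := by
  have hpi := Real.pi_pos
  set τ : ℤ → ℝ≥0∞ := fun k => ENNReal.ofReal (t k) with hτ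
  have hτ0 : ∀ k, τ k ≠ 0 := fun k => by simpa [hτ] using ht k
  have hτt : ∀ k, τ k ≠ ⊤ := fun k => ENNReal.ofReal_ne_top
  obtain ⟨A, hA⟩ : ∃ A : ℤ → ℝ → ℝ≥0∞, ∀ k z, A k z = ∫⁻ x, h k x * ewt (t k) (x - z) :=
    ⟨_, fun _ _ => rfl⟩
  have mA : ∀ k, Measurable (A k) := fun k => by
    rw [funext (hA k)]
    exact Measurable.lintegral_prod_right' (f := fun p : ℝ × ℝ => h k p.2 * ewt (t k) (p.2 - p.1))
      (by fun_prop)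
  have mA' : ∀ k l, Measurable fun x => ∫⁻ y, h l y * ewt (t k) (x - y) := fun k l =>
    Measurable.lintegral_prod_right' (f := fun p : ℝ × ℝ => h l p.2 * ewt (t k) (p.1 - p.2))
      (by fun_prop)
  set I : ℤ → ℤ → ℝ≥0∞ := fun k l => (τ k)⁻¹ * (τ l)⁻¹ * ∫⁻ z, A k z * A l z with hI
  have hsym : ∀ k l, I k l = I l k := fun k l => by
    simp only [hI, mul_comm]
  have hle : ∀ k l, l ≤ k → I k l ≤ ENNReal.ofReal (4 * Real.pi) * (τ k)⁻¹ *
      ∫⁻ x, h k x * ∫⁻ y, h l y * ewt (t k) (x - y) := by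
    intro k l hlk
    -- carry out the integration in `z` first; `ewt (t l)` is an approximate identity at scale `t k`
    have e1 : ∫⁻ z, A k z * A l z = ∫⁻ x, h k x * ∫⁻ z, ewt (t k) (x - z) * A l z := by
      have : ∀ z, A k z * A l z = ∫⁻ x, h k x * (ewt (t k) (x - z) * A l z) := fun z => by
        rw [hA k, ← lintegral_mul_const _ (by fun_prop)]
        simp_rw [mul_assoc]
      simp_rw [this]
      rw [lintegral_lintegral_swap (by fun_prop)]
      refine lintegral_congr fun x => ?_
      rw [lintegral_const_mul _ (by fun_prop)]
    have e2 : ∀ x, ∫⁻ z, ewt (t k) (x - z) * A l z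
        = ∫⁻ y, h l y * ∫⁻ z, ewt (t l) (y - z) * ewt (t k) (x - z) := by
      intro x
      have : ∀ z, ewt (t k) (x - z) * A l z
          = ∫⁻ y, h l y * (ewt (t l) (y - z) * ewt (t k) (x - z)) := fun z => by
        rw [mul_comm, hA l, ← lintegral_mul_const _ (by fun_prop)]
        simp_rw [mul_assoc]
      simp_rw [this]
      rw [lintegral_lintegral_swap (by fun_prop)]
      refine lintegral_congr fun y => ?_
      rw [lintegral_const_mul _ (by fun_prop)]
    have e3 : ∀ x, ∫⁻ y, h l y * ∫⁻ z, ewt (t l) (y - z) * ewt (t k) (x - z)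
        ≤ ENNReal.ofReal (4 * Real.pi) * τ l * ∫⁻ y, h l y * ewt (t k) (x - y) := by
      intro x
      rw [← lintegral_const_mul _ (by fun_prop)]
      refine lintegral_mono fun y => ?_
      calc h l y * ∫⁻ z, ewt (t l) (y - z) * ewt (t k) (x - z)
          ≤ h l y * (ENNReal.ofReal (4 * Real.pi * t l) * ewt (t k) (y - x)) := by
            gcongr
            exact lintegral_ewt_mul_ewt_le (ht l) (hmono hlk) y x
        _ = _ := by
            rw [ewt_sub_comm, ENNReal.ofReal_mul (by positivity)]; ring
    calc I k l = (τ k)⁻¹ * (τ l)⁻¹ * ∫⁻ x, h k x * ∫⁻ y, h l y *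
          ∫⁻ z, ewt (t l) (y - z) * ewt (t k) (x - z) := by
          simp only [hI, e1, e2]
      _ ≤ (τ k)⁻¹ * (τ l)⁻¹ * ∫⁻ x, h k x * (ENNReal.ofReal (4 * Real.pi) * τ l *
            ∫⁻ y, h l y * ewt (t k) (x - y)) := by
          gcongr with x
          exact e3 x
      _ = (τ k)⁻¹ * (τ l)⁻¹ * (ENNReal.ofReal (4 * Real.pi) * τ l *
            ∫⁻ x, h k x * ∫⁻ y, h l y * ewt (t k) (x - y)) := by
          have := mA' k l
          congr 1
          rw [← lintegral_const_mul (ENNReal.ofReal (4 * Real.pi) * τ l) (by fun_prop)]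
          exact lintegral_congr fun x => by ring
      _ = ENNReal.ofReal (4 * Real.pi) * (τ k)⁻¹ * ((τ l)⁻¹ * τ l) *
            ∫⁻ x, h k x * ∫⁻ y, h l y * ewt (t k) (x - y) := by ring
      _ = _ := by rw [ENNReal.inv_mul_cancel (hτ0 l) (hτt l), mul_one]
  have hsq : ∫⁻ z, (∑ k ∈ F, (τ k)⁻¹ * A k z) ^ 2 = ∑ k ∈ F, ∑ l ∈ F, I k l := by
    simp_rw [sq, Finset.sum_mul_sum]
    rw [lintegral_finsetSum _ fun k _ => by fun_prop]
    refine Finset.sum_congr rfl fun k _ => ?_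
    rw [lintegral_finsetSum _ fun l _ => by fun_prop]
    refine Finset.sum_congr rfl fun l _ => ?_
    simp only [hI]
    rw [← lintegral_const_mul _ (by fun_prop)]
    refine lintegral_congr fun z => ?_
    ring
  have hhalf : ∑ k ∈ F, ∑ l ∈ F, I k l ≤ 2 * ∑ k ∈ F, ∑ l ∈ F with l ≤ k, I k l := by
    have h1 : ∀ k, ∑ l ∈ F, I k l ≤ ∑ l ∈ F with l ≤ k, I k l + ∑ l ∈ F with k ≤ l, I k l := by
      intro k
      rw [← Finset.sum_filter_add_sum_filter_not F (fun l => l ≤ k)]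
      gcongr with l hl
      intro hl'; exact (not_le.1 hl').le
    have h2 : ∑ k ∈ F, ∑ l ∈ F with k ≤ l, I k l = ∑ k ∈ F, ∑ l ∈ F with l ≤ k, I k l := by
      simp_rw [Finset.sum_filter]
      rw [Finset.sum_comm]
      simp_rw [hsym]
    calc _ ≤ ∑ k ∈ F, (∑ l ∈ F with l ≤ k, I k l + ∑ l ∈ F with k ≤ l, I k l) :=
          Finset.sum_le_sum fun k _ => h1 k
      _ = _ := by rw [Finset.sum_add_distrib, h2, two_mul]
  simp_rw [← hA]
  rw [hsq]
  refine hhalf.trans ?_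
  calc 2 * ∑ k ∈ F, ∑ l ∈ F with l ≤ k, I k l
      ≤ 2 * ∑ k ∈ F, ∑ l ∈ F with l ≤ k, ENNReal.ofReal (4 * Real.pi) * (τ k)⁻¹ *
        ∫⁻ x, h k x * ∫⁻ y, h l y * ewt (t k) (x - y) := by
        gcongr with k hk l hl
        exact hle k l (Finset.mem_filter.1 hl).2
    _ ≤ 2 * ∑ k ∈ F, ENNReal.ofReal (4 * Real.pi) * (τ k)⁻¹ * ∫⁻ x, h k x * (B * τ k) := by
        gcongr with k hk
        rw [← Finset.mul_sum, ← lintegral_finsetSum _ fun l _ => by have := mA' k l; fun_prop]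
        gcongr with x
        rw [← Finset.mul_sum]
        gcongr
        exact hB k hk x
    _ = 2 * ∑ k ∈ F, ENNReal.ofReal (4 * Real.pi) * B * ∫⁻ x, h k x := by
        congr 1
        refine Finset.sum_congr rfl fun k _ => ?_
        rw [lintegral_mul_const _ (hmeas k)]
        calc _ = ENNReal.ofReal (4 * Real.pi) * ((τ k)⁻¹ * τ k) * B * ∫⁻ x, h k x := by ring
          _ = _ := by rw [ENNReal.inv_mul_cancel (hτ0 k) (hτt k), mul_one]
    _ = _ := by
        rw [← Finset.mul_sum, ← mul_assoc, ← mul_assoc,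
          show (2 : ℝ≥0∞) = ENNReal.ofReal 2 by norm_num, ← ENNReal.ofReal_mul (by norm_num)]
        congr 3; ring

/-! ### Wave packets on a tree -/

namespace BiTile

theorem cutoff_pos (P : BiTile u v) (x : ℝ) : 0 < P.cutoff x := by
  unfold cutoff; positivity

theorem cutoff_le_one (P : BiTile u v) (x : ℝ) : P.cutoff x ≤ 1 := by
  unfold cutoff
  exact Real.rpow_le_one_of_one_le_of_nonpos (by nlinarith [sq_nonneg (|x - P.center| / P.len)])
    (by norm_num)

theorem cutoff_sq (P : BiTile u v) (x : ℝ) : P.cutoff x ^ 2 = wt P.len (x - P.center) := by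
  unfold cutoff wt
  rw [← Real.rpow_natCast, ← Real.rpow_mul (by positivity), div_pow, sq_abs, ← div_pow]
  norm_num
  rw [Real.rpow_neg_one]

theorem cutoff_eq_rpow (P : BiTile u v) (x : ℝ) :
    P.cutoff x = wt P.len (x - P.center) ^ (1 / 2 : ℝ) := by
  rw [← cutoff_sq, ← Real.rpow_natCast, ← Real.rpow_mul (P.cutoff_pos x).le]
  norm_num

theorem continuous_cutoff (P : BiTile u v) : Continuous P.cutoff := by
  have : P.cutoff = fun x => wt P.len (x - P.center) ^ (1 / 2 : ℝ) := funext P.cutoff_eq_rpow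
  rw [this]
  exact ((continuous_wt _).comp (by fun_prop)).rpow_const fun x => .inr (by norm_num)

end BiTile

/-- The properties of a wave packet that the tree estimate uses: frequency localisation, and decay
of order `C + 2`, where the factor `wt` is what remains after the weight of the mass is split
off. -/
structure IsPacket (C K₀ : ℝ) (P : BiTile u v) (φ : ℝ → ℂ) : Prop where
  measurable : Measurable φ
  support : Function.support (𝓕 φ) ⊆ P.coreω₁
  bound : ∀ x, ‖φ x‖ ≤ K₀ * (√P.len)⁻¹ * (P.cutoff x ^ C * wt P.len (x - P.center))

theorem IsWavePacket.isPacket {K : ℕ → ℝ} {P : BiTile u v} {φ : ℝ → ℂ} (h : IsWavePacket K P φ)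
    (C : ℝ) : IsPacket C |K (⌈C⌉₊ + 2)| P φ := by
  refine ⟨h.measurable, h.fourier_support, fun x => (h.decay (⌈C⌉₊ + 2) x).trans ?_⟩
  have e : P.len ^ (-(1 / 2) : ℝ) = (√P.len)⁻¹ := by
    rw [Real.rpow_neg P.len_pos.le, Real.sqrt_eq_rpow]
  have hc := P.cutoff_pos x
  rw [e, pow_add, BiTile.cutoff_sq]
  have hw := wt_pos P.len (x - P.center)
  gcongr
  · exact le_abs_self _
  · rw [← Real.rpow_natCast]
    exact Real.rpow_le_rpow_of_exponent_ge hc (P.cutoff_le_one x) (Nat.le_ceil C)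

namespace IsPacket

variable {C K₀ : ℝ} {P : BiTile u v} {φ : ℝ → ℂ}

theorem bound' (h : IsPacket C K₀ P φ) (hC : 0 ≤ C) (hK : 0 ≤ K₀) (x : ℝ) :
    ‖φ x‖ ≤ K₀ * (√P.len)⁻¹ * wt P.len (x - P.center) := by
  refine (h.bound x).trans ?_
  gcongr
  exact mul_le_of_le_one_left (wt_pos _ _).le
    (Real.rpow_le_one (P.cutoff_pos x).le (P.cutoff_le_one x) hC)

theorem integrable (h : IsPacket C K₀ P φ) (hC : 0 ≤ C) (hK : 0 ≤ K₀) : Integrable φ :=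
  (((integrable_wt P.len_pos).comp_sub_right P.center).const_mul _).mono'
    h.measurable.aestronglyMeasurable (Filter.Eventually.of_forall (h.bound' hC hK))

theorem enorm_le (h : IsPacket C K₀ P φ) (hK : 0 ≤ K₀) (x : ℝ) :
    ‖φ x‖ₑ ≤ ENNReal.ofReal (K₀ * (√P.len)⁻¹) *
      (ENNReal.ofReal (P.cutoff x ^ C) * ewt P.len (x - P.center)) := by
  have h1 : 0 ≤ P.cutoff x ^ C := Real.rpow_nonneg (P.cutoff_pos x).le _
  unfold ewt
  rw [← ENNReal.ofReal_mul h1, ← ENNReal.ofReal_mul (by positivity), ← ofReal_norm]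
  exact ENNReal.ofReal_le_ofReal (h.bound x)

end IsPacket

theorem IsTree.disjoint_I {T : Finset (BiTile u v)} {top : BiTile u v} (hT : IsTree T top)
    {P Q : BiTile u v} (hP : P ∈ T) (hQ : Q ∈ T) (hj : P.j = Q.j) (hne : P ≠ Q) :
    Disjoint P.I Q.I := by
  refine Set.disjoint_left.2 fun x hx hx' => hne ?_
  exact BiTile.eq_of_meet hj hx hx' ((hT P hP).2 top.freqMid_mem) ((hT Q hQ).2 top.freqMid_mem)

theorem sum_len_mul_ewt_le {S : Finset (BiTile u v)}
    (hS : (S : Set (BiTile u v)).PairwiseDisjoint BiTile.I) {t : ℝ}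
    (ht : 0 < t) (hle : ∀ P ∈ S, P.len ≤ t) (x : ℝ) :
    ∑ P ∈ S, ENNReal.ofReal P.len * ewt t (x - P.center) ≤ ENNReal.ofReal (3 * Real.pi * t) := by
  have key : ∀ P ∈ S, ENNReal.ofReal P.len * ewt t (x - P.center)
      ≤ ∫⁻ y in P.I, ENNReal.ofReal 3 * ewt t (x - y) := by
    intro P hP
    rw [← BiTile.volume_I, mul_comm, ← setLIntegral_const]
    refine setLIntegral_mono (by fun_prop) fun y hy => ?_
    unfold ewt
    rw [← ENNReal.ofReal_mul (by norm_num)]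
    refine ENNReal.ofReal_le_ofReal (wt_le_mul ht ?_)
    have hl := hle P hP
    have hp := P.len_pos
    unfold BiTile.I at hy
    unfold BiTile.center
    rw [abs_le]
    constructor <;> nlinarith [hy.1, hy.2]
  calc _ ≤ ∑ P ∈ S, ∫⁻ y in P.I, ENNReal.ofReal 3 * ewt t (x - y) := Finset.sum_le_sum key
    _ = ∫⁻ y in ⋃ P ∈ S, P.I, ENNReal.ofReal 3 * ewt t (x - y) :=
        (lintegral_biUnion_finset hS (fun P _ => measurableSet_Ioo) _).symm
    _ ≤ ∫⁻ y, ENNReal.ofReal 3 * ewt t (x - y) := setLIntegral_le_lintegral _ _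
    _ = _ := by
        rw [lintegral_const_mul _ (by fun_prop), lintegral_ewt_sub ht,
          ← ENNReal.ofReal_mul (by norm_num), mul_assoc]

/-- The time intervals of a given scale in a tree are disjoint, so that the weights at a point add
up to `O(1)`. -/
theorem IsTree.sum_wt_le {T : Finset (BiTile u v)} {top : BiTile u v} (hT : IsTree T top) (j : ℤ)
    (x : ℝ) : ∑ P ∈ T with P.j = j, ewt P.len (x - P.center) ≤ ENNReal.ofReal (3 * Real.pi) := by
  have hl : ∀ P ∈ T.filter (fun P => P.j = j), P.len = scaleLen u j := fun P hP => by
    rw [BiTile.len_eq_scaleLen, (Finset.mem_filter.1 hP).2]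
  have h0 := scaleLen_pos u j
  have := sum_len_mul_ewt_le (S := T.filter fun P => P.j = j) (fun P hP Q hQ hne => by
      have hP' := Finset.mem_filter.1 (Finset.mem_coe.1 hP)
      have hQ' := Finset.mem_filter.1 (Finset.mem_coe.1 hQ)
      exact hT.disjoint_I hP'.1 hQ'.1 (hP'.2.trans hQ'.2.symm) hne) h0
      (fun P hP => (hl P hP).le) x
  have e : ∑ P ∈ T with P.j = j, ENNReal.ofReal P.len * ewt (scaleLen u j) (x - P.center)
      = ENNReal.ofReal (scaleLen u j) * ∑ P ∈ T with P.j = j, ewt P.len (x - P.center) := by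
    rw [Finset.mul_sum]
    exact Finset.sum_congr rfl fun P hP => by rw [hl P hP]
  rw [e, mul_comm (3 * Real.pi), ENNReal.ofReal_mul h0.le] at this
  exact (ENNReal.mul_le_mul_iff_right (by simpa using h0) ENNReal.ofReal_ne_top).1 this

theorem BiTile.coreω₁_subset (P : BiTile u v) : P.coreω₁ ⊆ P.ω₁ := by
  have := P.freqLen_pos
  exact Set.Ioo_subset_Ioo (by linarith) (by linarith)

theorem IsTwoTree.freq_mem {T : Finset (BiTile u v)} {top : BiTile u v} (hT : IsTwoTree T top)
    {P : BiTile u v} (hP : P ∈ T) : top.freqLeft + 3 / 4 * top.freqLen ∈ P.ω₂ :=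
  hT.2 P hP top.freqQuarter_mem

/-- In a `2`-tree, the frequency intervals of larger tiles lie in the right half of those of
smaller ones. -/
theorem IsTwoTree.ω_subset {T : Finset (BiTile u v)} {top : BiTile u v} (hT : IsTwoTree T top)
    {P Q : BiTile u v} (hP : P ∈ T) (hQ : Q ∈ T) (h : P.j < Q.j) : Q.ω ⊆ P.ω₂ :=
  BiTile.ω_subset_ω₂ h (hT.freq_mem hP) (Q.ω₂_subset (hT.freq_mem hQ))

theorem IsTwoTree.disjoint_core {T : Finset (BiTile u v)} {top : BiTile u v} (hT : IsTwoTree T top)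
    {P Q : BiTile u v} (hP : P ∈ T) (hQ : Q ∈ T) (h : P.j ≠ Q.j) :
    Disjoint P.coreω₁ Q.coreω₁ := by
  wlog hlt : P.j < Q.j generalizing P Q
  · exact (this hQ hP h.symm (lt_of_le_of_ne (not_lt.1 hlt) h.symm)).symm
  exact P.disjoint_ω₁_ω₂.mono P.coreω₁_subset
    ((Q.coreω₁_subset.trans Q.ω₁_subset).trans (hT.ω_subset hP hQ hlt))

theorem norm_integral_mul_conj_le {C K₀ : ℝ} (hC : 0 ≤ C) (hK : 0 ≤ K₀) {P Q : BiTile u v}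
    {φ ψ : ℝ → ℂ} (hφ : IsPacket C K₀ P φ) (hψ : IsPacket C K₀ Q ψ) (hj : P.j = Q.j) :
    ‖∫ x, φ x * conj (ψ x)‖ ≤ 4 * Real.pi * K₀ ^ 2 * wt P.len (P.center - Q.center) := by
  have hl : Q.len = P.len := by rw [BiTile.len_eq_scaleLen, BiTile.len_eq_scaleLen, hj]
  have hp := P.len_pos
  have hb : ∀ x, ‖φ x * conj (ψ x)‖ ≤ K₀ ^ 2 * P.len⁻¹ * (wt P.len (P.center - Q.center) *
      (2 * wt P.len (x - P.center) + 2 * wt P.len (x - Q.center))) := by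
    intro x
    rw [norm_mul, RCLike.norm_conj]
    have h1 := hφ.bound' hC hK x
    have h2 := hψ.bound' hC hK x
    rw [hl] at h2
    have h3 := wt_mul_wt_le hp hp P.center Q.center x
    rw [div_self hp.ne', one_pow, mul_one, wt_sub_comm _ _ x, wt_sub_comm _ _ x] at h3
    have hs : (√P.len)⁻¹ * (√P.len)⁻¹ = P.len⁻¹ := by
      rw [← mul_inv, Real.mul_self_sqrt hp.le]
    calc ‖φ x‖ * ‖ψ x‖ ≤ (K₀ * (√P.len)⁻¹ * wt P.len (x - P.center)) *
          (K₀ * (√P.len)⁻¹ * wt P.len (x - Q.center)) := by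
          gcongr
          have := wt_pos P.len (x - P.center)
          positivity
      _ = K₀ ^ 2 * ((√P.len)⁻¹ * (√P.len)⁻¹) * (wt P.len (x - P.center) *
          wt P.len (x - Q.center)) := by ring
      _ ≤ _ := by rw [hs]; gcongr
  have i1 := (integrable_wt hp).comp_sub_right P.center
  have i2 := (integrable_wt hp).comp_sub_right Q.center
  refine (norm_integral_le_of_norm_le ((((i1.const_mul 2).add (i2.const_mul 2)).const_mul _).const_mul
    _) (Filter.Eventually.of_forall hb)).trans (le_of_eq ?_)
  have e : ∫ x, (2 * wt P.len (x - P.center) + 2 * wt P.len (x - Q.center))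
      = 4 * Real.pi * P.len := by
    rw [integral_add (i1.const_mul 2) (i2.const_mul 2), integral_const_mul, integral_const_mul,
      integral_sub_right_eq_self (wt P.len), integral_sub_right_eq_self (wt P.len), integral_wt hp]
    ring
  simp only [Pi.add_apply]
  rw [integral_const_mul, integral_const_mul, e]
  field_simp

/-- Almost orthogonality of the wave packets in a `2`-tree: packets of different scales are
orthogonal, and for packets of the same scale Schur's test applies. -/
theorem IsTwoTree.lintegral_sq_le {C K₀ : ℝ} (hC : 0 ≤ C) (hK : 0 ≤ K₀)
    {T : Finset (BiTile u v)} {top : BiTile u v} (hT : IsTwoTree T top)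
    {φ : BiTile u v → ℝ → ℂ} (hφ : ∀ P ∈ T, IsPacket C K₀ P (φ P)) (a : BiTile u v → ℂ) :
    ∫⁻ z, ‖∑ P ∈ T, a P * φ P z‖ₑ ^ 2
      ≤ ENNReal.ofReal (12 * Real.pi ^ 2 * K₀ ^ 2 * ∑ P ∈ T, ‖a P‖ ^ 2) := by
  have hint : ∀ P ∈ T, Integrable (φ P) := fun P hP => (hφ P hP).integrable hC hK
  have hint2 : ∀ P ∈ T, ∀ Q ∈ T, Integrable fun x => φ P x * conj (φ Q x) := by
    intro P hP Q hQ
    refine (hint P hP).mul_bdd (c := K₀ * (√Q.len)⁻¹)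
      (Complex.continuous_conj.measurable.comp (hφ Q hQ).measurable).aestronglyMeasurable
      (Filter.Eventually.of_forall fun x => ?_)
    rw [RCLike.norm_conj]
    exact ((hφ Q hQ).bound' hC hK x).trans (mul_le_of_le_one_right (by positivity) (wt_le_one _ _))
  have hexp : ∀ z, ((‖∑ P ∈ T, a P * φ P z‖ ^ 2 : ℝ) : ℂ)
      = ∑ P ∈ T, ∑ Q ∈ T, a P * conj (a Q) * (φ P z * conj (φ Q z)) := by
    intro z
    rw [Complex.ofReal_pow, ← Complex.mul_conj', map_sum, Finset.sum_mul_sum]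
    refine Finset.sum_congr rfl fun P _ => Finset.sum_congr rfl fun Q _ => ?_
    rw [map_mul]; ring
  have hintS : Integrable fun z => ((‖∑ P ∈ T, a P * φ P z‖ ^ 2 : ℝ) : ℂ) := by
    simp_rw [hexp]
    exact integrable_finsetSum _ fun P hP => integrable_finsetSum _ fun Q hQ =>
      (hint2 P hP Q hQ).const_mul _
  have hintR : Integrable fun z => ‖∑ P ∈ T, a P * φ P z‖ ^ 2 := by
    exact hintS.re
  set e : BiTile u v → BiTile u v → ℝ := fun P Q =>
    if P.j = Q.j then 4 * Real.pi * K₀ ^ 2 * wt P.len (P.center - Q.center) else 0 with he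
  have he0 : ∀ P Q, 0 ≤ e P Q := fun P Q => by
    have := wt_pos P.len (P.center - Q.center)
    have := Real.pi_pos
    simp only [he]; split_ifs <;> positivity
  have hesym : ∀ P Q, e P Q = e Q P := fun P Q => by
    simp only [he]
    by_cases h : P.j = Q.j
    · have hl : Q.len = P.len := by rw [BiTile.len_eq_scaleLen, BiTile.len_eq_scaleLen, h]
      rw [if_pos h, if_pos h.symm, hl, wt_sub_comm]
    · rw [if_neg h, if_neg (Ne.symm h)]
  have hpair : ∀ P ∈ T, ∀ Q ∈ T, ‖∫ z, φ P z * conj (φ Q z)‖ ≤ e P Q := by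
    intro P hP Q hQ
    by_cases h : P.j = Q.j
    · simp only [he, if_pos h]
      exact norm_integral_mul_conj_le hC hK (hφ P hP) (hφ Q hQ) h
    · simp only [he, if_neg h]
      rw [integral_mul_conj_eq_zero (hint P hP) (hint Q hQ)
        (integrable_fourier_of_support (hint P hP) (hφ P hP).support)
        ((hT.disjoint_core hP hQ h).mono (hφ P hP).support (hφ Q hQ).support), norm_zero]
  have hrow : ∀ P, ∑ Q ∈ T, e P Q ≤ 12 * Real.pi ^ 2 * K₀ ^ 2 := by
    intro P
    simp only [he]
    rw [← Finset.sum_filter, ← Finset.mul_sum]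
    have h1 := hT.1.sum_wt_le P.j P.center
    have h2 : ∑ Q ∈ T with P.j = Q.j, wt P.len (P.center - Q.center) ≤ 3 * Real.pi := by
      have hpi := Real.pi_pos
      rw [← ENNReal.ofReal_le_ofReal_iff (by positivity),
        ENNReal.ofReal_sum_of_nonneg fun Q _ => (wt_pos _ _).le]
      refine le_trans (le_of_eq ?_) h1
      refine Finset.sum_congr (by ext Q; simp [eq_comm]) fun Q hQ => ?_
      have : Q.len = P.len := by
        rw [BiTile.len_eq_scaleLen, BiTile.len_eq_scaleLen, (Finset.mem_filter.1 hQ).2]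
      rw [ewt, this]
    calc _ ≤ 4 * Real.pi * K₀ ^ 2 * (3 * Real.pi) := by
          have := Real.pi_pos
          gcongr
      _ = _ := by ring
  have hmain : ∫ z, ‖∑ P ∈ T, a P * φ P z‖ ^ 2
      ≤ 12 * Real.pi ^ 2 * K₀ ^ 2 * ∑ P ∈ T, ‖a P‖ ^ 2 := by
    have h1 : ((∫ z, ‖∑ P ∈ T, a P * φ P z‖ ^ 2 : ℝ) : ℂ)
        = ∑ P ∈ T, ∑ Q ∈ T, a P * conj (a Q) * ∫ z, φ P z * conj (φ Q z) := by
      rw [← integral_complex_ofReal]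
      simp_rw [hexp]
      rw [integral_finsetSum _ fun P hP => integrable_finsetSum _ fun Q hQ =>
        (hint2 P hP Q hQ).const_mul _]
      refine Finset.sum_congr rfl fun P hP => ?_
      rw [integral_finsetSum _ fun Q hQ => (hint2 P hP Q hQ).const_mul _]
      exact Finset.sum_congr rfl fun Q hQ => integral_const_mul _ _
    calc ∫ z, ‖∑ P ∈ T, a P * φ P z‖ ^ 2
        ≤ ‖((∫ z, ‖∑ P ∈ T, a P * φ P z‖ ^ 2 : ℝ) : ℂ)‖ := by
          rw [Complex.norm_real]; exact le_abs_self _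
      _ ≤ ∑ P ∈ T, ∑ Q ∈ T, (‖a P‖ ^ 2 * e P Q / 2 + ‖a Q‖ ^ 2 * e Q P / 2) := by
          rw [h1]
          refine (norm_sum_le _ _).trans (Finset.sum_le_sum fun P hP => ?_)
          refine (norm_sum_le _ _).trans (Finset.sum_le_sum fun Q hQ => ?_)
          rw [norm_mul, norm_mul, RCLike.norm_conj, hesym Q P]
          have h2 := hpair P hP Q hQ
          have h3 := he0 P Q
          calc ‖a P‖ * ‖a Q‖ * ‖∫ z, φ P z * conj (φ Q z)‖ ≤ ‖a P‖ * ‖a Q‖ * e P Q := by gcongr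
            _ ≤ _ := by nlinarith [sq_nonneg (‖a P‖ - ‖a Q‖)]
      _ = ∑ P ∈ T, ‖a P‖ ^ 2 * ∑ Q ∈ T, e P Q := by
          simp_rw [Finset.sum_add_distrib]
          rw [Finset.sum_comm (f := fun P Q => ‖a Q‖ ^ 2 * e Q P / 2), ← Finset.sum_add_distrib]
          refine Finset.sum_congr rfl fun P _ => ?_
          rw [← Finset.sum_div, ← Finset.mul_sum]; ring
      _ ≤ ∑ P ∈ T, ‖a P‖ ^ 2 * (12 * Real.pi ^ 2 * K₀ ^ 2) := by
          gcongr with P _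
          exact hrow P
      _ = _ := by rw [← Finset.sum_mul]; ring
  calc ∫⁻ z, ‖∑ P ∈ T, a P * φ P z‖ₑ ^ 2
      = ∫⁻ z, ENNReal.ofReal (‖∑ P ∈ T, a P * φ P z‖ ^ 2) := by
        refine lintegral_congr fun z => ?_
        rw [ENNReal.ofReal_pow (norm_nonneg _), ofReal_norm]
    _ = ENNReal.ofReal (∫ z, ‖∑ P ∈ T, a P * φ P z‖ ^ 2) :=
        (ofReal_integral_eq_lintegral_ofReal hintR
          (Filter.Eventually.of_forall fun z => by positivity)).symm
    _ ≤ _ := ENNReal.ofReal_le_ofReal hmain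

/-! ### The stopping time of a tree -/

/-- The position of the dyadic interval of scale `m` containing `x`. -/
noncomputable def idx (u : ℝ) (m : ℤ) (x : ℝ) : ℤ := ⌊x / scaleLen u m⌋

theorem idx_eq_iff {m i : ℤ} {x : ℝ} :
    idx u m x = i ↔ x ∈ Set.Ico (scaleLen u m * i) (scaleLen u m * (i + 1)) := by
  have h := scaleLen_pos u m
  unfold idx
  rw [Int.floor_eq_iff, le_div_iff₀ h, div_lt_iff₀ h, Set.mem_Ico, mul_comm, mul_comm (_ + _)]

theorem idx_succ (m : ℤ) (x : ℝ) : idx u (m + 1) x = idx u m x / 2 := by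
  unfold idx
  rw [scaleLen_succ, ← div_div]
  exact_mod_cast Int.floor_div_natCast (x / scaleLen u m) 2

theorem idx_congr {m m' : ℤ} (h : m ≤ m') {x y : ℝ} (hxy : idx u m x = idx u m y) :
    idx u m' x = idx u m' y := by
  induction m', h using Int.leInduction with
  | base => exact hxy
  | succ n _ ih => rw [idx_succ, idx_succ, ih]

theorem measurable_idx (u : ℝ) (m : ℤ) : Measurable (idx u m) :=
  Int.measurable_floor.comp (measurable_id.div_const _)

theorem le_abs_sub_of_idx {m : ℤ} {x y : ℝ} (h : 2 ≤ |idx u m x - idx u m y|) :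
    scaleLen u m ≤ |x - y| := by
  have ht := scaleLen_pos u m
  obtain ⟨a1, a2⟩ := idx_eq_iff.1 (rfl : idx u m x = idx u m x)
  obtain ⟨b1, b2⟩ := idx_eq_iff.1 (rfl : idx u m y = idx u m y)
  rcases le_abs.1 h with h | h
  · have h' : (2 : ℝ) ≤ (idx u m x : ℝ) - idx u m y := by exact_mod_cast h
    refine le_trans ?_ (le_abs_self _)
    nlinarith
  · have h' : (2 : ℝ) ≤ -((idx u m x : ℝ) - idx u m y) := by exact_mod_cast h
    refine le_trans ?_ (neg_le_abs _)
    nlinarith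

theorem abs_sub_le_of_idx {m : ℤ} {x y : ℝ} (h : |idx u m x - idx u m y| ≤ 1) :
    |x - y| ≤ 2 * scaleLen u m := by
  have ht := scaleLen_pos u m
  obtain ⟨a1, a2⟩ := idx_eq_iff.1 (rfl : idx u m x = idx u m x)
  obtain ⟨b1, b2⟩ := idx_eq_iff.1 (rfl : idx u m y = idx u m y)
  rw [abs_le] at h
  have h1 : (-1 : ℝ) ≤ (idx u m x : ℝ) - idx u m y := by exact_mod_cast h.1
  have h2 : (idx u m x : ℝ) - idx u m y ≤ 1 := by exact_mod_cast h.2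
  rw [abs_le]
  constructor <;> nlinarith

theorem abs_sub_le_of_idx_eq {m : ℤ} {x y : ℝ} (h : idx u m x = idx u m y) :
    |x - y| ≤ scaleLen u m := by
  obtain ⟨a1, a2⟩ := idx_eq_iff.1 h
  obtain ⟨b1, b2⟩ := idx_eq_iff.1 (rfl : idx u m y = idx u m y)
  rw [abs_le]
  constructor <;> nlinarith

theorem BiTile.idx_of_mem {P : BiTile u v} {x : ℝ} (h : x ∈ P.I) : idx u P.j x = P.k :=
  idx_eq_iff.2 ⟨h.1.le, h.2⟩

theorem BiTile.idx_center_of_le {P Q : BiTile u v} (h : P.I ⊆ Q.I) : idx u Q.j P.center = Q.k :=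
  BiTile.idx_of_mem (h P.center_mem)

/-- A stopping time for the tree `T`: neither the dyadic interval of scale `κ x` around `x` nor its
two neighbours contain the time interval of a bi-tile of `T`, and this fails at the next scale
unless `κ x` is already the scale of the top. A time interval is located by its center. The scale
`κ x` is constant on the dyadic interval that it defines. -/
structure IsStopping (T : Finset (BiTile u v)) (top : BiTile u v) (κ : ℝ → ℤ) : Prop where
  bddBelow : ∃ m₀, ∀ x, m₀ ≤ κ x
  le_top : ∀ x, κ x ≤ top.j
  far : ∀ x, ∀ P ∈ T, P.j ≤ κ x → 2 ≤ |idx u (κ x) P.center - idx u (κ x) x|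
  near : ∀ x, κ x < top.j →
    ∃ P ∈ T, P.j ≤ κ x + 1 ∧ |idx u (κ x + 1) P.center - idx u (κ x + 1) x| ≤ 1
  const : ∀ x y, idx u (κ x) y = idx u (κ x) x → κ y = κ x

theorem exists_isStopping (T : Finset (BiTile u v)) (top : BiTile u v) :
    ∃ κ, IsStopping T top κ := by
  obtain ⟨m₀, hm₀, hm₀'⟩ : ∃ m₀ ≤ top.j, ∀ P ∈ T, m₀ < P.j := by
    obtain ⟨b, hb⟩ := (T.image BiTile.j).bddBelow
    refine ⟨min (b - 1) top.j, min_le_right _ _, fun P hP => (min_le_left _ _).trans_lt ?_⟩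
    have := hb (Finset.mem_coe.2 (Finset.mem_image_of_mem BiTile.j hP))
    omega
  let Bad : ℤ → ℝ → Prop := fun m x => ∃ P ∈ T, P.j ≤ m ∧ |idx u m P.center - idx u m x| ≤ 1
  have hbot : ∀ x, ¬ Bad m₀ x := by
    rintro x ⟨P, hP, h, -⟩
    exact absurd (hm₀' P hP) (not_lt.2 h)
  have hex : ∀ x, ∃ m, (m ≤ top.j ∧ ¬ Bad m x) ∧ ∀ m', m' ≤ top.j ∧ ¬ Bad m' x → m' ≤ m :=
    fun x => Int.exists_greatest_of_bdd ⟨top.j, fun m hm => hm.1⟩ ⟨m₀, hm₀, hbot x⟩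
  -- the largest admissible scale is a stopping time
  choose κ hκ hmax using hex
  refine ⟨κ, ⟨m₀, fun x => hmax x m₀ ⟨hm₀, hbot x⟩⟩, fun x => (hκ x).1, ?_, ?_, ?_⟩
  · intro x P hP hj
    by_contra hcon
    exact (hκ x).2 ⟨P, hP, hj, by omega⟩
  · intro x hx
    by_contra hcon
    have := hmax x (κ x + 1) ⟨hx, hcon⟩
    omega
  · intro x y hxy
    have hbad : ∀ m, κ x ≤ m → (Bad m y ↔ Bad m x) := fun m hm => by
      simp only [Bad, idx_congr hm hxy]
    have h1 : κ x ≤ κ y := hmax y (κ x) ⟨(hκ x).1, fun h => (hκ x).2 ((hbad _ le_rfl).1 h)⟩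
    exact le_antisymm (hmax x (κ y) ⟨(hκ y).1, fun h => (hκ y).2 ((hbad _ h1).2 h)⟩) h1

/-- The union of the time interval of the top and its two neighbours. -/
def nbhd (top : BiTile u v) : Set ℝ := {x | |idx u top.j x - top.k| ≤ 1}

theorem measurableSet_nbhd (top : BiTile u v) : MeasurableSet (nbhd top) :=
  measurable_idx u top.j (MeasurableSet.of_discrete (s := {i : ℤ | |i - top.k| ≤ 1}))

theorem volume_nbhd_le (top : BiTile u v) :
    volume (nbhd top) ≤ ENNReal.ofReal (3 * top.len) := by
  have hsub : nbhd top ⊆ Set.Ico (top.len * (top.k - 1)) (top.len * (top.k + 2)) := by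
    intro x hx
    have hx' := abs_le.1 (show |idx u top.j x - top.k| ≤ 1 from hx)
    obtain ⟨a1, a2⟩ := idx_eq_iff.1 (rfl : idx u top.j x = idx u top.j x)
    have h1 : (-1 : ℝ) ≤ (idx u top.j x : ℝ) - top.k := by exact_mod_cast hx'.1
    have h2 : (idx u top.j x : ℝ) - top.k ≤ 1 := by exact_mod_cast hx'.2
    have ht := top.len_pos
    rw [← BiTile.len_eq_scaleLen] at a1 a2
    constructor <;> nlinarith
  refine (measure_mono hsub).trans (le_of_eq ?_)
  rw [Real.volume_Ico]; congr 1; ring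

namespace IsStopping

variable {T : Finset (BiTile u v)} {top : BiTile u v} {κ : ℝ → ℤ}

/-- The dyadic interval of scale `κ x` containing `x`. -/
def cell (u : ℝ) (κ : ℝ → ℤ) (x : ℝ) : Set ℝ := {y | idx u (κ x) y = idx u (κ x) x}

theorem measurableSet_cell (x : ℝ) : MeasurableSet (cell u κ x) :=
  measurable_idx u _ (measurableSet_singleton _)

theorem volume_cell (x : ℝ) : volume (cell u κ x) = ENNReal.ofReal (scaleLen u (κ x)) := by
  have : cell u κ x = Set.Ico (scaleLen u (κ x) * idx u (κ x) x)
      (scaleLen u (κ x) * (idx u (κ x) x + 1)) := Set.ext fun y => idx_eq_iff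
  rw [this, Real.volume_Ico]; congr 1; ring

theorem measurable (h : IsStopping T top κ) : Measurable κ := by
  refine measurable_to_countable' fun k => ?_
  have : κ ⁻¹' {k} = idx u k ⁻¹' (idx u k '' (κ ⁻¹' {k})) := by
    refine Set.Subset.antisymm (Set.subset_preimage_image _ _) ?_
    rintro y ⟨x, hx, hxy⟩
    have hx' : κ x = k := hx
    subst hx'
    exact h.const x y hxy.symm
  rw [this]
  exact measurable_idx u k MeasurableSet.of_discrete

theorem cell_subset_nbhd (h : IsStopping T top κ) {x : ℝ} (hx : x ∈ nbhd top) :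
    cell u κ x ⊆ nbhd top := by
  intro y hy
  change |idx u top.j y - top.k| ≤ 1
  rw [idx_congr (h.le_top x) hy]
  exact hx

/-- The cells of a stopping time partition the neighbourhood of the top, so that an inequality
between integrals holds if it holds on each cell. -/
theorem setLIntegral_nbhd_le (h : IsStopping T top κ) {f g : ℝ → ℝ≥0∞}
    (hfg : ∀ x ∈ nbhd top, ∫⁻ y in cell u κ x, f y ≤ ∫⁻ y in cell u κ x, g y) :
    ∫⁻ y in nbhd top, f y ≤ ∫⁻ y in nbhd top, g y := by
  set τ : ℝ → ℤ × ℤ := fun x => (κ x, idx u (κ x) x) with hτ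
  have hmem : ∀ x y, y ∈ cell u κ x ↔ τ y = τ x := by
    intro x y
    simp only [hτ, Prod.mk.injEq]
    constructor
    · intro hy
      have := h.const x y hy
      exact ⟨this, by rw [this]; exact hy⟩
    · rintro ⟨h1, h2⟩
      rw [h1] at h2; exact h2
  set Λ : Set (ℤ × ℤ) := τ '' nbhd top with hΛ
  have hcell : ∀ x, τ ⁻¹' {τ x} = cell u κ x := fun x => by
    ext y; exact (hmem x y).symm
  have hunion : nbhd top = ⋃ p ∈ Λ, τ ⁻¹' {p} := by
    ext y
    simp only [Set.mem_iUnion, Set.mem_preimage, Set.mem_singleton_iff, exists_prop]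
    constructor
    · intro hy; exact ⟨τ y, ⟨y, hy, rfl⟩, rfl⟩
    · rintro ⟨_, ⟨x, hx, rfl⟩, hxy⟩
      exact h.cell_subset_nbhd hx ((hmem x y).2 hxy)
  have hmeas : ∀ p ∈ Λ, MeasurableSet (τ ⁻¹' {p}) := by
    rintro _ ⟨x, -, rfl⟩
    rw [hcell]; exact measurableSet_cell x
  have hdisj : Λ.PairwiseDisjoint fun p => τ ⁻¹' {p} := fun p _ q _ hpq =>
    Disjoint.preimage _ (Set.disjoint_singleton.2 hpq)
  rw [hunion, lintegral_biUnion Λ.to_countable hmeas hdisj,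
    lintegral_biUnion Λ.to_countable hmeas hdisj]
  refine ENNReal.tsum_le_tsum ?_
  rintro ⟨_, x, hx, rfl⟩
  simp only [hcell]
  exact hfg x hx

end IsStopping

/-- At every scale up to that of the top there is a bi-tile whose frequency interval contains that
of the top, with time interval in any prescribed position. -/
theorem BiTile.exists_freq_ancestor (top : BiTile u v) {m : ℤ} (hm : m ≤ top.j) (k : ℤ) :
    ∃ Q : BiTile u v, Q.j = m ∧ Q.k = k ∧ top.ω ⊆ Q.ω := by
  obtain ⟨d, hd⟩ := Int.le.dest hm
  set Q : BiTile u v := ⟨m, k, top.l / 2 ^ d⟩ with hQ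
  refine ⟨Q, rfl, rfl, ?_⟩
  have hf : Q.freqLen = top.freqLen * 2 ^ d := by
    obtain ⟨d', hd', -, h⟩ := BiTile.exists_len_eq (P := Q) (Q := top) hm
    have : d' = d := by simp only [hQ] at hd'; omega
    rw [h, this]
  have hp := top.freqLen_pos
  unfold BiTile.ω
  rw [BiTile.freqRight_eq, BiTile.freqRight_eq]
  unfold BiTile.freqLeft
  rw [hf]
  have h2 : (0 : ℤ) < 2 ^ d := by positivity
  have e1 : 2 ^ d * (top.l / 2 ^ d) ≤ top.l := Int.mul_ediv_self_le h2.ne'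
  have e2 : top.l + 1 ≤ 2 ^ d * (top.l / 2 ^ d + 1) := by
    have := Int.lt_mul_ediv_self_add (x := top.l) h2
    rw [mul_add, mul_one]; omega
  have e1' : (2 : ℝ) ^ d * ((top.l / 2 ^ d : ℤ) : ℝ) ≤ top.l := by exact_mod_cast e1
  have e2' : (top.l : ℝ) + 1 ≤ 2 ^ d * (((top.l / 2 ^ d : ℤ) : ℝ) + 1) := by exact_mod_cast e2
  refine Set.Ioo_subset_Ioo ?_ ?_
  · simp only [hQ]; nlinarith
  · simp only [hQ]; nlinarith

/-! ### Mass bounds on a tree -/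

section

/-- The density of the mass of `P`. -/
noncomputable def massDensity (C : ℝ) (N : ℝ → ℝ) (G : ℝ → ℂ) (P : BiTile u v) (x : ℝ) : ℝ≥0∞ :=
  {x | N x ∈ P.ω}.indicator (fun x => ‖G x‖ₑ * ENNReal.ofReal (P.cutoff x ^ C)) x

variable {C : ℝ} {N : ℝ → ℝ} {G : ℝ → ℂ}

theorem measurable_massDensity (hN : Measurable N) (hG : Measurable G) (P : BiTile u v) :
    Measurable (massDensity C N G P) :=
  (hG.enorm.mul (P.continuous_cutoff.measurable.pow_const C).ennreal_ofReal).indicator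
    (hN measurableSet_Ioo)

theorem lintegral_massDensity (hN : Measurable N) (P : BiTile u v) :
    ∫⁻ x, massDensity C N G P x = mass C N G P :=
  lintegral_indicator (hN measurableSet_Ioo) _

theorem sum_zpow_sq_le {F : Finset ℤ} {m : ℤ} (h : ∀ j ∈ F, j ≤ m) :
    ∑ j ∈ F, ((2 : ℝ) ^ (j - m)) ^ 2 ≤ 4 / 3 := by
  have hinj : Set.InjOn (fun j : ℤ => (m - j).toNat) F := by
    intro i hi j hj hij
    have h1 := h i hi
    have h2 := h j hj
    simp only at hij
    omega
  have e : ∑ j ∈ F, ((2 : ℝ) ^ (j - m)) ^ 2 =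
      ∑ n ∈ F.image fun j : ℤ => (m - j).toNat, (1 / 4 : ℝ) ^ n := by
    rw [Finset.sum_image hinj]
    refine Finset.sum_congr rfl fun j hj => ?_
    obtain ⟨n, hn⟩ := Int.le.dest (h j hj)
    have h1 : j - m = -(n : ℤ) := by omega
    have h2 : (m - j).toNat = n := by omega
    rw [h1, h2, zpow_neg, zpow_natCast, ← inv_pow, ← pow_mul, mul_comm, pow_mul]
    norm_num
  rw [e]
  refine (Summable.sum_le_tsum _ (fun n _ => by positivity)
    (summable_geometric_of_lt_one (by norm_num) (by norm_num))).trans (le_of_eq ?_)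
  rw [tsum_geometric_of_lt_one (by norm_num) (by norm_num)]
  norm_num

theorem scaleLen_div (u : ℝ) (j m : ℤ) : scaleLen u j / scaleLen u m = 2 ^ (j - m) := by
  unfold scaleLen
  rw [mul_div_mul_left _ _ (by positivity), ← zpow_sub₀ (by norm_num)]

/-- Summation over all scales up to `m` in a tree. -/
theorem IsTree.sum_scales_le {T : Finset (BiTile u v)} {top : BiTile u v} (hT : IsTree T top)
    {S : Finset (BiTile u v)} (hS : S ⊆ T) {m : ℤ} (hm : ∀ P ∈ S, P.j ≤ m) (x : ℝ) :
    ∑ P ∈ S, ENNReal.ofReal (P.len * (P.len / scaleLen u m) ^ 2) *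
      ewt (scaleLen u m) (x - P.center) ≤ ENNReal.ofReal (4 * Real.pi * scaleLen u m) := by
  classical
  have hpi := Real.pi_pos
  set L := scaleLen u m with hL
  have hL0 : 0 < L := scaleLen_pos u m
  rw [← Finset.sum_fiberwise_of_maps_to (t := S.image BiTile.j) (g := BiTile.j)
    (fun P hP => Finset.mem_image_of_mem _ hP)]
  have hin : ∀ j ∈ S.image BiTile.j, ∑ P ∈ S with P.j = j, ENNReal.ofReal
      (P.len * (P.len / L) ^ 2) * ewt L (x - P.center)
      ≤ ENNReal.ofReal (((2 : ℝ) ^ (j - m)) ^ 2) * ENNReal.ofReal (3 * Real.pi * L) := by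
    intro j hj
    have e : ∀ P ∈ S.filter (fun P => P.j = j), ENNReal.ofReal (P.len * (P.len / L) ^ 2) *
        ewt L (x - P.center) = ENNReal.ofReal (((2 : ℝ) ^ (j - m)) ^ 2) *
          (ENNReal.ofReal P.len * ewt L (x - P.center)) := by
      intro P hP
      have hPj : P.len / L = 2 ^ (j - m) := by
        rw [BiTile.len_eq_scaleLen, (Finset.mem_filter.1 hP).2, hL, scaleLen_div]
      rw [hPj, mul_comm P.len, ENNReal.ofReal_mul (by positivity), mul_assoc]
    rw [Finset.sum_congr rfl e, ← Finset.mul_sum]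
    gcongr
    refine sum_len_mul_ewt_le (fun P hP Q hQ hne => ?_) hL0 (fun P hP => ?_) x
    · have hP' := Finset.mem_filter.1 (Finset.mem_coe.1 hP)
      have hQ' := Finset.mem_filter.1 (Finset.mem_coe.1 hQ)
      exact hT.disjoint_I (hS hP'.1) (hS hQ'.1) (hP'.2.trans hQ'.2.symm) hne
    · exact scaleLen_le_iff.2 (hm P (Finset.mem_filter.1 hP).1)
  refine (Finset.sum_le_sum hin).trans ?_
  rw [← Finset.sum_mul, ← ENNReal.ofReal_sum_of_nonneg fun _ _ => by positivity,
    ← ENNReal.ofReal_mul (Finset.sum_nonneg fun _ _ => by positivity)]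
  refine ENNReal.ofReal_le_ofReal ?_
  have := sum_zpow_sq_le (F := S.image BiTile.j) (m := m) (fun j hj => by
    obtain ⟨P, hP, rfl⟩ := Finset.mem_image.1 hj
    exact hm P hP)
  calc _ ≤ 4 / 3 * (3 * Real.pi * L) := by gcongr
    _ = _ := by ring

/-- The contribution of a set `E` far away, at scale `m`, from all the time intervals. -/
theorem IsTree.sum_lintegral_tail_le (hN : Measurable N)
    {T : Finset (BiTile u v)} {top : BiTile u v} (hT : IsTree T top)
    {S : Finset (BiTile u v)} (hS : S ⊆ T) {m : ℤ} (hm : ∀ P ∈ S, P.j ≤ m) (x : ℝ)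
    {E : Set ℝ} (hE : MeasurableSet E)
    (hfar : ∀ P ∈ S, ∀ y ∈ E, wt P.len (y - P.center)
      ≤ 5 * (P.len / scaleLen u m) ^ 2 * wt (scaleLen u m) (x - P.center))
    {s : ℝ} (hs : 0 ≤ s) (hmass : ∀ P ∈ S, mass C N G P ≤ ENNReal.ofReal (s * P.len)) :
    ∑ P ∈ S, ∫⁻ y in E, massDensity C N G P y * ewt P.len (y - P.center)
      ≤ ENNReal.ofReal (20 * Real.pi * s * scaleLen u m) := by
  set L := scaleLen u m with hL
  have key : ∀ P ∈ S, ∫⁻ y in E, massDensity C N G P y * ewt P.len (y - P.center)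
      ≤ ENNReal.ofReal (5 * s) * (ENNReal.ofReal (P.len * (P.len / L) ^ 2) *
        ewt L (x - P.center)) := by
    intro P hP
    have hp := P.len_pos
    have hw := wt_pos L (x - P.center)
    calc _ ≤ ∫⁻ y in E, massDensity C N G P y *
          ENNReal.ofReal (5 * (P.len / L) ^ 2 * wt L (x - P.center)) := by
          refine setLIntegral_mono' hE fun y hy => ?_
          gcongr
          exact ENNReal.ofReal_le_ofReal (hfar P hP y hy)
      _ ≤ ∫⁻ y, massDensity C N G P y *
          ENNReal.ofReal (5 * (P.len / L) ^ 2 * wt L (x - P.center)) := setLIntegral_le_lintegral _ _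
      _ = mass C N G P * ENNReal.ofReal (5 * (P.len / L) ^ 2 * wt L (x - P.center)) := by
          rw [lintegral_mul_const' _ _ ENNReal.ofReal_ne_top, lintegral_massDensity hN]
      _ ≤ ENNReal.ofReal (s * P.len) *
          ENNReal.ofReal (5 * (P.len / L) ^ 2 * wt L (x - P.center)) := by
          gcongr
          exact hmass P hP
      _ = _ := by
          unfold ewt
          rw [← ENNReal.ofReal_mul (by positivity), ← ENNReal.ofReal_mul (by positivity),
            ← ENNReal.ofReal_mul (by positivity)]
          congr 1; ring
  refine (Finset.sum_le_sum key).trans ?_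
  rw [← Finset.mul_sum]
  calc _ ≤ ENNReal.ofReal (5 * s) * ENNReal.ofReal (4 * Real.pi * L) := by
        gcongr
        exact hT.sum_scales_le hS hm x
    _ = _ := by
        rw [← ENNReal.ofReal_mul (by positivity)]
        congr 1; ring

/-- The contribution of the points far from the top. -/
theorem IsTree.sum_lintegral_compl_nbhd_le (hN : Measurable N)
    {T : Finset (BiTile u v)} {top : BiTile u v} (hT : IsTree T top)
    {s : ℝ} (hs : 0 ≤ s) (hmass : ∀ P ∈ T, mass C N G P ≤ ENNReal.ofReal (s * P.len)) :
    ∑ P ∈ T, ∫⁻ y in (nbhd top)ᶜ, massDensity C N G P y * ewt P.len (y - P.center)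
      ≤ ENNReal.ofReal (20 * Real.pi * s * top.len) := by
  refine hT.sum_lintegral_tail_le hN subset_rfl (fun P hP => BiTile.le_j (hT P hP)) top.center
    (measurableSet_nbhd top).compl (fun P hP y hy => ?_) hs hmass
  have hL := scaleLen_pos u top.j
  have hidx : idx u top.j P.center = top.k := BiTile.idx_center_of_le (hT P hP).1
  have h1 : scaleLen u top.j ≤ |y - P.center| := by
    refine le_abs_sub_of_idx ?_
    rw [hidx]
    have : ¬ |idx u top.j y - top.k| ≤ 1 := hy
    omega
  have h2 : |top.center - P.center| ≤ scaleLen u top.j :=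
    abs_sub_le_of_idx_eq (by rw [hidx, BiTile.idx_of_mem top.center_mem])
  have h3 : 1 / 2 ≤ wt (scaleLen u top.j) (top.center - P.center) := by
    unfold wt
    rw [one_div]
    refine inv_anti₀ (by positivity) ?_
    have : ((top.center - P.center) / scaleLen u top.j) ^ 2 ≤ 1 := by
      rw [div_pow, ← sq_abs, div_le_one (by positivity)]
      gcongr
    linarith
  refine (wt_le_sq_div P.len_pos hL h1).trans ?_
  have := sq_nonneg (P.len / scaleLen u top.j)
  nlinarith

namespace IsStopping

variable {T : Finset (BiTile u v)} {top : BiTile u v} {κ : ℝ → ℤ}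

/-- The contribution of the bi-tiles below the stopping time. -/
theorem lintegral_below_le (h : IsStopping T top κ) (hT : IsTree T top) (hN : Measurable N)
    (hG : Measurable G)
    {s : ℝ} (hs : 0 ≤ s) (hmass : ∀ P ∈ T, mass C N G P ≤ ENNReal.ofReal (s * P.len)) :
    ∫⁻ y in nbhd top, ∑ P ∈ T with P.j ≤ κ y, massDensity C N G P y * ewt P.len (y - P.center)
      ≤ ENNReal.ofReal (60 * Real.pi * s * top.len) := by
  have hpi := Real.pi_pos
  have hcell : ∀ x ∈ nbhd top, ∫⁻ y in cell u κ x, ∑ P ∈ T with P.j ≤ κ y,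
      massDensity C N G P y * ewt P.len (y - P.center)
      ≤ ∫⁻ _ in cell u κ x, ENNReal.ofReal (20 * Real.pi * s) := by
    intro x _
    have hL := scaleLen_pos u (κ x)
    have e : ∫⁻ y in cell u κ x, ∑ P ∈ T with P.j ≤ κ y,
        massDensity C N G P y * ewt P.len (y - P.center)
        = ∑ P ∈ T with P.j ≤ κ x, ∫⁻ y in cell u κ x,
          massDensity C N G P y * ewt P.len (y - P.center) := by
      rw [← lintegral_finsetSum _ fun P _ => by
        have := measurable_massDensity (C := C) hN hG P
        fun_prop]
      refine setLIntegral_congr_fun (measurableSet_cell x) fun y hy => ?_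
      simp only [h.const x y hy]
    rw [e, setLIntegral_const, volume_cell, ← ENNReal.ofReal_mul (by positivity)]
    refine hT.sum_lintegral_tail_le hN (Finset.filter_subset _ _)
      (fun P hP => (Finset.mem_filter.1 hP).2) x (measurableSet_cell x) (fun P hP y hy => ?_) hs
      (fun P hP => hmass P (Finset.mem_filter.1 hP).1)
    obtain ⟨hPT, hPj⟩ := Finset.mem_filter.1 hP
    have hidx := h.far x P hPT hPj
    have h1 : scaleLen u (κ x) ≤ |y - P.center| := by
      refine le_abs_sub_of_idx ?_
      rw [show idx u (κ x) y = idx u (κ x) x from hy, abs_sub_comm]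
      exact hidx
    have h2 : |x - y| ≤ scaleLen u (κ x) := abs_sub_le_of_idx_eq (by rw [show _ = _ from hy])
    have h3 : |x - P.center| ≤ 2 * |y - P.center| := by
      calc |x - P.center| = |(x - y) + (y - P.center)| := by ring_nf
        _ ≤ |x - y| + |y - P.center| := abs_add_le _ _
        _ ≤ _ := by linarith
    set L := scaleLen u (κ x) with hLdef
    have hd : 0 < |y - P.center| := hL.trans_le h1
    refine (wt_le_sq_div P.len_pos hd le_rfl).trans ?_
    unfold wt
    rw [← div_eq_mul_inv, le_div_iff₀ (by positivity), div_pow, div_pow, div_pow]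
    set d := |y - P.center| with hd'
    have h5 : (x - P.center) ^ 2 ≤ 4 * d ^ 2 := by
      rw [← sq_abs (x - P.center)]
      nlinarith [abs_nonneg (x - P.center)]
    have h6 : L ^ 2 ≤ d ^ 2 := by gcongr
    rw [div_mul_eq_mul_div, ← mul_div_assoc, div_le_div_iff₀ (by positivity) (by positivity)]
    have h7 : (1 + (x - P.center) ^ 2 / L ^ 2) * L ^ 2 ≤ 5 * d ^ 2 := by
      rw [add_mul, div_mul_cancel₀ _ (by positivity)]; linarith
    nlinarith [mul_le_mul_of_nonneg_left h7 (sq_nonneg P.len)]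
  refine (h.setLIntegral_nbhd_le hcell).trans ?_
  rw [setLIntegral_const]
  calc _ ≤ ENNReal.ofReal (20 * Real.pi * s) * ENNReal.ofReal (3 * top.len) := by
        gcongr
        exact volume_nbhd_le top
    _ = _ := by
        rw [← ENNReal.ofReal_mul (by positivity)]
        congr 1; ring

/-- The part of `|G|` that is relevant for the bi-tiles above the stopping time: `|G|` restricted to
the points `y` with `N y ∈ ω_{P_2}` for some `P ∈ T` of scale larger than `κ y`. -/
noncomputable def upper (T : Finset (BiTile u v)) (κ : ℝ → ℤ) (N : ℝ → ℝ) (G : ℝ → ℂ) (y : ℝ) :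
    ℝ≥0∞ :=
  {y | ∃ P ∈ T, κ y < P.j ∧ N y ∈ P.ω₂}.indicator (fun y => ‖G y‖ₑ) y

theorem measurableSet_above (h : IsStopping T top κ) (hN : Measurable N) :
    MeasurableSet {y | ∃ P ∈ T, κ y < P.j ∧ N y ∈ P.ω₂} := by
  have : {y | ∃ P ∈ T, κ y < P.j ∧ N y ∈ P.ω₂}
      = ⋃ P ∈ T, (κ ⁻¹' Set.Iio P.j ∩ N ⁻¹' P.ω₂) := by
    ext y
    simp only [Set.mem_ofPred_eq, Set.mem_iUnion, Set.mem_inter_iff, Set.mem_preimage, Set.mem_Iio,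
      exists_prop]
  rw [this]
  exact Finset.measurableSet_biUnion _ fun P _ =>
    (h.measurable MeasurableSet.of_discrete).inter (hN measurableSet_Ioo)

theorem measurable_upper (h : IsStopping T top κ) (hN : Measurable N) (hG : Measurable G) :
    Measurable (upper T κ N G) :=
  hG.enorm.indicator (h.measurableSet_above hN)

/-- The stopping time prevents `upper` from concentrating on a cell: the dyadic parent of the cell
has a neighbour that contains the time interval of a bi-tile of the tree, so the bi-tile over that
neighbour has controlled mass. -/
theorem lintegral_upper_cell_le (h : IsStopping T top κ) (hT : IsTree T top) (hC : 0 ≤ C)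
    (hN : Measurable N) {s : ℝ} (hs : 0 ≤ s)
    (hmass : ∀ P ∈ T, ∀ P', P.le P' → mass C N G P' ≤ ENNReal.ofReal (s * P'.len)) (x : ℝ) :
    ∫⁻ y in cell u κ x, upper T κ N G y
      ≤ ∫⁻ _ in cell u κ x, ENNReal.ofReal (2 * 5 ^ (C / 2) * s) := by
  rcases (h.le_top x).eq_or_lt with hx | hx
  · have : ∫⁻ y in cell u κ x, upper T κ N G y = ∫⁻ y in cell u κ x, 0 := by
      refine setLIntegral_congr_fun (measurableSet_cell x) fun y hy => ?_
      refine Set.indicator_of_notMem ?_ _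
      rintro ⟨P, hP, hj, -⟩
      rw [h.const x y hy, hx] at hj
      exact absurd (BiTile.le_j (hT P hP)) (not_le.2 hj)
    rw [this, lintegral_zero]; exact bot_le
  obtain ⟨P', hP', hj', hnear⟩ := h.near x hx
  obtain ⟨Q, hQj, hQk, hQω⟩ := top.exists_freq_ancestor (m := κ x + 1) hx
    (idx u (κ x + 1) P'.center)
  have hQlen : Q.len = 2 * scaleLen u (κ x) := by
    rw [BiTile.len_eq_scaleLen, hQj, scaleLen_succ, mul_comm]
  have hQp := Q.len_pos
  -- `Q` is the bi-tile over the dyadic interval that contains the time interval of `P'`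
  have hle : P'.le Q := by
    have hjj : P'.j ≤ Q.j := by rw [hQj]; exact hj'
    refine ⟨?_, BiTile.ω_subset_of_meet hjj ((hT P' hP').2 top.freqMid_mem) (hQω top.freqMid_mem)⟩
    obtain ⟨d, -, hd, -⟩ := BiTile.exists_len_eq hjj
    have hc := P'.center_mem
    obtain ⟨c1, c2⟩ := idx_eq_iff.1 (rfl : idx u (κ x + 1) P'.center = _)
    rw [← hQk, ← hQj, ← BiTile.len_eq_scaleLen, hd] at c1 c2
    unfold BiTile.I at hc ⊢
    rw [hd]
    obtain ⟨h1, h2⟩ := grid_nested P'.len_pos (c1.trans_lt hc.2) (hc.1.trans c2)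
    exact Set.Ioo_subset_Ioo h1 h2
  have hpt : ∀ y ∈ cell u κ x, upper T κ N G y
      ≤ ENNReal.ofReal (5 ^ (C / 2)) * massDensity C N G Q y := by
    intro y hy
    by_cases hyU : y ∈ {y | ∃ P ∈ T, κ y < P.j ∧ N y ∈ P.ω₂}
    · unfold upper
      rw [Set.indicator_of_mem hyU]
      obtain ⟨P, hP, hj, hNy⟩ := hyU
      rw [h.const x y hy] at hj
      have hNQ : N y ∈ Q.ω := BiTile.ω_subset_of_meet (by rw [hQj]; exact hj)
        (hQω top.freqMid_mem) ((hT P hP).2 top.freqMid_mem) (P.ω₂_subset hNy)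
      unfold massDensity
      rw [Set.indicator_of_mem (show y ∈ {x | N x ∈ Q.ω} from hNQ), mul_left_comm,
        ← ENNReal.ofReal_mul (by positivity)]
      refine le_mul_of_one_le_right bot_le ?_
      rw [ENNReal.one_le_ofReal, BiTile.cutoff_eq_rpow, ← Real.rpow_mul (wt_pos _ _).le,
        one_div_mul_eq_div, ← Real.mul_rpow (by norm_num) (wt_pos _ _).le]
      refine Real.one_le_rpow ?_ (by positivity)
      have hdist : |y - Q.center| ≤ 2 * Q.len := by
        have := abs_sub_le_of_idx (u := u) (m := κ x + 1) (x := y) (y := Q.center) (by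
          rw [← hQj, BiTile.idx_of_mem Q.center_mem, hQk, hQj,
            idx_congr (by omega : κ x ≤ κ x + 1) (show idx u (κ x) y = idx u (κ x) x from hy),
            abs_sub_comm]
          exact hnear)
        rwa [← hQj, ← BiTile.len_eq_scaleLen] at this
      unfold wt
      rw [← div_eq_mul_inv, one_le_div (by positivity), div_pow]
      have : (y - Q.center) ^ 2 / Q.len ^ 2 ≤ 4 := by
        rw [div_le_iff₀ (by positivity), ← sq_abs]
        nlinarith [abs_nonneg (y - Q.center)]
      linarith
    · unfold upper
      rw [Set.indicator_of_notMem hyU]; exact bot_le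
  have hL := scaleLen_pos u (κ x)
  calc ∫⁻ y in cell u κ x, upper T κ N G y
      ≤ ∫⁻ y in cell u κ x, ENNReal.ofReal (5 ^ (C / 2)) * massDensity C N G Q y :=
        setLIntegral_mono' (measurableSet_cell x) hpt
    _ ≤ ∫⁻ y, ENNReal.ofReal (5 ^ (C / 2)) * massDensity C N G Q y := setLIntegral_le_lintegral _ _
    _ = ENNReal.ofReal (5 ^ (C / 2)) * mass C N G Q := by
        rw [lintegral_const_mul' _ _ ENNReal.ofReal_ne_top, lintegral_massDensity hN]
    _ ≤ ENNReal.ofReal (5 ^ (C / 2)) * ENNReal.ofReal (s * Q.len) := by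
        gcongr
        exact hmass P' hP' Q hle
    _ = _ := by
        rw [setLIntegral_const, volume_cell, ← ENNReal.ofReal_mul (by positivity),
          ← ENNReal.ofReal_mul (by positivity), hQlen]
        congr 1; ring

/-- The integral form of `lintegral_upper_cell_le`, summed over the cells. -/
theorem lintegral_upper_le (h : IsStopping T top κ) (hT : IsTree T top) (hC : 0 ≤ C)
    (hN : Measurable N) {s : ℝ} (hs : 0 ≤ s)
    (hmass : ∀ P ∈ T, ∀ P', P.le P' → mass C N G P' ≤ ENNReal.ofReal (s * P'.len)) :
    ∫⁻ y in nbhd top, upper T κ N G y ≤ ENNReal.ofReal (6 * 5 ^ (C / 2) * s * top.len) := by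
  refine (h.setLIntegral_nbhd_le fun x _ =>
    h.lintegral_upper_cell_le hT hC hN hs hmass x).trans ?_
  rw [setLIntegral_const]
  calc _ ≤ ENNReal.ofReal (2 * 5 ^ (C / 2) * s) * ENNReal.ofReal (3 * top.len) := by
        gcongr
        exact volume_nbhd_le top
    _ = _ := by
        rw [← ENNReal.ofReal_mul (by positivity)]
        congr 1; ring

/-- At scale `k`, the part of `upper` on the cells of scale at most `k` behaves like a bounded
function. -/
theorem lintegral_upper_mul_ewt_le (h : IsStopping T top κ) (hT : IsTree T top) (hC : 0 ≤ C)
    (hN : Measurable N) {s : ℝ} (hs : 0 ≤ s)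
    (hmass : ∀ P ∈ T, ∀ P', P.le P' → mass C N G P' ≤ ENNReal.ofReal (s * P'.len))
    (k : ℤ) (x : ℝ) :
    ∫⁻ y in nbhd top, {y | κ y ≤ k}.indicator (upper T κ N G) y * ewt (scaleLen u k) (x - y)
      ≤ ENNReal.ofReal (18 * Real.pi * 5 ^ (C / 2) * s) * ENNReal.ofReal (scaleLen u k) := by
  have hpi := Real.pi_pos
  have hk := scaleLen_pos u k
  set D := ENNReal.ofReal (2 * 5 ^ (C / 2) * s) with hD
  have hcell : ∀ z ∈ nbhd top, ∫⁻ y in cell u κ z,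
      {y | κ y ≤ k}.indicator (upper T κ N G) y * ewt (scaleLen u k) (x - y)
      ≤ ∫⁻ y in cell u κ z, 9 * D * ewt (scaleLen u k) (x - y) := by
    intro z _
    by_cases hz : κ z ≤ k
    · have hclose : ∀ y ∈ cell u κ z, |z - y| ≤ scaleLen u k := fun y hy =>
        (abs_sub_le_of_idx_eq (show idx u (κ z) z = idx u (κ z) y from hy.symm)).trans
          (scaleLen_le_iff.2 hz)
      have three : (3 : ℝ≥0∞) = ENNReal.ofReal 3 := by norm_num
      have b1 : ∀ y ∈ cell u κ z, ewt (scaleLen u k) (x - y) ≤ 3 * ewt (scaleLen u k) (x - z) := by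
        intro y hy
        unfold ewt
        rw [three, ← ENNReal.ofReal_mul (by norm_num)]
        refine ENNReal.ofReal_le_ofReal (wt_le_mul hk ?_)
        have := hclose y hy
        rwa [show x - y - (x - z) = z - y by ring]
      have b2 : ∀ y ∈ cell u κ z, ewt (scaleLen u k) (x - z) ≤ 3 * ewt (scaleLen u k) (x - y) := by
        intro y hy
        unfold ewt
        rw [three, ← ENNReal.ofReal_mul (by norm_num)]
        refine ENNReal.ofReal_le_ofReal (wt_le_mul hk ?_)
        have := hclose y hy
        rwa [show x - z - (x - y) = -(z - y) by ring, abs_neg]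
      have hfin : 3 * ewt (scaleLen u k) (x - z) ≠ ⊤ :=
        ENNReal.mul_ne_top (by norm_num) ENNReal.ofReal_ne_top
      calc _ ≤ ∫⁻ y in cell u κ z, upper T κ N G y * (3 * ewt (scaleLen u k) (x - z)) := by
            refine setLIntegral_mono' (measurableSet_cell z) fun y hy => ?_
            refine mul_le_mul' (Set.indicator_le_self _ _ _) (b1 y hy)
        _ = (∫⁻ y in cell u κ z, upper T κ N G y) * (3 * ewt (scaleLen u k) (x - z)) :=
            lintegral_mul_const' _ _ hfin
        _ ≤ (∫⁻ _ in cell u κ z, D) * (3 * ewt (scaleLen u k) (x - z)) := by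
            exact mul_le_mul' (h.lintegral_upper_cell_le hT hC hN hs hmass z) le_rfl
        _ = ∫⁻ _ in cell u κ z, D * (3 * ewt (scaleLen u k) (x - z)) :=
            (lintegral_mul_const' _ _ hfin).symm
        _ ≤ _ := by
            refine setLIntegral_mono' (measurableSet_cell z) fun y hy => ?_
            calc D * (3 * ewt (scaleLen u k) (x - z))
                ≤ D * (3 * (3 * ewt (scaleLen u k) (x - y))) := by
                  gcongr
                  exact b2 y hy
              _ = _ := by ring
    · have : ∫⁻ y in cell u κ z,
          {y | κ y ≤ k}.indicator (upper T κ N G) y * ewt (scaleLen u k) (x - y)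
          = ∫⁻ y in cell u κ z, 0 := by
        refine setLIntegral_congr_fun (measurableSet_cell z) fun y hy => ?_
        have hy' : y ∉ {y | κ y ≤ k} := by
          change ¬ κ y ≤ k
          rwa [h.const z y hy]
        simp only [Set.indicator_of_notMem hy', zero_mul]
      rw [this, lintegral_zero]; exact bot_le
  refine (h.setLIntegral_nbhd_le hcell).trans ((setLIntegral_le_lintegral _ _).trans ?_)
  rw [lintegral_const_mul _ (by fun_prop), lintegral_ewt_sub hk, hD,
    show (9 : ℝ≥0∞) = ENNReal.ofReal 9 by norm_num, ← ENNReal.ofReal_mul (by norm_num),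
    ← ENNReal.ofReal_mul (by positivity), ← ENNReal.ofReal_mul (by positivity)]
  refine ENNReal.ofReal_le_ofReal (le_of_eq ?_)
  ring

end IsStopping

end

/-! ### The tree estimate -/

section

/-- The constant in the decay of the kernels of the frequency cutoffs. -/
noncomputable def kernelConst : ℝ := exists_norm_fourierInv_freqCutoff_le.choose

theorem kernelConst_pos : 0 < kernelConst := exists_norm_fourierInv_freqCutoff_le.choose_spec.1

theorem norm_fourierInv_freqCutoff_le {c ℓ : ℝ} (hℓ : 0 < ℓ) (y : ℝ) :
    ‖𝓕⁻ (freqCutoff c ℓ) y‖ ≤ kernelConst * (ℓ * (1 + (ℓ * y) ^ 2)⁻¹) :=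
  exists_norm_fourierInv_freqCutoff_le.choose_spec.2 c ℓ y hℓ

/-- In a `2`-tree, convolution with a suitable kernel of scale `k` truncates a sum of wave packets
to the scales above `k`. -/
theorem IsTwoTree.exists_kernel {C K₀ : ℝ} (hC : 0 ≤ C) (hK : 0 ≤ K₀) {T : Finset (BiTile u v)}
    {top : BiTile u v} (hT : IsTwoTree T top) {φ : BiTile u v → ℝ → ℂ}
    (hφ : ∀ P ∈ T, IsPacket C K₀ P (φ P)) (k : ℤ) :
    ∃ 𝓚 : ℝ → ℂ, Continuous 𝓚 ∧
      (∀ y, ‖𝓚 y‖ ≤ kernelConst * ((scaleLen u k)⁻¹ * wt (scaleLen u k) y)) ∧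
      ∀ P ∈ T, ∀ᵐ x, ∫ z, φ P z * 𝓚 (x - z) = if k < P.j then φ P x else 0 := by
  have hB := kernelConst_pos
  have hk := scaleLen_pos u k
  rcases le_or_gt top.j k with hjk | hjk
  · refine ⟨fun _ => 0, continuous_const, fun y => ?_, fun P hP => ?_⟩
    · have := wt_pos (scaleLen u k) y
      rw [norm_zero]; positivity
    · have := BiTile.le_j (hT.1 P hP)
      simp [this.trans hjk]
  -- the cutoff to the frequency interval of scale `k + 1` around the top: it is `1` on the packets
  -- of larger scale, and vanishes on the others thanks to the gap between `(9/10) ω_{P_1}` and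
  -- `ω_{P_2}`
  obtain ⟨Q, hQj, -, hQω⟩ := top.exists_freq_ancestor (m := k + 1) hjk 0
  have hQl : Q.freqLen = (scaleLen u k)⁻¹ := by
    rw [BiTile.freqLen_eq, BiTile.len_eq_scaleLen, hQj, scaleLen_succ]
    field_simp
  have hq := Q.freqLen_pos
  refine ⟨𝓕⁻ (freqCutoff Q.freqLeft Q.freqLen),
    continuous_fourierInv_of_integrable (integrable_freqCutoff hq _), fun y => ?_, fun P hP => ?_⟩
  · refine (norm_fourierInv_freqCutoff_le hq y).trans (le_of_eq ?_)
    rw [hQl]; unfold wt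
    rw [div_eq_inv_mul y]
  have hint := (hφ P hP).integrable hC hK
  have hsupp := (hφ P hP).support
  have hmul : (fun η => 𝓕 (φ P) η * freqCutoff Q.freqLeft Q.freqLen η) =
      fun η => if k < P.j then 𝓕 (φ P) η else 0 := by
    funext η
    by_cases hη : 𝓕 (φ P) η = 0
    · simp [hη]
    have hcore : η ∈ P.coreω₁ := hsupp hη
    have hpl := P.freqLen_pos
    split_ifs with hlt
    · have hsub : P.ω ⊆ Q.ω := BiTile.ω_subset_of_meet (by rw [hQj]; exact hlt)
        (hQω top.freqMid_mem) ((hT.1 P hP).2 top.freqMid_mem)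
      have hη' := hsub (P.ω₁_subset (P.coreω₁_subset hcore))
      rw [freqCutoff_eq_one hq hη'.1.le hη'.2.le, mul_one]
    · have hsub : Q.ω ⊆ P.ω₂ := BiTile.ω_subset_ω₂ (by rw [hQj]; omega) (hT.freq_mem hP)
        (hQω (top.ω₂_subset top.freqQuarter_mem))
      unfold BiTile.ω BiTile.ω₂ at hsub
      have hsub' := (Set.Ioo_subset_Ioo_iff (by linarith)).1 hsub
      rw [freqCutoff_eq_zero hq, mul_zero]
      have h2 := hcore.2
      linarith [hsub'.1, hsub'.2]
  have key : ∀ x, ∫ z, φ P z * 𝓕⁻ (freqCutoff Q.freqLeft Q.freqLen) (x - z)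
      = 𝓕⁻ (fun η => if k < P.j then 𝓕 (φ P) η else 0) x := fun x => by
    rw [integral_mul_fourierInv_sub hint (integrable_freqCutoff hq _), hmul]
  simp_rw [key]
  by_cases hlt : k < P.j
  · simp only [if_pos hlt]
    exact (ae_eq_fourierInv_fourier hint (integrable_fourier_of_support hint hsupp)).mono
      fun x hx => hx.symm
  · simp only [if_neg hlt]
    refine Filter.Eventually.of_forall fun x => ?_
    rw [Real.fourierInv_eq]
    simp

/-- The Cauchy-Schwarz inequality with prescribed bounds. -/
theorem lintegral_mul_le_of_sq {f g : ℝ → ℝ≥0∞} (hf : AEMeasurable f) (hg : AEMeasurable g)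
    {α β : ℝ} (hα : 0 ≤ α) (hβ : 0 ≤ β) (h1 : ∫⁻ x, f x ^ 2 ≤ ENNReal.ofReal (α ^ 2))
    (h2 : ∫⁻ x, g x ^ 2 ≤ ENNReal.ofReal (β ^ 2)) :
    ∫⁻ x, f x * g x ≤ ENNReal.ofReal (α * β) := by
  have h := ENNReal.lintegral_mul_le_Lp_mul_Lq volume Real.HolderConjugate.two_two hf hg
  simp only [ENNReal.rpow_two, Pi.mul_apply] at h
  have root : ∀ {X : ℝ≥0∞} {γ : ℝ}, 0 ≤ γ → X ≤ ENNReal.ofReal (γ ^ 2) →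
      X ^ (1 / 2 : ℝ) ≤ ENNReal.ofReal γ := by
    intro X γ hγ hX
    refine (ENNReal.rpow_le_rpow hX (by norm_num)).trans (le_of_eq ?_)
    rw [ENNReal.ofReal_rpow_of_nonneg (by positivity) (by norm_num), ← Real.sqrt_eq_rpow,
      Real.sqrt_sq hγ]
  rw [ENNReal.ofReal_mul hα]
  exact h.trans (mul_le_mul' (root hα h1) (root hβ h2))

variable {C K₀ : ℝ} {N : ℝ → ℝ} {G : ℝ → ℂ} {T : Finset (BiTile u v)} {top : BiTile u v}
  {φ : BiTile u v → ℝ → ℂ} {a : BiTile u v → ℂ} {s₁ s₂ : ℝ} {κ : ℝ → ℤ}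

/-- The integrand of `coeff`. -/
noncomputable def pairing (N : ℝ → ℝ) (G : ℝ → ℂ) (P : BiTile u v) (φ : ℝ → ℂ) (x : ℝ) : ℂ :=
  {x | N x ∈ P.ω₂}.indicator G x * conj (φ x)

theorem measurable_pairing (hN : Measurable N) (hG : Measurable G) {P : BiTile u v} {φ : ℝ → ℂ}
    (hφ : Measurable φ) : Measurable (pairing N G P φ) :=
  (hG.indicator (hN measurableSet_Ioo)).mul (Complex.continuous_conj.measurable.comp hφ)

theorem pairing_of_notMem {P : BiTile u v} {φ : ℝ → ℂ} {x : ℝ} (h : N x ∉ P.ω₂) :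
    pairing N G P φ x = 0 := by
  unfold pairing
  rw [Set.indicator_of_notMem (show x ∉ {x | N x ∈ P.ω₂} from h), zero_mul]

theorem enorm_pairing_le {P : BiTile u v} {φ : ℝ → ℂ} (hK : 0 ≤ K₀) (hφ : IsPacket C K₀ P φ)
    (x : ℝ) : ‖pairing N G P φ x‖ₑ ≤ ENNReal.ofReal (K₀ * (√P.len)⁻¹) *
      (massDensity C N G P x * ewt P.len (x - P.center)) := by
  unfold pairing
  rw [enorm_mul]
  by_cases hx : x ∈ {x | N x ∈ P.ω₂}
  · have hx2 : x ∈ {x | N x ∈ P.ω} := P.ω₂_subset hx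
    unfold massDensity
    rw [Set.indicator_of_mem hx, Set.indicator_of_mem hx2, RCLike.enorm_conj]
    calc _ ≤ ‖G x‖ₑ * (ENNReal.ofReal (K₀ * (√P.len)⁻¹) *
          (ENNReal.ofReal (P.cutoff x ^ C) * ewt P.len (x - P.center))) := by
          gcongr
          exact hφ.enorm_le hK x
      _ = _ := by ring
  · rw [Set.indicator_of_notMem hx]; simp

theorem enorm_mul_ofReal_le {P : BiTile u v} (hK : 0 ≤ K₀)
    (ha : ‖a P‖ ≤ s₁ * √P.len) :
    ‖a P‖ₑ * ENNReal.ofReal (K₀ * (√P.len)⁻¹) ≤ ENNReal.ofReal (s₁ * K₀) := by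
  have hl : 0 < √P.len := Real.sqrt_pos.2 P.len_pos
  rw [← ofReal_norm, ← ENNReal.ofReal_mul (norm_nonneg _)]
  refine ENNReal.ofReal_le_ofReal ?_
  calc ‖a P‖ * (K₀ * (√P.len)⁻¹) ≤ s₁ * √P.len * (K₀ * (√P.len)⁻¹) := by gcongr
    _ = s₁ * K₀ := by field_simp

theorem enorm_mul_pairing_le {P : BiTile u v} (hK : 0 ≤ K₀)
    (hφ : IsPacket C K₀ P (φ P)) (ha : ‖a P‖ ≤ s₁ * √P.len) (x : ℝ) :
    ‖a P * pairing N G P (φ P) x‖ₑ ≤ ENNReal.ofReal (s₁ * K₀) *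
      (massDensity C N G P x * ewt P.len (x - P.center)) := by
  rw [enorm_mul]
  calc _ ≤ ‖a P‖ₑ * (ENNReal.ofReal (K₀ * (√P.len)⁻¹) *
        (massDensity C N G P x * ewt P.len (x - P.center))) := by
        gcongr
        exact enorm_pairing_le hK hφ x
    _ ≤ _ := by
        rw [← mul_assoc]
        exact mul_le_mul' (enorm_mul_ofReal_le hK ha) le_rfl

theorem IsTree.mono {T T' : Finset (BiTile u v)} (hT : IsTree T top) (h : T' ⊆ T) : IsTree T' top :=
  fun P hP => hT P (h hP)

namespace IsStopping

/-- Away from the top, and below the stopping time, absolute values can be taken inside the sum. -/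
theorem enorm_sum_mul_coeff_le (h : IsStopping T top κ) (hT : IsTree T top) (hK : 0 ≤ K₀)
    (hN : Measurable N) (hG : Measurable G) (hs₁ : 0 ≤ s₁) (hs₂ : 0 ≤ s₂)
    (hφ : ∀ P ∈ T, IsPacket C K₀ P (φ P)) (ha : ∀ P ∈ T, ‖a P‖ ≤ s₁ * √P.len)
    (hint : ∀ P ∈ T, Integrable (pairing N G P (φ P)))
    (hmass : ∀ P ∈ T, mass C N G P ≤ ENNReal.ofReal (s₂ * P.len)) :
    ‖∑ P ∈ T, a P * coeff N G P (φ P)‖ₑ ≤ ENNReal.ofReal (80 * Real.pi * (K₀ * s₁ * s₂ * top.len)) +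
      ∫⁻ x in nbhd top, ‖∑ P ∈ T with κ x < P.j, a P * pairing N G P (φ P) x‖ₑ := by
  have hpi := Real.pi_pos
  have htop := top.len_pos
  have hmd : ∀ P : BiTile u v, Measurable (massDensity C N G P) := measurable_massDensity hN hG
  have e : ∑ P ∈ T, a P * coeff N G P (φ P) = ∫ x, ∑ P ∈ T, a P * pairing N G P (φ P) x := by
    rw [integral_finsetSum _ fun P hP => (hint P hP).const_mul _]
    exact Finset.sum_congr rfl fun P _ => (integral_const_mul _ _).symm
  have far : ∫⁻ x in (nbhd top)ᶜ, ‖∑ P ∈ T, a P * pairing N G P (φ P) x‖ₑ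
      ≤ ENNReal.ofReal (s₁ * K₀) * ENNReal.ofReal (20 * Real.pi * s₂ * top.len) := by
    calc _ ≤ ∫⁻ x in (nbhd top)ᶜ, ENNReal.ofReal (s₁ * K₀) *
          ∑ P ∈ T, massDensity C N G P x * ewt P.len (x - P.center) := by
          refine lintegral_mono fun x => (enorm_sum_le _ _).trans ?_
          rw [Finset.mul_sum]
          exact Finset.sum_le_sum fun P hP => enorm_mul_pairing_le hK (hφ P hP) (ha P hP) x
      _ = ENNReal.ofReal (s₁ * K₀) * ∑ P ∈ T,
          ∫⁻ x in (nbhd top)ᶜ, massDensity C N G P x * ewt P.len (x - P.center) := by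
          rw [lintegral_const_mul' _ _ ENNReal.ofReal_ne_top,
            lintegral_finsetSum _ fun P _ => by have := hmd P; fun_prop]
      _ ≤ _ := by
          gcongr
          exact hT.sum_lintegral_compl_nbhd_le hN hs₂ hmass
  have below : ∫⁻ x in nbhd top, ∑ P ∈ T with P.j ≤ κ x, ‖a P * pairing N G P (φ P) x‖ₑ
      ≤ ENNReal.ofReal (s₁ * K₀) * ENNReal.ofReal (60 * Real.pi * s₂ * top.len) := by
    calc _ ≤ ∫⁻ x in nbhd top, ENNReal.ofReal (s₁ * K₀) * ∑ P ∈ T with P.j ≤ κ x,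
          massDensity C N G P x * ewt P.len (x - P.center) := by
          refine lintegral_mono fun x => ?_
          rw [Finset.mul_sum]
          refine Finset.sum_le_sum fun P hP => ?_
          have hP' := (Finset.mem_filter.1 hP).1
          exact enorm_mul_pairing_le hK (hφ P hP') (ha P hP') x
      _ ≤ _ := by
          rw [lintegral_const_mul' _ _ ENNReal.ofReal_ne_top]
          gcongr
          exact h.lintegral_below_le hT hN hG hs₂ hmass
  have hsplit : ∀ x, ‖∑ P ∈ T, a P * pairing N G P (φ P) x‖ₑ
      ≤ (∑ P ∈ T with P.j ≤ κ x, ‖a P * pairing N G P (φ P) x‖ₑ) +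
        ‖∑ P ∈ T with κ x < P.j, a P * pairing N G P (φ P) x‖ₑ := by
    intro x
    rw [← Finset.sum_filter_add_sum_filter_not T (fun P => P.j ≤ κ x)]
    simp only [not_le]
    exact (enorm_add_le _ _).trans (add_le_add (enorm_sum_le _ _) le_rfl)
  have hmeas : Measurable fun x => ∑ P ∈ T with P.j ≤ κ x, ‖a P * pairing N G P (φ P) x‖ₑ := by
    simp_rw [Finset.sum_filter]
    refine Finset.measurable_sum _ fun P hP => Measurable.ite ?_ ?_ measurable_const
    · exact h.measurable (MeasurableSet.of_discrete (s := Set.Ici P.j))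
    · exact ((measurable_pairing hN hG (hφ P hP).measurable).const_mul _).enorm
  rw [e]
  refine (enorm_integral_le_lintegral_enorm _).trans ?_
  rw [← lintegral_add_compl _ (measurableSet_nbhd top)]
  calc _ ≤ ((∫⁻ x in nbhd top, ∑ P ∈ T with P.j ≤ κ x, ‖a P * pairing N G P (φ P) x‖ₑ) +
        ∫⁻ x in nbhd top, ‖∑ P ∈ T with κ x < P.j, a P * pairing N G P (φ P) x‖ₑ) +
        ENNReal.ofReal (s₁ * K₀) * ENNReal.ofReal (20 * Real.pi * s₂ * top.len) := by
        refine add_le_add ?_ far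
        rw [← lintegral_add_left hmeas]
        exact lintegral_mono hsplit
    _ ≤ (ENNReal.ofReal (s₁ * K₀) * ENNReal.ofReal (60 * Real.pi * s₂ * top.len) +
        ∫⁻ x in nbhd top, ‖∑ P ∈ T with κ x < P.j, a P * pairing N G P (φ P) x‖ₑ) +
        ENNReal.ofReal (s₁ * K₀) * ENNReal.ofReal (20 * Real.pi * s₂ * top.len) := by
        gcongr
    _ = _ := by
        rw [add_right_comm, ← ENNReal.ofReal_mul (by positivity), ← ENNReal.ofReal_mul (by positivity),
          ← ENNReal.ofReal_add (by positivity) (by positivity)]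
        congr 2; ring

/-- In a `1`-tree, only bi-tiles of one scale contribute at each point. -/
theorem lintegral_above_le_of_oneTree (h : IsStopping T top κ) (hT : IsTree T top)
    (hT1 : ∀ P ∈ T, ∀ Q ∈ T, P.j < Q.j → Q.ω ⊆ P.ω₁) (hC : 0 ≤ C) (hK : 0 ≤ K₀)
    (hN : Measurable N) (hs₁ : 0 ≤ s₁) (hs₂ : 0 ≤ s₂)
    (hφ : ∀ P ∈ T, IsPacket C K₀ P (φ P)) (ha : ∀ P ∈ T, ‖a P‖ ≤ s₁ * √P.len)
    (hmass : ∀ P ∈ T, ∀ P', P.le P' → mass C N G P' ≤ ENNReal.ofReal (s₂ * P'.len)) :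
    ∫⁻ x in nbhd top, ‖∑ P ∈ T with κ x < P.j, a P * pairing N G P (φ P) x‖ₑ
      ≤ ENNReal.ofReal (18 * Real.pi * 5 ^ (C / 2) * (K₀ * s₁ * s₂ * top.len)) := by
  have hpi := Real.pi_pos
  have htop := top.len_pos
  have hpt : ∀ x, ‖∑ P ∈ T with κ x < P.j, a P * pairing N G P (φ P) x‖ₑ
      ≤ ENNReal.ofReal (3 * Real.pi * s₁ * K₀) * upper T κ N G x := by
    intro x
    by_cases hx : x ∈ {y | ∃ P ∈ T, κ y < P.j ∧ N y ∈ P.ω₂}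
    · unfold upper
      rw [Set.indicator_of_mem hx]
      obtain ⟨P₀, hP₀, -, hN₀⟩ := hx
      have hscale : ∀ P ∈ T, N x ∈ P.ω₂ → P.j = P₀.j := by
        have aux : ∀ P ∈ T, ∀ Q ∈ T, N x ∈ P.ω₂ → N x ∈ Q.ω₂ → ¬ P.j < Q.j :=
            fun P hP Q hQ h1 h2 hlt =>
          Set.disjoint_left.1 P.disjoint_ω₁_ω₂ (hT1 P hP Q hQ hlt (Q.ω₂_subset h2)) h1
        intro P hP hNP
        exact le_antisymm (not_lt.1 (aux P₀ hP₀ P hP hN₀ hNP)) (not_lt.1 (aux P hP P₀ hP₀ hNP hN₀))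
      have hterm : ∀ P ∈ T, ‖a P * pairing N G P (φ P) x‖ₑ ≤ if P.j = P₀.j then
          ENNReal.ofReal (s₁ * K₀) * ‖G x‖ₑ * ewt P.len (x - P.center) else 0 := by
        intro P hP
        by_cases hNP : N x ∈ P.ω₂
        · rw [if_pos (hscale P hP hNP)]
          refine (enorm_mul_pairing_le hK (hφ P hP) (ha P hP) x).trans ?_
          rw [mul_assoc]
          gcongr
          refine (Set.indicator_le_self _ _ _).trans (mul_le_of_le_one_right' ?_)
          rw [ENNReal.ofReal_le_one]
          exact Real.rpow_le_one (P.cutoff_pos x).le (P.cutoff_le_one x) hC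
        · rw [pairing_of_notMem hNP]
          simp
      calc _ ≤ ∑ P ∈ T with κ x < P.j, ‖a P * pairing N G P (φ P) x‖ₑ := enorm_sum_le _ _
        _ ≤ ∑ P ∈ T, ‖a P * pairing N G P (φ P) x‖ₑ :=
            Finset.sum_le_sum_of_subset (Finset.filter_subset _ _)
        _ ≤ ∑ P ∈ T, if P.j = P₀.j then
            ENNReal.ofReal (s₁ * K₀) * ‖G x‖ₑ * ewt P.len (x - P.center) else 0 :=
            Finset.sum_le_sum hterm
        _ = ENNReal.ofReal (s₁ * K₀) * ‖G x‖ₑ * ∑ P ∈ T with P.j = P₀.j,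
            ewt P.len (x - P.center) := by
            rw [← Finset.sum_filter, Finset.mul_sum]
        _ ≤ ENNReal.ofReal (s₁ * K₀) * ‖G x‖ₑ * ENNReal.ofReal (3 * Real.pi) := by
            gcongr
            exact hT.sum_wt_le _ x
        _ = _ := by
            rw [mul_right_comm, ← ENNReal.ofReal_mul (by positivity)]
            congr 2; ring
    · rw [Finset.sum_eq_zero, enorm_zero]
      · exact bot_le
      intro P hP
      obtain ⟨hP, hj⟩ := Finset.mem_filter.1 hP
      rw [pairing_of_notMem fun hNP => hx ⟨P, hP, hj, hNP⟩, mul_zero]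
  calc _ ≤ ∫⁻ x in nbhd top, ENNReal.ofReal (3 * Real.pi * s₁ * K₀) * upper T κ N G x :=
        lintegral_mono hpt
    _ ≤ ENNReal.ofReal (3 * Real.pi * s₁ * K₀) *
        ENNReal.ofReal (6 * 5 ^ (C / 2) * s₂ * top.len) := by
        rw [lintegral_const_mul' _ _ ENNReal.ofReal_ne_top]
        gcongr
        exact h.lintegral_upper_le hT hC hN hs₂ hmass
    _ = _ := by
        rw [← ENNReal.ofReal_mul (by positivity)]
        congr 1; ring

end IsStopping

/-! ### The tree estimate for `2`-trees -/

/-- In a `2`-tree, the right frequency halves are nested. -/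
theorem IsTwoTree.ω₂_subset (hT : IsTwoTree T top) {P Q : BiTile u v} (hP : P ∈ T) (hQ : Q ∈ T)
    (h : P.j ≤ Q.j) : Q.ω₂ ⊆ P.ω₂ := by
  rcases h.lt_or_eq with h | h
  · exact Q.ω₂_subset.trans (hT.ω_subset hP hQ h)
  · have hl := BiTile.l_eq_of_meet h (P.ω₂_subset (hT.freq_mem hP)) (Q.ω₂_subset (hT.freq_mem hQ))
    unfold BiTile.ω₂ BiTile.freqLeft BiTile.freqLen
    rw [h, hl]

open Classical in
/-- The largest scale of a bi-tile of `T` whose right frequency half contains `N x`, or `κ x` if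
this is larger. -/
noncomputable def topScale (T : Finset (BiTile u v)) (κ : ℝ → ℤ) (N : ℝ → ℝ) (x : ℝ) : ℤ :=
  T.fold max (κ x) fun P => if N x ∈ P.ω₂ then P.j else κ x

theorem le_topScale (x : ℝ) : κ x ≤ topScale T κ N x :=
  Finset.le_fold_max _ |>.2 (.inl le_rfl)

theorem IsTree.topScale_le (hT : IsTree T top) (hκ : ∀ x, κ x ≤ top.j) (x : ℝ) :
    topScale T κ N x ≤ top.j := by
  refine Finset.fold_max_le _ |>.2 ⟨hκ x, fun P hP => ?_⟩
  split_ifs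
  · exact BiTile.le_j (hT P hP)
  · exact hκ x

theorem measurable_topScale (hκ : Measurable κ) (hN : Measurable N) (T : Finset (BiTile u v)) :
    Measurable (topScale T κ N) := by
  classical
  unfold topScale
  induction T using Finset.induction_on with
  | empty => simpa using hκ
  | insert P T hP ih =>
    simp only [Finset.fold_insert hP]
    exact (Measurable.ite (hN measurableSet_Ioo) measurable_const hκ).max ih

/-- In a `2`-tree, the condition `N x ∈ ω_{P_2}` truncates the scales from above. -/
theorem IsTwoTree.mem_ω₂_iff (hT : IsTwoTree T top) {P : BiTile u v} (hP : P ∈ T) {x : ℝ}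
    (hx : κ x < P.j) : N x ∈ P.ω₂ ↔ P.j ≤ topScale T κ N x := by
  unfold topScale
  rw [Finset.le_fold_max]
  constructor
  · intro h
    exact .inr ⟨P, hP, by rw [if_pos h]⟩
  · rintro (h | ⟨Q, hQ, h⟩)
    · omega
    · split_ifs at h with hNQ
      · exact hT.ω₂_subset hP hQ h hNQ
      · omega

/-- The average, with the weight of scale `k`, that controls truncations of `f` at scale `k`. -/
noncomputable def average (u : ℝ) (f : ℝ → ℂ) (k : ℤ) (x : ℝ) : ℝ≥0∞ :=
  (ENNReal.ofReal (scaleLen u k))⁻¹ * ∫⁻ z, ‖f z‖ₑ * ewt (scaleLen u k) (x - z)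

/-- The sums of wave packets over the large scales of a `2`-tree are controlled by averages of the
full sum. -/
theorem IsTwoTree.enorm_truncation_le (hC : 0 ≤ C) (hK : 0 ≤ K₀) (hT : IsTwoTree T top)
    (hφ : ∀ P ∈ T, IsPacket C K₀ P (φ P)) (a : BiTile u v → ℂ) :
    ∀ᵐ x, ∀ k, ‖∑ P ∈ T with k < P.j, a P * φ P x‖ₑ
      ≤ ENNReal.ofReal kernelConst * average u (fun z => ∑ P ∈ T, a P * φ P z) k x := by
  rw [ae_all_iff]
  intro k
  have hk := scaleLen_pos u k
  obtain ⟨𝓚, hcont, hbd, hconv⟩ := hT.exists_kernel hC hK hφ k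
  filter_upwards [(Filter.eventually_all_finset T).2 hconv] with x hx
  have hint : ∀ P ∈ T, Integrable fun z => φ P z * 𝓚 (x - z) := fun P hP => by
    refine ((hφ P hP).integrable hC hK).mul_bdd (c := kernelConst * (scaleLen u k)⁻¹)
      (by fun_prop) (Filter.Eventually.of_forall fun z => (hbd _).trans ?_)
    have := kernelConst_pos
    gcongr
    exact mul_le_of_le_one_right (by positivity) (wt_le_one _ _)
  have e : ∑ P ∈ T with k < P.j, a P * φ P x = ∫ z, (∑ P ∈ T, a P * φ P z) * 𝓚 (x - z) := by
    simp_rw [Finset.sum_mul, mul_assoc]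
    rw [integral_finsetSum _ fun P hP => (hint P hP).const_mul _, Finset.sum_filter]
    refine Finset.sum_congr rfl fun P hP => ?_
    rw [integral_const_mul, hx P hP, mul_ite, mul_zero]
  rw [e]
  refine (enorm_integral_le_lintegral_enorm _).trans ?_
  unfold average
  rw [← ENNReal.ofReal_inv_of_pos hk, ← mul_assoc, ← ENNReal.ofReal_mul kernelConst_pos.le,
    ← lintegral_const_mul' _ _ ENNReal.ofReal_ne_top]
  refine lintegral_mono fun z => ?_
  rw [enorm_mul, mul_left_comm]
  gcongr
  unfold ewt
  have := kernelConst_pos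
  rw [← ENNReal.ofReal_mul (by positivity), ← ofReal_norm, mul_assoc]
  exact ENNReal.ofReal_le_ofReal (hbd _)

namespace IsStopping

/-- Above the stopping time, a `2`-tree contributes the difference of two truncations. -/
theorem enorm_above_le (hC : 0 ≤ C) (hK : 0 ≤ K₀)
    (hT : IsTwoTree T top) (hφ : ∀ P ∈ T, IsPacket C K₀ P (φ P)) (a : BiTile u v → ℂ) :
    ∀ᵐ x, ‖∑ P ∈ T with κ x < P.j, a P * pairing N G P (φ P) x‖ₑ
      ≤ upper T κ N G x * (ENNReal.ofReal kernelConst *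
        (average u (fun z => ∑ P ∈ T, conj (a P) * φ P z) (κ x) x +
        average u (fun z => ∑ P ∈ T, conj (a P) * φ P z) (topScale T κ N x) x)) := by
  filter_upwards [hT.enorm_truncation_le hC hK hφ fun P => conj (a P)] with x hx
  by_cases hxU : x ∈ {y | ∃ P ∈ T, κ y < P.j ∧ N y ∈ P.ω₂}
  · have e1 : ∑ P ∈ T with κ x < P.j, a P * pairing N G P (φ P) x
        = G x * conj (∑ P ∈ T with κ x < P.j,
          if P.j ≤ topScale T κ N x then conj (a P) * φ P x else 0) := by
      rw [map_sum, Finset.mul_sum]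
      refine Finset.sum_congr rfl fun P hP => ?_
      obtain ⟨hP, hj⟩ := Finset.mem_filter.1 hP
      by_cases hNP : N x ∈ P.ω₂
      · rw [if_pos ((hT.mem_ω₂_iff hP hj).1 hNP), map_mul, Complex.conj_conj]
        unfold pairing
        rw [Set.indicator_of_mem (show x ∈ {x | N x ∈ P.ω₂} from hNP)]
        ring
      · rw [if_neg fun h => hNP ((hT.mem_ω₂_iff hP hj).2 h), pairing_of_notMem hNP]
        simp
    have e2 : (∑ P ∈ T with κ x < P.j, if P.j ≤ topScale T κ N x then conj (a P) * φ P x else 0)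
        = ∑ P ∈ T with κ x < P.j, conj (a P) * φ P x -
          ∑ P ∈ T with topScale T κ N x < P.j, conj (a P) * φ P x := by
      rw [Finset.sum_filter, Finset.sum_filter, Finset.sum_filter, ← Finset.sum_sub_distrib]
      refine Finset.sum_congr rfl fun P _ => ?_
      have := le_topScale (T := T) (κ := κ) (N := N) x
      by_cases h1 : κ x < P.j <;> by_cases h2 : topScale T κ N x < P.j
      · simp [h1, h2]
      · simp [h1, h2, not_lt.1 h2]
      · omega
      · simp [h1, h2]
    unfold upper
    rw [e1, Set.indicator_of_mem hxU, enorm_mul, RCLike.enorm_conj, e2, mul_add]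
    gcongr
    exact (enorm_sub_le).trans (add_le_add (hx _) (hx _))
  · rw [Finset.sum_eq_zero, enorm_zero]
    · exact bot_le
    intro P hP
    obtain ⟨hP, hj⟩ := Finset.mem_filter.1 hP
    rw [pairing_of_notMem fun hNP => hxU ⟨P, hP, hj, hNP⟩, mul_zero]

/-- In a `2`-tree, the part above the stopping time is estimated by Cauchy-Schwarz: one factor is
the sum of wave packets, the other one a sum of averages of `upper`, to which
`lintegral_sq_sum_le` applies because `upper` is spread out over the cells. -/
theorem lintegral_above_le_of_twoTree (h : IsStopping T top κ) (hT : IsTwoTree T top)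
    (hC : 0 ≤ C) (hK : 0 ≤ K₀) (hN : Measurable N) (hG : Measurable G)
    (hs₁ : 0 ≤ s₁) (hs₂ : 0 ≤ s₂)
    (hφ : ∀ P ∈ T, IsPacket C K₀ P (φ P)) (ha : ∑ P ∈ T, ‖a P‖ ^ 2 ≤ s₁ ^ 2 * top.len)
    (hmass : ∀ P ∈ T, ∀ P', P.le P' → mass C N G P' ≤ ENNReal.ofReal (s₂ * P'.len)) :
    ∫⁻ x in nbhd top, ‖∑ P ∈ T with κ x < P.j, a P * pairing N G P (φ P) x‖ₑ
      ≤ ENNReal.ofReal (240 * Real.pi ^ 2 * kernelConst * 5 ^ (C / 2) *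
        (K₀ * s₁ * s₂ * top.len)) := by
  have hpi := Real.pi_pos
  have htop := top.len_pos
  have hB := kernelConst_pos
  obtain ⟨m₀, hm₀⟩ := h.bddBelow
  set F := Finset.Icc m₀ top.j with hF
  set f : ℝ → ℂ := fun z => ∑ P ∈ T, conj (a P) * φ P z with hf
  have hfm : Measurable f := Finset.measurable_sum _ fun P hP => (hφ P hP).measurable.const_mul _
  set κ' := topScale T κ N with hκ'
  set W : ℝ → ℝ≥0∞ := (nbhd top).indicator (upper T κ N G) with hW
  have hWm : Measurable W := (h.measurable_upper hN hG).indicator (measurableSet_nbhd top)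
  have hκm := h.measurable
  have hκm' : Measurable κ' := measurable_topScale hκm hN T
  have hmemκ : ∀ x, κ x ∈ F := fun x => Finset.mem_Icc.2 ⟨hm₀ x, h.le_top x⟩
  have hmemκ' : ∀ x, κ' x ∈ F := fun x =>
    Finset.mem_Icc.2 ⟨(hm₀ x).trans (le_topScale x), hT.1.topScale_le h.le_top x⟩
  -- the part of `upper` on which a truncation at scale `k` is used
  set H : ℤ → ℝ → ℝ≥0∞ := fun k x =>
    W x * ((if κ x = k then 1 else 0) + if κ' x = k then 1 else 0) with hH
  have hHm : ∀ k, Measurable (H k) := fun k => hWm.mul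
    ((Measurable.ite (hκm (measurableSet_singleton k)) measurable_const measurable_const).add
    (Measurable.ite (hκm' (measurableSet_singleton k)) measurable_const measurable_const))
  have hsumH : ∀ (g : ℤ → ℝ≥0∞) x, ∑ k ∈ F, H k x * g k = W x * (g (κ x) + g (κ' x)) := by
    intro g x
    simp only [hH, mul_assoc, ← Finset.mul_sum, add_mul, Finset.sum_add_distrib, ite_mul, one_mul,
      zero_mul, Finset.sum_ite_eq, if_pos (hmemκ x), if_pos (hmemκ' x)]
  have hsumH1 : ∀ x, ∑ k ∈ F, H k x = 2 * W x := by
    intro x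
    have := hsumH (fun _ => 1) x
    simp only [mul_one] at this
    rw [this, mul_comm, one_add_one_eq_two]
  have hWint : ∫⁻ x, W x ≤ ENNReal.ofReal (6 * 5 ^ (C / 2) * s₂ * top.len) := by
    rw [hW, lintegral_indicator (measurableSet_nbhd top)]
    exact h.lintegral_upper_le hT.1 hC hN hs₂ hmass
  have hHint : ∑ k ∈ F, ∫⁻ x, H k x ≤ ENNReal.ofReal (12 * 5 ^ (C / 2) * s₂ * top.len) := by
    rw [← lintegral_finsetSum _ fun k _ => hHm k]
    simp_rw [hsumH1]
    rw [lintegral_const_mul _ hWm]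
    calc _ ≤ 2 * ENNReal.ofReal (6 * 5 ^ (C / 2) * s₂ * top.len) := by gcongr
      _ = _ := by
        rw [show (2 : ℝ≥0∞) = ENNReal.ofReal 2 by norm_num, ← ENNReal.ofReal_mul (by norm_num)]
        congr 1; ring
  have hHB : ∀ k ∈ F, ∀ x, ∑ l ∈ F with l ≤ k, ∫⁻ y, H l y * ewt (scaleLen u k) (x - y)
      ≤ ENNReal.ofReal (36 * Real.pi * 5 ^ (C / 2) * s₂) * ENNReal.ofReal (scaleLen u k) := by
    intro k _ x
    rw [← lintegral_finsetSum _ fun l _ => by have := hHm l; fun_prop]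
    have hpt : ∀ y, ∑ l ∈ F with l ≤ k, H l y * ewt (scaleLen u k) (x - y)
        ≤ 2 * (nbhd top).indicator (fun y => {y | κ y ≤ k}.indicator (upper T κ N G) y *
          ewt (scaleLen u k) (x - y)) y := by
      intro y
      rw [← Finset.sum_mul]
      by_cases hy : κ y ≤ k
      · calc (∑ l ∈ F with l ≤ k, H l y) * ewt (scaleLen u k) (x - y)
            ≤ (∑ l ∈ F, H l y) * ewt (scaleLen u k) (x - y) := by
              gcongr
              exact Finset.filter_subset _ _
          _ = _ := by
              rw [hsumH1, mul_assoc]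
              by_cases hyn : y ∈ nbhd top
              · simp only [hW, Set.indicator_of_mem hyn,
                  Set.indicator_of_mem (show y ∈ {y | κ y ≤ k} from hy)]
              · simp only [hW, Set.indicator_of_notMem hyn, zero_mul]
      · rw [Finset.sum_eq_zero, zero_mul]
        · exact bot_le
        intro l hl
        have hlk := (Finset.mem_filter.1 hl).2
        have h1 : κ y ≠ l := by omega
        have h2 : κ' y ≠ l := by
          have : κ y ≤ κ' y := le_topScale y
          omega
        simp only [hH, if_neg h1, if_neg h2, add_zero, mul_zero]
    refine (lintegral_mono hpt).trans ?_
    rw [lintegral_const_mul' _ _ (by norm_num), lintegral_indicator (measurableSet_nbhd top)]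
    calc _ ≤ 2 * (ENNReal.ofReal (18 * Real.pi * 5 ^ (C / 2) * s₂) *
          ENNReal.ofReal (scaleLen u k)) := by
          gcongr
          exact h.lintegral_upper_mul_ewt_le hT.1 hC hN hs₂ hmass k x
      _ = _ := by
        rw [← mul_assoc, show (2 : ℝ≥0∞) = ENNReal.ofReal 2 by norm_num,
          ← ENNReal.ofReal_mul (by norm_num)]
        congr 2; ring
  set A : ℝ → ℝ≥0∞ := fun z =>
    ∑ k ∈ F, (ENNReal.ofReal (scaleLen u k))⁻¹ * ∫⁻ x, H k x * ewt (scaleLen u k) (x - z) with hA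
  have hAm : Measurable A := by
    refine Finset.measurable_sum _ fun k _ => Measurable.const_mul ?_ _
    have := hHm k
    exact Measurable.lintegral_prod_left' (f := fun p : ℝ × ℝ => H k p.1 *
      ewt (scaleLen u k) (p.1 - p.2)) (by fun_prop)
  have hmono : Monotone (scaleLen u) := fun k l hkl => scaleLen_le_iff.2 hkl
  have hA2 : ∫⁻ z, A z ^ 2 ≤ ENNReal.ofReal ((60 * Real.pi * 5 ^ (C / 2) * s₂ * √top.len) ^ 2) := by
    refine (lintegral_sq_sum_le (scaleLen_pos u) hmono hHm hHB).trans ?_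
    calc _ ≤ ENNReal.ofReal (8 * Real.pi) * ENNReal.ofReal (36 * Real.pi * 5 ^ (C / 2) * s₂) *
          ENNReal.ofReal (12 * 5 ^ (C / 2) * s₂ * top.len) := by gcongr
      _ ≤ _ := by
        rw [← ENNReal.ofReal_mul (by positivity), ← ENNReal.ofReal_mul (by positivity)]
        refine ENNReal.ofReal_le_ofReal ?_
        rw [mul_pow, Real.sq_sqrt htop.le]
        have : 0 ≤ Real.pi ^ 2 * (5 ^ (C / 2)) ^ 2 * s₂ ^ 2 * top.len := by positivity
        linarith
  have hf2 : ∫⁻ z, ‖f z‖ₑ ^ 2 ≤ ENNReal.ofReal ((4 * Real.pi * K₀ * s₁ * √top.len) ^ 2) := by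
    refine (hT.lintegral_sq_le hC hK hφ fun P => conj (a P)).trans (ENNReal.ofReal_le_ofReal ?_)
    simp only [RCLike.norm_conj]
    rw [mul_pow, Real.sq_sqrt htop.le]
    calc _ ≤ 12 * Real.pi ^ 2 * K₀ ^ 2 * (s₁ ^ 2 * top.len) := by gcongr
      _ ≤ _ := by
        have : 0 ≤ Real.pi ^ 2 * K₀ ^ 2 * s₁ ^ 2 * top.len := by positivity
        linarith
  have hswap : ∫⁻ x, ∑ k ∈ F, H k x * average u f k x = ∫⁻ z, ‖f z‖ₑ * A z := by
    have hk1 : ∀ k, ∀ x, H k x * average u f k x = ∫⁻ z, (ENNReal.ofReal (scaleLen u k))⁻¹ *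
        (‖f z‖ₑ * (H k x * ewt (scaleLen u k) (x - z))) := by
      intro k x
      unfold average
      rw [← lintegral_const_mul _ (by fun_prop), ← lintegral_const_mul _ (by fun_prop)]
      refine lintegral_congr fun z => ?_
      ring
    have hk2 : ∀ z, ‖f z‖ₑ * A z = ∑ k ∈ F, ∫⁻ x, (ENNReal.ofReal (scaleLen u k))⁻¹ *
        (‖f z‖ₑ * (H k x * ewt (scaleLen u k) (x - z))) := by
      intro z
      rw [hA, Finset.mul_sum]
      refine Finset.sum_congr rfl fun k _ => ?_
      have := hHm k
      rw [lintegral_const_mul _ (by fun_prop), lintegral_const_mul _ (by fun_prop)]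
      ring
    simp_rw [hk1, hk2]
    have hjoint : ∀ k, Measurable fun p : ℝ × ℝ => (ENNReal.ofReal (scaleLen u k))⁻¹ *
        (‖f p.2‖ₑ * (H k p.1 * ewt (scaleLen u k) (p.1 - p.2))) := fun k => by
      have := hHm k
      fun_prop
    rw [lintegral_finsetSum _ fun k _ => (hjoint k).lintegral_prod_right',
      lintegral_finsetSum _ fun k _ => (hjoint k).lintegral_prod_left']
    exact Finset.sum_congr rfl fun k _ => lintegral_lintegral_swap (hjoint k).aemeasurable
  calc _ ≤ ∫⁻ x in nbhd top, upper T κ N G x * (ENNReal.ofReal kernelConst *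
        (average u f (κ x) x + average u f (κ' x) x)) :=
        lintegral_mono_ae (ae_restrict_of_ae (enorm_above_le hC hK hT hφ a))
    _ = ENNReal.ofReal kernelConst * ∫⁻ x, ∑ k ∈ F, H k x * average u f k x := by
        rw [← lintegral_const_mul' _ _ ENNReal.ofReal_ne_top,
          ← lintegral_indicator (measurableSet_nbhd top)]
        refine lintegral_congr fun x => ?_
        rw [hsumH (fun k => average u f k x)]
        by_cases hx : x ∈ nbhd top
        · simp only [hW, Set.indicator_of_mem hx]; ring
        · simp only [hW, Set.indicator_of_notMem hx, zero_mul, mul_zero]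
    _ ≤ ENNReal.ofReal kernelConst * ENNReal.ofReal ((4 * Real.pi * K₀ * s₁ * √top.len) *
        (60 * Real.pi * 5 ^ (C / 2) * s₂ * √top.len)) := by
        rw [hswap]
        gcongr
        exact lintegral_mul_le_of_sq hfm.enorm.aemeasurable hAm.aemeasurable (by positivity)
          (by positivity) hf2 hA2
    _ = _ := by
        rw [← ENNReal.ofReal_mul hB.le]
        congr 1
        have hs : √top.len * √top.len = top.len := Real.mul_self_sqrt htop.le
        linear_combination 240 * Real.pi ^ 2 * kernelConst * 5 ^ (C / 2) * K₀ * s₁ * s₂ * hs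

end IsStopping

/-! ### The estimate for trees of all types -/

/-- The constant of the tree estimate. The three terms come from the points far from the top or
below the stopping time, from `IsStopping.lintegral_above_le_of_oneTree` and from
`IsStopping.lintegral_above_le_of_twoTree`. -/
noncomputable def treeConst (C K₀ : ℝ) : ℝ :=
  K₀ * (160 * Real.pi + 18 * Real.pi * 5 ^ (C / 2) +
    240 * Real.pi ^ 2 * kernelConst * 5 ^ (C / 2))

theorem le_treeConst (hK : 0 ≤ K₀) : K₀ ≤ treeConst C K₀ := by
  have hpi := Real.pi_gt_three
  have := kernelConst_pos
  refine le_mul_of_one_le_right hK ?_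
  have h1 : 0 ≤ 18 * Real.pi * 5 ^ (C / 2) := by positivity
  have h2 : 0 ≤ 240 * Real.pi ^ 2 * kernelConst * 5 ^ (C / 2) := by positivity
  linarith

/-- The tree estimate. The bi-tiles of a tree are divided into those of a `2`-tree and those whose
left frequency half contains the frequency interval of the top. -/
theorem IsTree.norm_sum_le (hT : IsTree T top) (hC : 0 ≤ C) (hK : 0 ≤ K₀)
    (hN : Measurable N) (hG : Measurable G) (hφ : ∀ P ∈ T, IsPacket C K₀ P (φ P))
    (hint : ∀ P ∈ T, Integrable (pairing N G P (φ P))) (hs₁ : 0 ≤ s₁) (hs₂ : 0 ≤ s₂)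
    (ha : HasSize a T s₁)
    (hmass : ∀ P ∈ T, ∀ P', P.le P' → mass C N G P' ≤ ENNReal.ofReal (s₂ * P'.len)) :
    ‖∑ P ∈ T, a P * coeff N G P (φ P)‖ ≤ treeConst C K₀ * (s₁ * s₂) * top.len := by
  classical
  have hpi := Real.pi_pos
  have htop := top.len_pos
  have hB := kernelConst_pos
  set X := K₀ * s₁ * s₂ * top.len with hX
  have hX0 : 0 ≤ X := by positivity
  -- for either part of the tree, only the bi-tiles above a stopping time matter
  have reduce : ∀ S ⊆ T, ∀ c : ℝ, 0 ≤ c → (∀ κ, IsStopping S top κ →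
      ∫⁻ x in nbhd top, ‖∑ P ∈ S with κ x < P.j, a P * pairing N G P (φ P) x‖ₑ
        ≤ ENNReal.ofReal (c * X)) →
      ‖∑ P ∈ S, a P * coeff N G P (φ P)‖ ≤ (80 * Real.pi + c) * X := by
    intro S hS c hc habove
    obtain ⟨κ, hκ⟩ := exists_isStopping S top
    have h := hκ.enorm_sum_mul_coeff_le (hT.mono hS) hK hN hG hs₁ hs₂ (fun P hP => hφ P (hS hP))
      (fun P hP => ha.norm_le hs₁ (hS hP)) (fun P hP => hint P (hS hP))
      (fun P hP => hmass P (hS hP) P P.le_refl)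
    have h' := h.trans (add_le_add le_rfl (habove κ hκ))
    rw [← ENNReal.ofReal_add (by positivity) (by positivity), ← ofReal_norm,
      ENNReal.ofReal_le_ofReal_iff (by positivity), ← add_mul] at h'
    exact h'
  set T₂ := T.filter fun P => top.ω₂ ⊆ P.ω₂ with hT₂
  set T₁ := T.filter fun P => ¬ top.ω₂ ⊆ P.ω₂ with hT₁
  have hsub₂ : T₂ ⊆ T := Finset.filter_subset _ _
  have hsub₁ : T₁ ⊆ T := Finset.filter_subset _ _
  have h2 := reduce T₂ hsub₂ (240 * Real.pi ^ 2 * kernelConst * 5 ^ (C / 2)) (by positivity)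
    fun κ hκ => by
      have htwo : IsTwoTree T₂ top := ⟨hT.mono hsub₂, fun P hP => (Finset.mem_filter.1 hP).2⟩
      exact hκ.lintegral_above_le_of_twoTree htwo hC hK hN hG hs₁ hs₂ (fun P hP => hφ P (hsub₂ hP))
        (ha T₂ hsub₂ top htwo) fun P hP => hmass P (hsub₂ hP)
  have h1 := reduce T₁ hsub₁ (18 * Real.pi * 5 ^ (C / 2)) (by positivity) fun κ hκ => by
    refine hκ.lintegral_above_le_of_oneTree (hT.mono hsub₁) (fun P hP Q hQ hlt => ?_) hC hK hN hs₁
      hs₂ (fun P hP => hφ P (hsub₁ hP)) (fun P hP => ha.norm_le hs₁ (hsub₁ hP))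
      fun P hP => hmass P (hsub₁ hP)
    obtain ⟨hP, hP2⟩ := Finset.mem_filter.1 hP
    have hPω := ((BiTile.subset_ω₂_or_subset_ω₁ (hT P hP)).resolve_left hP2).2
    exact BiTile.ω_subset_ω₁ hlt (hPω top.freqMid_mem) ((hT Q (hsub₁ hQ)).2 top.freqMid_mem)
  rw [← Finset.sum_filter_add_sum_filter_not T (fun P => top.ω₂ ⊆ P.ω₂)]
  refine (norm_add_le _ _).trans ((add_le_add h2 h1).trans (le_of_eq ?_))
  rw [hX]
  unfold treeConst
  ring

/-- The coefficients are controlled by the masses. -/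
theorem enorm_coeff_le (hK : 0 ≤ K₀) (hN : Measurable N) {P : BiTile u v} {φ : ℝ → ℂ}
    (hφ : IsPacket C K₀ P φ) :
    ‖coeff N G P φ‖ₑ ≤ ENNReal.ofReal (K₀ * (√P.len)⁻¹) * mass C N G P := by
  refine (enorm_integral_le_lintegral_enorm _).trans ?_
  rw [← lintegral_massDensity hN, ← lintegral_const_mul' _ _ ENNReal.ofReal_ne_top]
  refine lintegral_mono fun x => (enorm_pairing_le hK hφ x).trans ?_
  gcongr
  refine mul_le_of_le_one_right' ?_
  unfold ewt
  rw [ENNReal.ofReal_le_one]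
  exact wt_le_one _ _

/-- For disjoint bi-tiles the tree estimate is trivial, and uses only the masses of the bi-tiles
themselves: a tree of disjoint bi-tiles has disjoint time intervals. -/
theorem IsTree.norm_sum_le_of_disjoint (hT : IsTree T top)
    (hd : DisjointBiTiles (T : Set (BiTile u v))) (hK : 0 ≤ K₀) (hN : Measurable N)
    (hφ : ∀ P ∈ T, IsPacket C K₀ P (φ P)) (hs₁ : 0 ≤ s₁) (hs₂ : 0 ≤ s₂) (ha : HasSize a T s₁)
    (hmass : ∀ P ∈ T, mass C N G P ≤ ENNReal.ofReal (s₂ * P.len)) :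
    ‖∑ P ∈ T, a P * coeff N G P (φ P)‖ ≤ treeConst C K₀ * (s₁ * s₂) * top.len := by
  have htop := top.len_pos
  have hterm : ∀ P ∈ T, ‖a P * coeff N G P (φ P)‖ ≤ K₀ * (s₁ * s₂) * P.len := by
    intro P hP
    have hp := P.len_pos
    have hl : 0 < √P.len := Real.sqrt_pos.2 hp
    rw [← ENNReal.ofReal_le_ofReal_iff (by positivity), ofReal_norm, enorm_mul]
    calc _ ≤ ‖a P‖ₑ * (ENNReal.ofReal (K₀ * (√P.len)⁻¹) * ENNReal.ofReal (s₂ * P.len)) := by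
          gcongr
          exact (enorm_coeff_le hK hN (hφ P hP)).trans (mul_le_mul' le_rfl (hmass P hP))
      _ ≤ ENNReal.ofReal (s₁ * K₀) * ENNReal.ofReal (s₂ * P.len) := by
          rw [← mul_assoc]
          exact mul_le_mul' (enorm_mul_ofReal_le hK (ha.norm_le hs₁ hP)) le_rfl
      _ = _ := by
          rw [← ENNReal.ofReal_mul (by positivity)]
          congr 1; ring
  have hlen : ∑ P ∈ T, P.len ≤ top.len := by
    have hpd : (T : Set (BiTile u v)).PairwiseDisjoint BiTile.I := by
      intro P hP Q hQ hne
      refine Set.disjoint_left.2 fun x hx hx' => ?_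
      have hP' : (x, top.freqLeft + top.freqLen / 2) ∈ P.rect := ⟨hx, (hT P hP).2 top.freqMid_mem⟩
      have hQ' : (x, top.freqLeft + top.freqLen / 2) ∈ Q.rect := ⟨hx', (hT Q hQ).2 top.freqMid_mem⟩
      exact Set.disjoint_left.1 (hd hP hQ hne) hP' hQ'
    rw [← ENNReal.ofReal_le_ofReal_iff htop.le, ENNReal.ofReal_sum_of_nonneg
      fun P _ => P.len_pos.le]
    simp_rw [← BiTile.volume_I]
    rw [← measure_biUnion_finset hpd fun P _ => measurableSet_Ioo]
    exact measure_mono (Set.iUnion₂_subset fun P hP => (hT P hP).1)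
  calc _ ≤ ∑ P ∈ T, ‖a P * coeff N G P (φ P)‖ := _root_.norm_sum_le _ _
    _ ≤ ∑ P ∈ T, K₀ * (s₁ * s₂) * P.len := Finset.sum_le_sum hterm
    _ = K₀ * (s₁ * s₂) * ∑ P ∈ T, P.len := (Finset.mul_sum _ _ _).symm
    _ ≤ _ := by
        have := le_treeConst (C := C) hK
        have hsum : 0 ≤ ∑ P ∈ T, P.len := Finset.sum_nonneg fun P _ => P.len_pos.le
        gcongr
        exact mul_nonneg (hK.trans this) (by positivity)

/-! ### Non-degeneracy of the sizes and energies -/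

variable {𝒬 : Finset (BiTile u v)}

theorem isTwoTree_singleton (P : BiTile u v) : IsTwoTree {P} P :=
  ⟨fun Q hQ => by rw [Finset.mem_singleton.1 hQ]; exact P.le_refl,
    fun Q hQ => by rw [Finset.mem_singleton.1 hQ]⟩

theorem size₁_ne_zero {P : BiTile u v} (hP : P ∈ 𝒬) (ha : a P ≠ 0) : size₁ 𝒬 a ≠ 0 := by
  have hp := P.len_pos
  have ha' := norm_pos_iff.2 ha
  refine ne_of_gt (lt_of_lt_of_le ?_ (le_iSup₂_of_le {P} P (le_iSup₂_of_le
    (Finset.singleton_subset_iff.2 hP) (isTwoTree_singleton P) le_rfl)))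
  rw [Finset.sum_singleton, ENNReal.ofReal_pos]
  positivity

theorem size₁_ne_top (𝒬 : Finset (BiTile u v)) (a : BiTile u v → ℂ) : size₁ 𝒬 a ≠ ⊤ := by
  refine ne_top_of_le_ne_top (b := ENNReal.ofReal (√(∑ P ∈ 𝒬, ‖a P‖ ^ 2 / P.len)))
    ENNReal.ofReal_ne_top (iSup₂_le fun T top => iSup₂_le fun hT htop => ?_)
  refine ENNReal.ofReal_le_ofReal (Real.sqrt_le_sqrt ?_)
  rw [Finset.mul_sum]
  refine (Finset.sum_le_sum fun P hP => ?_).trans (Finset.sum_le_sum_of_subset_of_nonneg hT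
    fun P _ _ => div_nonneg (sq_nonneg _) P.len_pos.le)
  have := P.len_pos
  rw [one_div_mul_eq_div]
  gcongr
  exact BiTile.le_len (htop.1 P hP)

theorem hasSize_size₁ (𝒬 : Finset (BiTile u v)) (a : BiTile u v → ℂ) :
    HasSize a 𝒬 (size₁ 𝒬 a).toReal := by
  intro T hT top htop
  have hp := top.len_pos
  have h : ENNReal.ofReal (√((1 / top.len) * ∑ P ∈ T, ‖a P‖ ^ 2)) ≤ size₁ 𝒬 a :=
    le_iSup₂_of_le T top (le_iSup₂_of_le hT htop le_rfl)
  rw [ENNReal.ofReal_le_iff_le_toReal (size₁_ne_top 𝒬 a), Real.sqrt_le_iff,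
    one_div_mul_eq_div, div_le_iff₀ hp] at h
  exact h.2

theorem energy₁_ne_zero {P : BiTile u v} (hP : P ∈ 𝒬) (ha : a P ≠ 0) : energy₁ 𝒬 a ≠ 0 := by
  have hp := P.len_pos
  have ha' := norm_pos_iff.2 ha
  have hl : 0 < √P.len := Real.sqrt_pos.2 hp
  obtain ⟨n, hn1, hn2⟩ := exists_mem_Ico_zpow (div_pos ha' hl) (one_lt_two (α := ℝ))
  rw [le_div_iff₀ hl] at hn1
  rw [div_lt_iff₀ hl] at hn2
  have hfam : IsEnergyFamily 𝒬 a n {({P}, P)} := by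
    refine ⟨?_, ?_, Set.pairwise_singleton _ _, ?_, ?_⟩
    · rintro t rfl
      exact Finset.singleton_subset_iff.2 hP
    · rintro t rfl
      exact isTwoTree_singleton P
    · rintro t rfl
      unfold l2norm
      rw [Finset.sum_singleton, Real.sqrt_sq ha'.le]
      exact hn1
    · rintro t rfl T' top' hT' htop'
      unfold l2norm
      rcases Finset.subset_singleton_iff.1 hT' with rfl | rfl
      · rw [Finset.sum_empty, Real.sqrt_zero]; positivity
      · have := BiTile.le_len (htop' P (Finset.mem_singleton_self P))
        rw [Finset.sum_singleton, Real.sqrt_sq ha'.le]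
        refine hn2.le.trans ?_
        gcongr
  refine ne_of_gt (lt_of_lt_of_le ?_ (le_iSup₂_of_le n {({P}, P)} (le_iSup_of_le hfam le_rfl)))
  refine ENNReal.mul_pos (ENNReal.zpow_pos (by norm_num) (by norm_num) n).ne' ?_
  rw [tsum_fintype]
  simp [hp]

theorem energy_ne_zero {P : BiTile u v} (hP : P ∈ 𝒬) (hm : mass C N G P ≠ 0) :
    energy 𝒬 C N G ≠ 0 := by
  have hp := P.len_pos
  have hr : 0 < (min (mass C N G P) 1).toReal :=
    ENNReal.toReal_pos (by simp [hm]) (by simp)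
  obtain ⟨n, hn, -⟩ := exists_mem_Ico_zpow (div_pos hr hp) (one_lt_two (α := ℝ))
  rw [le_div_iff₀ hp] at hn
  have h := ofReal_sum_le_energy (𝒬 := 𝒬) (C := C) (N := N) (G := G) n (𝒟 := {P}) (D := {P})
    (Set.pairwise_singleton _ _) (by
      rintro P' rfl
      refine ⟨⟨P', hP, P'.le_refl⟩, ?_⟩
      refine (ENNReal.ofReal_le_ofReal hn).trans ?_
      rw [ENNReal.ofReal_toReal (by simp)]
      exact min_le_left _ _) (by simp)
  rw [Finset.sum_singleton] at h
  refine (lt_of_lt_of_le ?_ h).ne'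
  rw [ENNReal.ofReal_pos]
  positivity

/-! ### The bound in terms of sizes and energies -/

/-- The passage from selection lemmas and a tree estimate to the final bound in `ℝ≥0∞`, where all
degenerate cases are dealt with. The size `σ` of the second sequence is kept abstract. -/
theorem enorm_sum_le_of_treeEstimate {θ₁ θ₂ : ℝ} (h0 : 0 ≤ θ₁) (h1 : θ₁ < 1) (hθ₂ : 0 < θ₂)
    (h12 : θ₁ + 2 * θ₂ = 1) {c : ℝ} (hc : 0 ≤ c) {b : BiTile u v → ℂ}
    {p : BiTile u v → ℝ → Prop} (hp : ∀ P s s', p P s → s ≤ s' → p P s') {σ : ℝ≥0∞}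
    (hb : ∀ P ∈ 𝒬, b P ≠ 0 → mass C N G P ≠ 0)
    (hσ : ∀ P ∈ 𝒬, mass C N G P ≠ 0 → σ ≠ 0)
    (hσp : σ ≠ ⊤ → ∀ P ∈ 𝒬, p P σ.toReal)
    (hsel : energy 𝒬 C N G ≠ ⊤ → ∀ 𝒬' ⊆ 𝒬, ∀ m : ℤ, ∃ D : Finset (BiTile u v),
      (2 : ℝ) ^ m * ∑ t ∈ D, t.len ≤ (energy 𝒬 C N G).toReal ∧ ∀ P ∈ remainder 𝒬' D, p P (2 ^ m))
    (htree : ∀ T ⊆ 𝒬, ∀ top, IsTree T top → ∀ s₁ s₂, 0 ≤ s₁ → 0 ≤ s₂ → HasSize a T s₁ →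
      (∀ P ∈ T, p P s₂) → ‖∑ P ∈ T, a P * b P‖ ≤ c * (s₁ * s₂) * top.len) :
    ‖∑ P ∈ 𝒬, a P * b P‖ₑ ≤ ((c * (128 * 2 ^ (1 - θ₁) / (2 ^ (1 - θ₁) - 1))).toNNReal + 1 : ℝ≥0) *
      (size₁ 𝒬 a ^ θ₁ * σ ^ θ₂ * energy₁ 𝒬 a ^ (1 - θ₁) * energy 𝒬 C N G ^ (1 - θ₂)) := by
  by_cases hex : ∃ P ∈ 𝒬, a P * b P ≠ 0
  swap
  · push Not at hex
    rw [Finset.sum_eq_zero hex, enorm_zero]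
    exact bot_le
  -- a non-vanishing summand makes all four quantities positive, so that no factor `0` cancels a `⊤`
  obtain ⟨P, hP, hab⟩ := hex
  have haP := left_ne_zero_of_mul hab
  have hmP := hb P hP (right_ne_zero_of_mul hab)
  have z1 := size₁_ne_zero hP haP
  have z2 := hσ P hP hmP
  have z3 := energy₁_ne_zero hP haP
  have z4 := energy_ne_zero hP hmP
  have t1 := size₁_ne_top 𝒬 a
  have e3 : 0 < 1 - θ₁ := by linarith
  have e4 : 0 < 1 - θ₂ := by linarith
  have rpow_ne_zero : ∀ {x : ℝ≥0∞} {y : ℝ}, x ≠ 0 → 0 ≤ y → x ^ y ≠ 0 := fun hx hy h => by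
    rcases ENNReal.rpow_eq_zero_iff.1 h with h | h
    · exact hx h.1
    · linarith [h.2]
  have y1 := rpow_ne_zero z1 h0
  have y2 := rpow_ne_zero z2 hθ₂.le
  have y3 := rpow_ne_zero z3 e3.le
  have y4 := rpow_ne_zero z4 e4.le
  have hA : (((c * (128 * 2 ^ (1 - θ₁) / (2 ^ (1 - θ₁) - 1))).toNNReal + 1 : ℝ≥0) : ℝ≥0∞) ≠ 0 := by
    rw [ENNReal.coe_ne_zero]
    positivity
  by_cases t2 : σ = ⊤
  · rw [t2, ENNReal.top_rpow_of_pos hθ₂, ENNReal.mul_top y1, ENNReal.top_mul y3,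
      ENNReal.top_mul y4, ENNReal.mul_top hA]
    exact le_top
  by_cases t3 : energy₁ 𝒬 a = ⊤
  · rw [t3, ENNReal.top_rpow_of_pos e3, ENNReal.mul_top (mul_ne_zero y1 y2), ENNReal.top_mul y4,
      ENNReal.mul_top hA]
    exact le_top
  by_cases t4 : energy 𝒬 C N G = ⊤
  · rw [t4, ENNReal.top_rpow_of_pos e4, ENNReal.mul_top (mul_ne_zero (mul_ne_zero y1 y2) y3),
      ENNReal.mul_top hA]
    exact le_top
  have r1 := ENNReal.toReal_pos z1 t1
  have r2 := ENNReal.toReal_pos z2 t2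
  have r3 := ENNReal.toReal_pos z3 t3
  have r4 := ENNReal.toReal_pos z4 t4
  have main := norm_sum_le_of_selection h0 h1 hθ₂ h12 r3 r4 r1 r2 hc hp
    (fun 𝒬' h𝒬' m hs => exists_tops_energy₁ t3 h𝒬' m hs) (hsel t4) htree (hasSize_size₁ 𝒬 a)
    (hσp t2)
  generalize c * (128 * 2 ^ (1 - θ₁) / (2 ^ (1 - θ₁) - 1)) = c' at main ⊢
  rw [← ofReal_norm]
  refine (ENNReal.ofReal_le_ofReal main).trans ?_
  have conv : ∀ {x : ℝ≥0∞} {y : ℝ}, x ≠ ⊤ → 0 < x.toReal → ENNReal.ofReal (x.toReal ^ y) = x ^ y :=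
    fun hx hx0 => by rw [← ENNReal.ofReal_rpow_of_pos hx0, ENNReal.ofReal_toReal hx]
  rw [ENNReal.ofReal_mul' (by positivity), ENNReal.ofReal_mul (by positivity),
    ENNReal.ofReal_mul (by positivity), ENNReal.ofReal_mul (by positivity), conv t1 r1, conv t2 r2,
    conv t3 r3, conv t4 r4]
  refine mul_le_mul' ?_ le_rfl
  rw [ENNReal.ofReal, ENNReal.coe_le_coe]
  exact le_self_add

theorem size_ne_zero {P : BiTile u v} (hP : P ∈ 𝒬) (hm : mass C N G P ≠ 0) :
    size 𝒬 C N G ≠ 0 := by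
  refine (lt_of_lt_of_le ?_ (le_iSup₂_of_le P hP (le_iSup₂_of_le P P.le_refl le_rfl))).ne'
  exact ENNReal.div_pos hm ENNReal.ofReal_ne_top

theorem sizeE_ne_zero {P : BiTile u v} (hP : P ∈ 𝒬) (hm : mass C N G P ≠ 0) :
    sizeE 𝒬 C N G ≠ 0 := by
  refine (lt_of_lt_of_le ?_ (le_iSup₂_of_le P hP le_rfl)).ne'
  exact ENNReal.div_pos hm ENNReal.ofReal_ne_top

theorem mass_le_of_div_le {P : BiTile u v} {σ : ℝ≥0∞} (hσ : σ ≠ ⊤)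
    (h : mass C N G P / ENNReal.ofReal P.len ≤ σ) :
    mass C N G P ≤ ENNReal.ofReal (σ.toReal * P.len) := by
  have hp := P.len_pos
  rw [ENNReal.ofReal_mul ENNReal.toReal_nonneg, ENNReal.ofReal_toReal hσ]
  exact (ENNReal.div_le_iff (by simpa using hp) ENNReal.ofReal_ne_top).1 h

theorem mass_congr {G G' : ℝ → ℂ} (h : G =ᵐ[volume] G') :
    (mass C N G : BiTile u v → ℝ≥0∞) = mass C N G' := by
  funext P
  exact lintegral_congr_ae (ae_restrict_of_ae (h.mono fun x hx => by simp only [hx]))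

theorem pairing_congr {G G' : ℝ → ℂ} (h : G =ᵐ[volume] G') (P : BiTile u v) (φ : ℝ → ℂ) :
    pairing N G P φ =ᵐ[volume] pairing N G' P φ :=
  h.mono fun x hx => by simp only [pairing, Set.indicator, hx]

end

end Bicarleson

open Bicarleson in
theorem proposition10 :
    ∃ C₀ : ℝ, ∀ C : ℝ, C₀ ≤ C →
    ∀ θ₁ θ₂ : ℝ, 0 ≤ θ₁ → θ₁ < 1 → 0 < θ₂ → θ₂ ≤ 1 → θ₁ + 2 * θ₂ = 1 →
    ∀ K : ℕ → ℝ, ∃ A : ℝ≥0,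
    ∀ u v : ℝ, u ∈ Set.Icc (-1 : ℝ) 1 →
    ∀ (𝒬 : Finset (Bicarleson.BiTile u v)) (φ : Bicarleson.BiTile u v → ℝ → ℂ),
    (∀ P ∈ 𝒬, Bicarleson.IsWavePacket K P (φ P)) →
    ∀ (N : ℝ → ℝ) (G : ℝ → ℂ), Measurable N → MeasureTheory.AEStronglyMeasurable G →
    (∀ P ∈ 𝒬, MeasureTheory.Integrable
      fun x => ({x | N x ∈ P.ω₂}.indicator G x) * conj (φ P x)) →
    ∀ a : Bicarleson.BiTile u v → ℂ,
      ‖∑ P ∈ 𝒬, a P * Bicarleson.coeff N G P (φ P)‖ₑ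
          ≤ A * (Bicarleson.size₁ 𝒬 a ^ θ₁ * Bicarleson.size 𝒬 C N G ^ θ₂
              * Bicarleson.energy₁ 𝒬 a ^ (1 - θ₁) * Bicarleson.energy 𝒬 C N G ^ (1 - θ₂))
      ∧ (Bicarleson.DisjointBiTiles (𝒬 : Set (Bicarleson.BiTile u v)) →
        ‖∑ P ∈ 𝒬, a P * Bicarleson.coeff N G P (φ P)‖ₑ
          ≤ A * (Bicarleson.size₁ 𝒬 a ^ θ₁ * Bicarleson.sizeE 𝒬 C N G ^ θ₂
              * Bicarleson.energy₁ 𝒬 a ^ (1 - θ₁) * Bicarleson.energy 𝒬 C N G ^ (1 - θ₂))) := by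
  refine ⟨0, fun C hC θ₁ θ₂ h0 h1 hθ₂ _ h12 K => ?_⟩
  set K₀ := |K (⌈C⌉₊ + 2)| with hK₀
  have hK : 0 ≤ K₀ := abs_nonneg _
  have hc : 0 ≤ treeConst C K₀ := hK.trans (le_treeConst hK)
  refine ⟨(treeConst C K₀ * (128 * 2 ^ (1 - θ₁) / (2 ^ (1 - θ₁) - 1))).toNNReal + 1,
    fun u v _ 𝒬 φ hφ N G₀ hN hG₀ hint₀ a => ?_⟩
  -- everything depends on `G₀` only up to null sets, so it may be replaced by a measurable function
  obtain ⟨G, hGm, hGe⟩ := hG₀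
  have hG := hGm.measurable
  have hmeq : (mass C N G₀ : BiTile u v → ℝ≥0∞) = mass C N G := mass_congr hGe
  have hcoeff : ∀ P : BiTile u v, coeff N G₀ P (φ P) = coeff N G P (φ P) := fun P =>
    MeasureTheory.integral_congr_ae (pairing_congr hGe P (φ P))
  have hsize : size 𝒬 C N G₀ = size 𝒬 C N G := by simp only [size, hmeq]
  have hsizeE : sizeE 𝒬 C N G₀ = sizeE 𝒬 C N G := by simp only [sizeE, hmeq]
  have henergy : energy 𝒬 C N G₀ = energy 𝒬 C N G := by simp only [energy, hmeq]
  simp only [hcoeff, hsize, hsizeE, henergy]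
  have hint : ∀ P ∈ 𝒬, MeasureTheory.Integrable (pairing N G P (φ P)) := fun P hP =>
    (hint₀ P hP).congr (pairing_congr hGe P (φ P))
  have hpk : ∀ P ∈ 𝒬, IsPacket C K₀ P (φ P) := fun P hP => (hφ P hP).isPacket C
  have hb : ∀ P ∈ 𝒬, coeff N G P (φ P) ≠ 0 → mass C N G P ≠ 0 := by
    intro P hP hne hm
    have := enorm_coeff_le (G := G) hK hN (hpk P hP)
    rw [hm, mul_zero, nonpos_iff_eq_zero, enorm_eq_zero] at this
    exact hne this
  constructor
  · refine enorm_sum_le_of_treeEstimate h0 h1 hθ₂ h12 hc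
      (p := fun P s => ∀ P', P.le P' → mass C N G P' ≤ ENNReal.ofReal (s * P'.len))
      (fun P s s' h hs P' hP' => (h P' hP').trans ?_) hb (fun P hP => size_ne_zero hP)
      (fun ht P hP P' hP' => mass_le_of_div_le ht
        (le_iSup₂_of_le P hP (le_iSup₂_of_le P' hP' le_rfl)))
      (fun hE 𝒬' h𝒬' m => exists_tops_energy hE h𝒬' m)
      (fun T hTQ top hT s₁ s₂ hs₁ hs₂ ha hm => hT.norm_sum_le hC hK hN hG
        (fun P hP => hpk P (hTQ hP)) (fun P hP => hint P (hTQ hP)) hs₁ hs₂ ha hm)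
    have := P'.len_pos
    gcongr
  · intro hd
    refine enorm_sum_le_of_treeEstimate h0 h1 hθ₂ h12 hc
      (p := fun P s => mass C N G P ≤ ENNReal.ofReal (s * P.len))
      (fun P s s' h hs => h.trans ?_) hb (fun P hP => sizeE_ne_zero hP)
      (fun ht P hP => mass_le_of_div_le ht (le_iSup₂_of_le P hP le_rfl))
      (fun hE 𝒬' h𝒬' m => exists_tops_energy_of_disjoint hE hd h𝒬' m)
      (fun T hTQ top hT s₁ s₂ hs₁ hs₂ ha hm => hT.norm_sum_le_of_disjoint
        (hd.mono (Finset.coe_subset.2 hTQ)) hK hN (fun P hP => hpk P (hTQ hP)) hs₁ hs₂ ha hm)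
    have := P.len_pos
    gcongr
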